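/- Let $U\subset\mathbb{R}$ be an open interval and let $\gamma\colon U\to S^2\subset\mathbb{R}^3$ be a $C^3$ curve which is non-degenerate, i.e. $\operatorname{span}\{\gamma(\theta),\dot\gamma(\theta),\ddot\gamma(\theta)\}=\mathbb{R}^3$ for every $\theta\in U$. For $\theta\in U$ let $\rho_\theta\colon\mathbb{R}^3\to\mathbb{R}$, $\rho_\theta(x)=\gamma(\theta)\cdot x$, be the orthogonal projection onto the line $\ell_\theta=\operatorname{span}(\gamma(\theta))$, identified with $\mathbb{R}$, and let $\pi_\theta$ be the orthogonal projection of $\mathbb{R}^3$ onto the plane $V_\theta=\ell_\theta^{\perp}$, identified isometrically with $\mathbb{R}^2$. Write $\dim_{\mathrm H}$ for Hausdorff dimension and $\dim_{\mathrm p}$ for packing dimension, $\dim_{\mathrm p}A=\inf\{\sup_i\overline{\dim}_{\mathrm B}A_i : A=\bigcup_{i\in\mathbb{N}}A_i,\ A_i \text{ bounded}\}$, where $\overline{\dim}_{\mathrm B}R=\limsup_{\delta\to0}\frac{\log N(R,\delta)}{-\log\delta}$ and $N(R,\delta)$ is the least number of balls of radius $\delta$ needed to cover $R$. There are numbers $\sigma_1(s)>\tfrac12$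 for $s>\tfrac12$ and $\sigma_2(s)>1$ for $s>1$, depending only on $s$ (and not on $U$, $\gamma$ or $B$), such that for every non-degenerate curve $\gamma\colon U\to S^2$ as above and every analytic set $B\subset\mathbb{R}^3$ with $\dim_{\mathrm H}B=s$: (a) if $s>\tfrac12$, then $\dim_{\mathrm p}\rho_\theta(B)\ge\sigma_1(s)$ for Lebesgue almost every $\theta\in U$; (b) if $s>1$, then $\dim_{\mathrm p}\pi_\theta(B)\ge\sigma_2(s)$ for Lebesgue almost every $\theta\in U$. Moreover, $\sigma_1$ and $\sigma_2$ can be chosen so that $$\sigma_1(s)\ \ge\ \frac12+\frac12\cdot\frac{(2s-1)^2}{12s^2+4s-1},\qquad \sigma_2(s)\ \ge\ 1+\frac{(s-1)^2}{2s-1},$$ and also $\sigma_1(s)\ge s/2$ when $\tfrac12<s\le 2$. -/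

import Mathlib

open MeasureTheory Filter Topology
open scoped NNReal ENNReal

noncomputable section

/-- Euclidean three-space. -/
abbrev E3 : Type := EuclideanSpace ℝ (Fin 3)

/-- `γ` is a `C³` curve on the unit sphere of `ℝ³`, parametrised by the (possibly unbounded) open
interval `U`, such that `γ(θ), γ'(θ), γ''(θ)` span `ℝ³` for every `θ ∈ U`.
Values of `γ` outside `U` play no role. -/
structure IsNondegenerateCurve (U : Set ℝ) (γ : ℝ → E3) : Prop where
  isOpen : IsOpen U
  ordConnected : U.OrdConnected
  contDiffOn : ContDiffOn ℝ 3 γ U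
  norm_eq_one : ∀ θ ∈ U, ‖γ θ‖ = 1
  span_eq_top : ∀ θ ∈ U, Submodule.span ℝ {γ θ, deriv γ θ, deriv (deriv γ) θ} = ⊤

/-- The projection `ρ_θ(x) = γ(θ) · x` onto the line spanned by `γ(θ)`, read as a map to `ℝ`. -/
def lineProj (γ : ℝ → E3) (θ : ℝ) (x : E3) : ℝ := inner ℝ (γ θ) x

/-- The plane `V_θ`, the orthogonal complement of the line spanned by `γ(θ)`. -/
abbrev planeAt (γ : ℝ → E3) (θ : ℝ) : Submodule ℝ E3 := (Submodule.span ℝ {γ θ})ᗮ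

/-- The orthogonal projection `π_θ` onto the plane `V_θ` (with its induced Euclidean metric). -/
def planeProj (γ : ℝ → E3) (θ : ℝ) (x : E3) : planeAt γ θ :=
  (planeAt γ θ).orthogonalProjectionOnto x

/-- Upper box (Minkowski) dimension, `limsup_{δ → 0+} log N(A, δ) / log (1/δ)`, where `N(A, δ)` is
the least number of balls of radius `δ` needed to cover `A`. It is `⊥` for the empty set. -/
def upperBoxDim {X : Type*} [PseudoMetricSpace X] (A : Set X) : EReal :=
  limsup (fun δ : ℝ≥0 =>
    ENNReal.log (Metric.externalCoveringNumber δ A : ℝ≥0∞) / ((-Real.log δ : ℝ) : EReal)) (𝓝[>] 0)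

/-- Packing dimension: the infimum, over all countable decompositions `A = ⋃ i, F i` into bounded
sets, of the supremum of the upper box dimensions of the pieces. -/
def packingDim {X : Type*} [PseudoMetricSpace X] (A : Set X) : EReal :=
  ⨅ (F : ℕ → Set X) (_ : ∀ i, Bornology.IsBounded (F i)) (_ : A = ⋃ i, F i), ⨆ i, upperBoxDim (F i)

end

/-! Write `δ = 2⁻ʲ`. For `t` below `dimH B`, Frostman's lemma gives a finite nonzero measure `μ` on
a compact part of `B` with `μ(ball of radius r) ≲ rᵗ`. It is proved here for analytic sets: code
unit cubes by binary sequences, show that a net content there is a capacity (strong subadditivity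
gives continuity along increasing unions), pass to a compact subset of positive content, and
distribute mass down the binary tree.

If the packing dimension of a projection of `B` is below `σ`, a covering count and Borel–Cantelli
show that for `μ`-almost every `y` the `δ`-neighbourhood of the fibre through `y` has mass at least
`δ^σ` for all small `δ` (`HasCoverExponent.ae_eventually_le`). If this happens for a non-null set of
`θ`, choose two or three distinct points near each of which the bad set is non-null. Integrate the
product of the corresponding tube masses over `y` and over the parameters. By Tonelli this equals an
integral over `y` and auxiliary points `xᵢ` of products of lengths of parameter sets. An upper bound
with a better power of `δ` is a contradiction (`null_of_eventually_ge` and the incidence lemmas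
derived from it).

Bound `s/2` for lines: use two parameters and one point `x`. The function `θ ↦ γ(θ)·z` and its first
two derivatives never are all small, so the product of the lengths of its `δ`-sublevel sets near two
separated parameters is `≲ (δ/|z|)ᵖ` for `p ≤ 2`, and the energy of `μ` is finite.

Planes: use two parameters and two points. Each parameter set has length `≲ δ/|xᵢ - y|`, and `y`
lies near the intersection of two cones with vertices `x₁` and `x₂`. Where their rulings point in
distinct directions of the curve, that intersection is essentially a curve, of `μ`-mass `≲ δ^(s-1)`.
The gain is `δ^(2+s-1)` against `δ²`.

Lines, beyond `1/2`: use three parameters and three points. Away from tangency the parameter set is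
shorter than `√δ`, so only nearly tangential pairs count, where `γ(θ)·(x-y)` and `γ'(θ)·(x-y)` are
both small. Then `y` lies near three cones dual to the curve, whose tangent planes have the
independent normals `γ(θᵢ)`, so `y` is confined to few small balls. The gain is almost `δ^(3/2+s)`
against `δ^(3/2)`.

In the last two arguments pairs with `|x - y| < δ^τ` are discarded first, at a cost controlled by
the energy; optimising the exponents gives the explicit bounds. -/

/-! ### Net content on binary sequences -/

/-- Total weight of a set of binary words, a word of length `n` having weight `q ^ n`. -/
noncomputable def wordWeight (q : ℝ≥0∞) (C : Set (List (Fin 2))) : ℝ≥0∞ :=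
  ∑' w, C.indicator (fun w => q ^ w.length) w

/-- The set of words `C` covers `A`: every sequence in `A` has an initial segment in `C`. -/
def WordCover (C : Set (List (Fin 2))) (A : Set (ℕ → Fin 2)) : Prop :=
  ∀ x ∈ A, ∃ n, PiNat.res x n ∈ C

/-- The net content of a set of binary sequences. -/
noncomputable def netContent (q : ℝ≥0∞) (A : Set (ℕ → Fin 2)) : ℝ≥0∞ :=
  ⨅ (C : Set (List (Fin 2))) (_ : WordCover C A), wordWeight q C

/-- The cylinder of all sequences that start with the (reversed) word `w`. -/
def wordCylinder (w : List (Fin 2)) : Set (ℕ → Fin 2) := {x | PiNat.res x w.length = w}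

/-- The words of `S` without proper initial segment in `S`. -/
def minimalWords (S : Set (List (Fin 2))) : Set (List (Fin 2)) :=
  {w ∈ S | ∀ v ∈ S, v <:+ w → v = w}

variable {q : ℝ≥0∞}

theorem wordWeight_singleton (w : List (Fin 2)) : wordWeight q {w} = q ^ w.length := by
  unfold wordWeight
  rw [tsum_eq_single w]
  · simp
  · intro b hb
    simp [hb]

theorem wordWeight_mono {C D : Set (List (Fin 2))} (h : C ⊆ D) :
    wordWeight q C ≤ wordWeight q D :=
  ENNReal.tsum_le_tsum fun _ => Set.indicator_le_indicator_of_subset h (fun _ => zero_le) _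

theorem wordWeight_union_le (C D : Set (List (Fin 2))) :
    wordWeight q (C ∪ D) ≤ wordWeight q C + wordWeight q D := by
  unfold wordWeight
  rw [← ENNReal.tsum_add]
  refine ENNReal.tsum_le_tsum fun w => ?_
  by_cases h1 : w ∈ C <;> by_cases h2 : w ∈ D <;> simp [Set.indicator, h1, h2]

theorem netContent_le_wordWeight {C : Set (List (Fin 2))} {A : Set (ℕ → Fin 2)}
    (h : WordCover C A) : netContent q A ≤ wordWeight q C :=
  iInf₂_le C h

theorem exists_wordCover_of_netContent_lt {A : Set (ℕ → Fin 2)} {c : ℝ≥0∞}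
    (h : netContent q A < c) : ∃ C, WordCover C A ∧ wordWeight q C < c := by
  simpa [netContent, iInf_lt_iff] using h

theorem netContent_mono {A B : Set (ℕ → Fin 2)} (h : A ⊆ B) :
    netContent q A ≤ netContent q B :=
  le_iInf₂ fun _ hC => netContent_le_wordWeight fun x hx => hC x (h hx)

theorem netContent_le_pow {A : Set (ℕ → Fin 2)} {w : List (Fin 2)} (h : A ⊆ wordCylinder w) :
    netContent q A ≤ q ^ w.length := by
  rw [← wordWeight_singleton]
  exact netContent_le_wordWeight fun x hx => ⟨w.length, h hx⟩

theorem netContent_le_one (A : Set (ℕ → Fin 2)) : netContent q A ≤ 1 := by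
  simpa using netContent_le_pow (q := q) (A := A) (w := []) (fun x _ => by simp [wordCylinder])

theorem netContent_ne_top (A : Set (ℕ → Fin 2)) : netContent q A ≠ ∞ :=
  ne_top_of_le_ne_top ENNReal.one_ne_top (netContent_le_one A)

theorem netContent_empty : netContent q ∅ = 0 := by
  refine le_antisymm ?_ zero_le
  refine (netContent_le_wordWeight (C := ∅) (by simp [WordCover])).trans ?_
  simp [wordWeight]

theorem netContent_union_le (A B : Set (ℕ → Fin 2)) :
    netContent q (A ∪ B) ≤ netContent q A + netContent q B := by
  refine ENNReal.le_of_forall_pos_le_add fun ε hε _ => ?_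
  have hε' : ((ε / 2 : ℝ≥0) : ℝ≥0∞) ≠ 0 := by simpa using hε.ne'
  obtain ⟨C, hC, hC'⟩ := exists_wordCover_of_netContent_lt
    (ENNReal.lt_add_right (netContent_ne_top (q := q) A) hε')
  obtain ⟨D, hD, hD'⟩ := exists_wordCover_of_netContent_lt
    (ENNReal.lt_add_right (netContent_ne_top (q := q) B) hε')
  have hCD : WordCover (C ∪ D) (A ∪ B) := by
    rintro x (hx | hx)
    · exact (hC x hx).imp fun _ h => Or.inl h
    · exact (hD x hx).imp fun _ h => Or.inr h
  calc netContent q (A ∪ B) ≤ wordWeight q C + wordWeight q D :=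
        (netContent_le_wordWeight hCD).trans (wordWeight_union_le C D)
    _ ≤ (netContent q A + (ε / 2 : ℝ≥0)) + (netContent q B + (ε / 2 : ℝ≥0)) :=
        add_le_add hC'.le hD'.le
    _ = netContent q A + netContent q B + ((ε / 2 + ε / 2 : ℝ≥0) : ℝ≥0∞) := by
        push_cast; ring
    _ = _ := by rw [add_halves]

/-- `PiNat.res` puts the latest digit at the head, so initial segments of a sequence are suffixes of
words. -/
theorem suffix_res {x : ℕ → Fin 2} {v : List (Fin 2)} :
    ∀ {k : ℕ}, v <:+ PiNat.res x k → v = PiNat.res x v.length ∧ v.length ≤ k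
  | 0, h => by
    have : v = [] := by simpa using h
    simp [this]
  | k + 1, h => by
    rw [PiNat.res_succ, List.suffix_cons_iff] at h
    rcases h with h | h
    · rw [h]; simp
    · exact ⟨(suffix_res h).1, (suffix_res h).2.trans (Nat.le_succ k)⟩

theorem res_suffix_res (x : ℕ → Fin 2) {j k : ℕ} (h : j ≤ k) :
    PiNat.res x j <:+ PiNat.res x k := by
  induction k, h using Nat.le_induction with
  | base => exact List.suffix_rfl
  | succ k _ ih => exact ih.trans (by rw [PiNat.res_succ]; exact List.suffix_cons _ _)

theorem exists_res_mem_minimalWords {S : Set (List (Fin 2))} {x : ℕ → Fin 2} {k : ℕ}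
    (h : PiNat.res x k ∈ S) : ∃ j ≤ k, PiNat.res x j ∈ minimalWords S := by
  classical
  have hex : ∃ j, PiNat.res x j ∈ S := ⟨k, h⟩
  refine ⟨Nat.find hex, Nat.find_min' hex h, Nat.find_spec hex, fun v hv hvs => ?_⟩
  obtain ⟨h1, h2⟩ := suffix_res hvs
  have h3 : Nat.find hex ≤ v.length := Nat.find_min' hex (h1 ▸ hv)
  rw [h1, le_antisymm h2 h3]

/-- Strong subadditivity of covers. -/
theorem wordWeight_minimalWords_add_le (C D : Set (List (Fin 2))) (A : Set (ℕ → Fin 2))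
    (hC : WordCover C A) (hD : WordCover D A) :
    wordWeight q (minimalWords (C ∪ D)) + netContent q A ≤ wordWeight q C + wordWeight q D := by
  -- The leftover of `C` and `D`, counted with multiplicity, after removing the minimal words. A
  -- point meets both covers: at different lengths the longer word is not minimal, at equal lengths
  -- the word occurs twice. So the leftover still covers `A`.
  set V : Set (List (Fin 2)) := ((C ∪ D) \ minimalWords (C ∪ D)) ∪ (C ∩ D) with hV
  have hcov : WordCover V A := by
    intro x hx
    obtain ⟨m, hm⟩ := hC x hx
    obtain ⟨n, hn⟩ := hD x hx
    have key : ∀ {i j : ℕ}, i < j → PiNat.res x i ∈ C ∪ D → PiNat.res x j ∈ C ∪ D →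
        PiNat.res x j ∈ V := by
      intro i j hij hi hj
      refine Or.inl ⟨hj, fun h => ?_⟩
      have := congrArg List.length (h.2 _ hi (res_suffix_res x hij.le))
      simp at this
      omega
    rcases lt_trichotomy m n with h | h | h
    · exact ⟨n, key h (Or.inl hm) (Or.inr hn)⟩
    · exact ⟨m, Or.inr ⟨hm, h ▸ hn⟩⟩
    · exact ⟨m, key h (Or.inr hn) (Or.inl hm)⟩
  refine (add_le_add le_rfl (netContent_le_wordWeight hcov)).trans ?_
  unfold wordWeight
  rw [← ENNReal.tsum_add, ← ENNReal.tsum_add]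
  refine ENNReal.tsum_le_tsum fun w => ?_
  have hsub : w ∈ minimalWords (C ∪ D) → w ∈ C ∪ D := fun h => h.1
  rw [hV]
  generalize minimalWords (C ∪ D) = Mn at hsub ⊢
  by_cases h1 : w ∈ C <;> by_cases h2 : w ∈ D <;> by_cases h3 : w ∈ Mn <;>
    simp_all [Set.indicator]

/-- Continuity of the net content along increasing sequences of arbitrary sets. -/
theorem netContent_iUnion_le {E : ℕ → Set (ℕ → Fin 2)} (hE : Monotone E) {L : ℝ≥0∞}
    (hL : ∀ n, netContent q (E n) ≤ L) : netContent q (⋃ n, E n) ≤ L := by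
  refine ENNReal.le_of_forall_pos_le_add fun ε hε _ => ?_
  obtain ⟨e, he, hes⟩ := ENNReal.exists_pos_sum_of_countable
    (ε := (ε : ℝ≥0∞)) (by simpa using hε.ne') ℕ
  have hex : ∀ n, ∃ C, WordCover C (E n) ∧ wordWeight q C < netContent q (E n) + e n := fun n =>
    exists_wordCover_of_netContent_lt
      (ENNReal.lt_add_right (netContent_ne_top _) (by simpa using (he n).ne'))
  choose C hC hCw using hex
  -- Merge near-optimal covers one after another, keeping only minimal words.
  let U : ℕ → Set (List (Fin 2)) := fun n =>
    Nat.rec (minimalWords (C 0)) (fun n S => minimalWords (S ∪ C (n + 1))) n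
  have hU0 : U 0 = minimalWords (C 0) := rfl
  have hUs : ∀ n, U (n + 1) = minimalWords (U n ∪ C (n + 1)) := fun n => rfl
  have hUC : ∀ n, WordCover (U n) (E n) := by
    intro n x hx
    obtain ⟨k, hk⟩ := hC n x hx
    cases n with
    | zero =>
      obtain ⟨j, -, hj⟩ := exists_res_mem_minimalWords hk
      exact ⟨j, hU0 ▸ hj⟩
    | succ n =>
      obtain ⟨j, -, hj⟩ := exists_res_mem_minimalWords (S := U n ∪ C (n + 1)) (Or.inr hk)
      exact ⟨j, (hUs n) ▸ hj⟩
  have hUw : ∀ n, wordWeight q (U n) ≤ netContent q (E n) + ∑ i ∈ Finset.range (n + 1), (e i : ℝ≥0∞) := by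
    intro n
    induction n with
    | zero =>
      rw [hU0]
      simpa using (wordWeight_mono (q := q) (fun w hw => hw.1)).trans (hCw 0).le
    | succ n ih =>
      -- Both `U n` and `C (n + 1)` cover `E n`. Strong subadditivity lets its content cancel, so
      -- each merge costs only the error `e (n + 1)`.
      have h1 := wordWeight_minimalWords_add_le (q := q) (U n) (C (n + 1)) (E n) (hUC n)
        (fun x hx => hC (n + 1) x (hE (Nat.le_succ n) hx))
      rw [← hUs] at h1
      refine (ENNReal.add_le_add_iff_right (netContent_ne_top (q := q) (E n))).1 (h1.trans ?_)
      rw [Finset.sum_range_succ]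
      calc wordWeight q (U n) + wordWeight q (C (n + 1))
          ≤ (netContent q (E n) + ∑ i ∈ Finset.range (n + 1), (e i : ℝ≥0∞)) +
            (netContent q (E (n + 1)) + e (n + 1)) := add_le_add ih (hCw (n + 1)).le
        _ = _ := by ring
  have hUL : ∀ n, wordWeight q (U n) ≤ L + ε := fun n =>
    (hUw n).trans (add_le_add (hL n) ((ENNReal.sum_le_tsum _).trans hes.le))
  let V : Set (List (Fin 2)) := {w | ∀ᶠ n in atTop, w ∈ U n}
  have hV : WordCover V (⋃ n, E n) := by
    classical
    intro x hx
    obtain ⟨n, hn⟩ := Set.mem_iUnion.1 hx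
    obtain ⟨k₀, hk₀⟩ := hUC n x hn
    -- Take the shortest initial segment of `x` that ever enters some `U m`. A merge could replace
    -- it only by a shorter one, so it remains in every later `U j`.
    obtain ⟨P, hP⟩ : ∃ P : ℕ → Prop, ∀ k, P k ↔ ∃ m, PiNat.res x k ∈ U m := ⟨_, fun _ => Iff.rfl⟩
    have hex : ∃ k, P k := ⟨k₀, (hP k₀).2 ⟨n, hk₀⟩⟩
    obtain ⟨m, hm⟩ := (hP _).1 (Nat.find_spec hex)
    refine ⟨Nat.find hex, eventually_atTop.2 ⟨m, fun j hj => ?_⟩⟩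
    induction j, hj using Nat.le_induction with
    | base => exact hm
    | succ j _ ih =>
      obtain ⟨k', hk', hk''⟩ := exists_res_mem_minimalWords (S := U j ∪ C (j + 1)) (Or.inl ih)
      rw [← hUs] at hk''
      have := Nat.find_min' hex ((hP _).2 ⟨j + 1, hk''⟩)
      rwa [le_antisymm this hk']
  refine (netContent_le_wordWeight hV).trans ?_
  unfold wordWeight
  rw [ENNReal.tsum_eq_iSup_sum]
  refine iSup_le fun F => ?_
  -- Finitely many words of `V` lie in a common `U n`, so every partial sum of the weight of `V`
  -- obeys the uniform bound.
  have hF : ∀ᶠ n in atTop, ∀ w ∈ F, w ∈ V → w ∈ U n := by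
    rw [Filter.eventually_all_finset]
    intro w _
    by_cases hw : w ∈ V
    · exact (show ∀ᶠ n in atTop, w ∈ U n from hw).mono fun n h _ => h
    · exact Eventually.of_forall fun n h => absurd h hw
  obtain ⟨n, hn⟩ := hF.exists
  refine le_trans ?_ (hUL n)
  refine le_trans (Finset.sum_le_sum fun w hw => ?_) (ENNReal.sum_le_tsum F)
  by_cases h : w ∈ V
  · simp [Set.indicator, h, hn w hw h]
  · simp [Set.indicator, h]

/-! ### Capacitability of analytic sets -/

theorem isOpen_wordCylinder (w : List (Fin 2)) : IsOpen (wordCylinder w) := by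
  rw [isOpen_iff_forall_mem_open]
  intro x hx
  refine ⟨PiNat.cylinder x w.length, fun y hy => ?_, PiNat.isOpen_cylinder _ _ _,
    PiNat.self_mem_cylinder _ _⟩
  rw [PiNat.cylinder_eq_res] at hy
  exact Eq.trans hy hx

theorem isOpen_setOf_exists_res_mem (C : Set (List (Fin 2))) :
    IsOpen {x : ℕ → Fin 2 | ∃ n, PiNat.res x n ∈ C} := by
  have : {x : ℕ → Fin 2 | ∃ n, PiNat.res x n ∈ C} = ⋃ w ∈ C, wordCylinder w := by
    ext x
    simp only [Set.mem_ofPred_eq, Set.mem_iUnion, exists_prop, wordCylinder]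
    constructor
    · rintro ⟨n, hn⟩
      exact ⟨_, hn, by simp⟩
    · rintro ⟨w, hw, h⟩
      exact ⟨w.length, h.symm ▸ hw⟩
  rw [this]
  exact isOpen_biUnion fun w _ => isOpen_wordCylinder w

/-- If every word with property `P` extends to a longer one, there is an infinite branch. -/
theorem exists_branch {P : List ℕ → Prop} (h0 : P []) (hs : ∀ l, P l → ∃ m, P (m :: l)) :
    ∃ k : ℕ → ℕ, ∀ n, P (PiNat.res k n) := by
  choose! m hm using hs
  let g : ℕ → List ℕ := fun n => Nat.rec [] (fun _ l => m l :: l) n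
  have hg : ∀ n, g (n + 1) = m (g n) :: g n := fun _ => rfl
  have hres : ∀ n, PiNat.res (fun n => m (g n)) n = g n := by
    intro n
    induction n with
    | zero => rfl
    | succ n ih => rw [PiNat.res_succ, ih, hg]
  refine ⟨fun n => m (g n), fun n => ?_⟩
  rw [hres]
  induction n with
  | zero => exact h0
  | succ n ih => rw [hg]; exact hm _ ih

/-- Sequences whose initial coordinates are bounded by the entries of a (reversed) word. -/
def boundedBy : List ℕ → Set (ℕ → ℕ)
  | [] => Set.univ
  | m :: l => boundedBy l ∩ {x | x l.length ≤ m}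

theorem mem_boundedBy_res {k x : ℕ → ℕ} {n : ℕ} :
    x ∈ boundedBy (PiNat.res k n) ↔ ∀ i < n, x i ≤ k i := by
  induction n with
  | zero => simp [boundedBy]
  | succ n ih =>
    rw [PiNat.res_succ, boundedBy, Set.mem_inter_iff, ih]
    simp only [PiNat.res_length, Set.mem_ofPred_eq]
    constructor
    · rintro ⟨h1, h2⟩ i hi
      rcases Nat.lt_succ_iff_lt_or_eq.1 hi with h | h
      · exact h1 i h
      · exact h ▸ h2
    · intro h
      exact ⟨fun i hi => h i (by omega), h n (by omega)⟩

/-- The box below `k` is compact, so finitely many cylinders inside `O` cover it, and these inspect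
only finitely many coordinates. -/
theorem exists_boundedBy_subset {k : ℕ → ℕ} {O : Set (ℕ → ℕ)} (hO : IsOpen O)
    (hk : Set.pi Set.univ (fun i => Set.Iic (k i)) ⊆ O) :
    ∃ n, boundedBy (PiNat.res k n) ⊆ O := by
  have hcomp : IsCompact (Set.pi Set.univ (fun i => Set.Iic (k i))) :=
    isCompact_univ_pi fun i => (Set.finite_Iic (k i)).isCompact
  have hloc : ∀ x ∈ O, ∃ n, PiNat.cylinder x n ⊆ O := by
    intro x hx
    obtain ⟨_, ⟨y, n, rfl⟩, hxy, hsub⟩ :=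
      (PiNat.isTopologicalBasis_cylinders (fun _ : ℕ => ℕ)).exists_subset_of_mem_open hx hO
    exact ⟨n, by rwa [PiNat.mem_cylinder_iff_eq.1 hxy]⟩
  choose! N hN using hloc
  obtain ⟨t, ht, hcov⟩ := hcomp.elim_nhds_subcover (fun x => PiNat.cylinder x (N x))
    (fun x _ => (PiNat.isOpen_cylinder _ x (N x)).mem_nhds (PiNat.self_mem_cylinder x (N x)))
  refine ⟨t.sup N, fun x hx => ?_⟩
  rw [mem_boundedBy_res] at hx
  -- Truncating `x` at `k` lands in the box without changing the coordinates that matter.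
  have hy : (fun i => min (x i) (k i)) ∈ Set.pi Set.univ (fun i => Set.Iic (k i)) := by
    intro i _
    exact min_le_right (x i) (k i)
  obtain ⟨z, hz, hyz⟩ := Set.mem_iUnion₂.1 (hcov hy)
  refine hN z (hk (ht z hz)) fun i hi => ?_
  have h1 : i < t.sup N := lt_of_lt_of_le hi (Finset.le_sup hz)
  have h2 : min (x i) (k i) = z i := hyz i hi
  rw [← h2]
  exact (min_eq_left (hx i h1)).symm

/-- An analytic set whose coded preimage has positive net content contains a compact set with the
same property. -/
theorem exists_isCompact_netContent_pos {X : Type*} [TopologicalSpace X] [T2Space X]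
    {φ : (ℕ → Fin 2) → X} (hφ : Continuous φ) {B : Set X} (hB : AnalyticSet B)
    (hpos : 0 < netContent q (φ ⁻¹' B)) :
    ∃ K ⊆ B, IsCompact K ∧ 0 < netContent q (φ ⁻¹' K) := by
  rw [AnalyticSet] at hB
  rcases hB with rfl | ⟨f, hf, rfl⟩
  · simp [netContent_empty] at hpos
  obtain ⟨c, hc0, hc⟩ := exists_between hpos
  -- Bounding one further coordinate exhausts the set increasingly, so by continuity of the content
  -- some bound keeps it above `c`.
  obtain ⟨k, hk⟩ := exists_branch (P := fun l => c < netContent q (φ ⁻¹' (f '' boundedBy l)))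
    (by simpa [boundedBy] using hc) (by
      intro l hl
      by_contra! hcon
      have hun : φ ⁻¹' (f '' boundedBy l) = ⋃ m, φ ⁻¹' (f '' boundedBy (m :: l)) := by
        rw [← Set.preimage_iUnion, ← Set.image_iUnion]
        congr 2
        ext x
        simp only [boundedBy, Set.mem_iUnion, Set.mem_inter_iff, Set.mem_ofPred_eq]
        exact ⟨fun h => ⟨x l.length, h, le_rfl⟩, fun ⟨m, h, _⟩ => h⟩
      have hmono : Monotone fun m => φ ⁻¹' (f '' boundedBy (m :: l)) := by
        intro m n hmn
        refine Set.preimage_mono (Set.image_mono ?_)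
        exact fun x hx => ⟨hx.1, le_trans hx.2 hmn⟩
      have := netContent_iUnion_le (q := q) hmono hcon
      rw [← hun] at this
      exact absurd hl (not_lt.2 this))
  have hcomp : IsCompact (Set.pi Set.univ (fun i => Set.Iic (k i))) :=
    isCompact_univ_pi fun i => (Set.finite_Iic (k i)).isCompact
  refine ⟨f '' Set.pi Set.univ (fun i => Set.Iic (k i)), Set.image_subset_range _ _,
    hcomp.image hf, lt_of_lt_of_le hc0 ?_⟩
  -- A cover of weight below `c` of the compact preimage covers an open set `O`. Since `φ '' Oᶜ` is
  -- compact, the same words already cover the preimage of some `f '' boundedBy (PiNat.res k n)`,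
  -- against the choice of `k`.
  by_contra! hcon
  obtain ⟨C, hC, hCw⟩ := exists_wordCover_of_netContent_lt hcon
  set O := {x : ℕ → Fin 2 | ∃ n, PiNat.res x n ∈ C} with hO
  have hOo : IsOpen O := isOpen_setOf_exists_res_mem C
  have hV : IsOpen (φ '' Oᶜ)ᶜ :=
    (hOo.isClosed_compl.isCompact.image hφ).isClosed.isOpen_compl
  obtain ⟨n, hn⟩ := exists_boundedBy_subset (k := k) (hV.preimage hf) (by
    rintro x hx ⟨y, hy, hyx⟩
    exact hy (hC y ⟨x, hx, hyx.symm⟩))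
  have hcov : WordCover C (φ ⁻¹' (f '' boundedBy (PiNat.res k n))) := by
    rintro x ⟨y, hy, hyx⟩
    by_contra hx
    exact hn hy ⟨x, hx, hyx.symm⟩
  exact absurd (hk n) (not_lt.2 ((netContent_le_wordWeight hcov).trans hCw.le))

/-! ### Measures on binary sequences from mass distributions on words -/

/-- The mass distribution on words obtained by splitting the mass of `w` between its two
continuations in proportion to the values of `c`. -/
noncomputable def splitMass (c : List (Fin 2) → ℝ) : List (Fin 2) → ℝ
  | [] => c []
  | i :: w => splitMass c w * (c (i :: w) / (c (0 :: w) + c (1 :: w)))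

/-- Left end points of the nested intervals of lengths `ν w`. -/
noncomputable def wordLeft (ν : List (Fin 2) → ℝ) : List (Fin 2) → ℝ
  | [] => 0
  | i :: w => if i = 0 then wordLeft ν w else wordLeft ν w + ν (0 :: w)

/-- The word of length `n` whose interval contains `u`. -/
noncomputable def wordPath (ν : List (Fin 2) → ℝ) (u : ℝ) : ℕ → List (Fin 2)
  | 0 => []
  | n + 1 => (if u < wordLeft ν (wordPath ν u n) + ν (0 :: wordPath ν u n) then 0 else 1) ::
      wordPath ν u n

/-- The binary sequence whose nested intervals contain `u`. -/
noncomputable def seqPath (ν : List (Fin 2) → ℝ) (u : ℝ) : ℕ → Fin 2 :=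
  fun n => (wordPath ν u (n + 1)).headI

theorem res_seqPath (ν : List (Fin 2) → ℝ) (u : ℝ) (n : ℕ) :
    PiNat.res (seqPath ν u) n = wordPath ν u n := by
  induction n with
  | zero => rfl
  | succ n ih => rw [PiNat.res_succ, ih]; simp [seqPath, wordPath]

theorem measurable_seqPath (ν : List (Fin 2) → ℝ) : Measurable (seqPath ν) := by
  have hset : ∀ (n : ℕ) (w : List (Fin 2)), MeasurableSet {u | wordPath ν u n = w} := by
    intro n
    induction n with
    | zero => intro w; simp only [wordPath]; exact MeasurableSet.const _
    | succ n ih =>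
      intro w
      cases w with
      | nil => simp [wordPath]
      | cons i w =>
        have : {u | wordPath ν u (n + 1) = i :: w} = {u | wordPath ν u n = w} ∩
            {u | (if u < wordLeft ν w + ν (0 :: w) then (0 : Fin 2) else 1) = i} := by
          ext u
          simp only [wordPath, List.cons.injEq, Set.mem_inter_iff, Set.mem_ofPred_eq]
          constructor
          · rintro ⟨h1, h2⟩
            exact ⟨h2, by rwa [h2] at h1⟩
          · rintro ⟨h1, h2⟩
            exact ⟨by rwa [h1], h1⟩
        rw [this]
        refine (ih w).inter ?_
        refine (Measurable.ite (measurableSet_Iio (a := wordLeft ν w + ν (0 :: w)))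
          measurable_const measurable_const) (MeasurableSet.singleton i)
  refine measurable_pi_iff.2 fun n => measurable_to_countable' fun i => ?_
  have : (fun u => seqPath ν u n) ⁻¹' {i} = ⋃ w : List (Fin 2), {u | wordPath ν u (n + 1) = w ∧
      w.headI = i} := by
    ext u
    simp [seqPath]
  rw [this]
  refine MeasurableSet.iUnion fun w => ?_
  exact (hset (n + 1) w).inter (MeasurableSet.const _)

theorem mem_Ico_of_wordPath_eq {ν : List (Fin 2) → ℝ}
    (hadd : ∀ w, ν w = ν (0 :: w) + ν (1 :: w)) {u : ℝ} (hu : u ∈ Set.Ico 0 (ν [])) :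
    ∀ w : List (Fin 2), wordPath ν u w.length = w →
      u ∈ Set.Ico (wordLeft ν w) (wordLeft ν w + ν w)
  | [], _ => by simpa [wordLeft] using hu
  | i :: w, h => by
    simp only [List.length_cons, wordPath, List.cons.injEq] at h
    obtain ⟨h1, h2⟩ := h
    have ih := mem_Ico_of_wordPath_eq hadd hu w h2
    rw [h2] at h1
    have ha := hadd w
    simp only [Set.mem_Ico] at ih ⊢
    split_ifs at h1 with hlt
    · subst h1
      simp only [wordLeft, if_true]
      exact ⟨ih.1, hlt⟩
    · subst h1
      simp only [wordLeft, one_ne_zero, if_false]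
      exact ⟨not_lt.1 hlt, by linarith [ih.2]⟩

/-- A mass distribution on words gives a measure on sequences. -/
theorem exists_measure_wordCylinder_le {ν : List (Fin 2) → ℝ}
    (hadd : ∀ w, ν w = ν (0 :: w) + ν (1 :: w)) :
    ∃ m : Measure (ℕ → Fin 2), m Set.univ = ENNReal.ofReal (ν []) ∧
      ∀ w, m (wordCylinder w) ≤ ENNReal.ofReal (ν w) := by
  -- Lebesgue measure is pushed forward by the address map of nested intervals of lengths `ν w`, so
  -- no extension theorem is needed.
  refine ⟨(volume.restrict (Set.Ico 0 (ν []))).map (seqPath ν), ?_, fun w => ?_⟩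
  · rw [Measure.map_apply (measurable_seqPath ν) MeasurableSet.univ]
    simp
  · rw [Measure.map_apply (measurable_seqPath ν) (isOpen_wordCylinder w).measurableSet,
      Measure.restrict_apply (measurable_seqPath ν (isOpen_wordCylinder w).measurableSet)]
    calc volume (seqPath ν ⁻¹' wordCylinder w ∩ Set.Ico 0 (ν []))
        ≤ volume (Set.Ico (wordLeft ν w) (wordLeft ν w + ν w)) := by
          refine measure_mono ?_
          rintro u ⟨h1, h2⟩
          refine mem_Ico_of_wordPath_eq hadd h2 w ?_
          rw [← res_seqPath]
          exact h1
      _ = ENNReal.ofReal (ν w) := by simp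

/-- Proportional splitting keeps the mass below `c` because `c w` is at most the sum over its
children. If both children have value zero, the convention `x / 0 = 0` gives them no mass. -/
theorem splitMass_bounds {c : List (Fin 2) → ℝ} (h0 : ∀ w, 0 ≤ c w)
    (hsub : ∀ w, c w ≤ c (0 :: w) + c (1 :: w)) :
    ∀ w, 0 ≤ splitMass c w ∧ splitMass c w ≤ c w
  | [] => ⟨h0 [], le_rfl⟩
  | i :: w => by
    obtain ⟨ih0, ih1⟩ := splitMass_bounds h0 hsub w
    have hs : 0 ≤ c (0 :: w) + c (1 :: w) := add_nonneg (h0 _) (h0 _)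
    refine ⟨mul_nonneg ih0 (div_nonneg (h0 _) hs), ?_⟩
    rcases hs.eq_or_lt with h | h
    · simp only [splitMass, ← h, div_zero, mul_zero]
      exact h0 _
    · calc splitMass c w * (c (i :: w) / (c (0 :: w) + c (1 :: w)))
          ≤ (c (0 :: w) + c (1 :: w)) * (c (i :: w) / (c (0 :: w) + c (1 :: w))) :=
            mul_le_mul_of_nonneg_right (ih1.trans (hsub w)) (div_nonneg (h0 _) hs)
        _ = c (i :: w) := by field_simp

theorem splitMass_add {c : List (Fin 2) → ℝ} (h0 : ∀ w, 0 ≤ c w)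
    (hsub : ∀ w, c w ≤ c (0 :: w) + c (1 :: w)) (w : List (Fin 2)) :
    splitMass c w = splitMass c (0 :: w) + splitMass c (1 :: w) := by
  obtain ⟨ih0, ih1⟩ := splitMass_bounds h0 hsub w
  have hs : 0 ≤ c (0 :: w) + c (1 :: w) := add_nonneg (h0 _) (h0 _)
  simp only [splitMass]
  rcases hs.eq_or_lt with h | h
  · have : splitMass c w = 0 := le_antisymm (ih1.trans ((hsub w).trans h.ge)) ih0
    simp [this]
  · field_simp

/-- Frostman's lemma for closed sets of binary sequences. -/
theorem exists_frostman_of_isClosed {q : ℝ≥0∞} {L : Set (ℕ → Fin 2)} (hL : IsClosed L)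
    (hpos : 0 < netContent q L) :
    ∃ m : Measure (ℕ → Fin 2), IsFiniteMeasure m ∧ m ≠ 0 ∧ m Lᶜ = 0 ∧
      ∀ w, m (wordCylinder w) ≤ q ^ w.length := by
  set c : List (Fin 2) → ℝ := fun w => (netContent q (L ∩ wordCylinder w)).toReal with hc
  have h0 : ∀ w, 0 ≤ c w := fun w => ENNReal.toReal_nonneg
  have hsub : ∀ w, c w ≤ c (0 :: w) + c (1 :: w) := by
    intro w
    rw [hc]
    simp only
    rw [← ENNReal.toReal_add (netContent_ne_top _) (netContent_ne_top _)]
    refine ENNReal.toReal_mono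
      (ENNReal.add_ne_top.2 ⟨netContent_ne_top _, netContent_ne_top _⟩) ?_
    refine (netContent_mono ?_).trans (netContent_union_le _ _)
    rintro x ⟨hx, hxw⟩
    have hxw' : PiNat.res x w.length = w := hxw
    have h2 : x w.length = 0 ∨ x w.length = 1 := by omega
    rcases h2 with h | h
    · refine Or.inl ⟨hx, ?_⟩
      simp [wordCylinder, hxw', h]
    · refine Or.inr ⟨hx, ?_⟩
      simp [wordCylinder, hxw', h]
  obtain ⟨m, hm, hmw⟩ := exists_measure_wordCylinder_le (splitMass_add h0 hsub)
  have hmc : ∀ w, m (wordCylinder w) ≤ netContent q (L ∩ wordCylinder w) := fun w =>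
    (hmw w).trans (ENNReal.ofReal_le_of_le_toReal (splitMass_bounds h0 hsub w).2)
  have hm' : m Set.univ = netContent q L := by
    rw [hm]
    simp [splitMass, hc, wordCylinder, netContent_ne_top]
  refine ⟨m, ⟨by rw [hm]; exact ENNReal.ofReal_lt_top⟩, ?_, ?_,
    fun w => (hmc w).trans (netContent_le_pow Set.inter_subset_right)⟩
  · rintro rfl
    simp only [Measure.coe_zero, Pi.zero_apply] at hm'
    exact hpos.ne hm'
  -- The complement of a closed set is a countable union of cylinders disjoint from it, which have
  -- zero content and hence zero mass.
  · have hsubset : Lᶜ ⊆ ⋃ w ∈ {w : List (Fin 2) | L ∩ wordCylinder w = ∅}, wordCylinder w := by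
      intro x hx
      obtain ⟨n, hn⟩ := PiNat.exists_disjoint_cylinder hL hx
      refine Set.mem_iUnion₂.2 ⟨PiNat.res x n, ?_, by simp [wordCylinder]⟩
      rw [Set.mem_ofPred_eq, ← Set.disjoint_iff_inter_eq_empty]
      have heq : wordCylinder (PiNat.res x n) = PiNat.cylinder x n := by
        rw [PiNat.cylinder_eq_res]
        simp [wordCylinder]
      rwa [heq]
    refine measure_mono_null hsubset ?_
    refine (measure_biUnion_null_iff (Set.to_countable _)).2 fun w hw => ?_
    have := hmc w
    rw [show L ∩ wordCylinder w = ∅ from hw, netContent_empty] at this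
    exact le_antisymm this zero_le

/-! ### Binary coding of cubes and Frostman's lemma in three-space -/

/-- The `i`-th of three interleaved binary sequences. -/
def subSeq (x : ℕ → Fin 2) (i : Fin 3) : ℕ → Fin 2 := fun n => x (3 * n + i)

/-- The binary coding of the unit cube with corner `k`. -/
noncomputable def cubeCode (k : E3) (x : ℕ → Fin 2) : E3 :=
  WithLp.toLp 2 fun i => k i + Real.ofDigits (subSeq x i)

/-- The integer with the binary digits `x 0, …, x (n - 1)`. -/
def binaryInt (x : ℕ → Fin 2) : ℕ → ℕ
  | 0 => 0
  | n + 1 => 2 * binaryInt x n + x n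

theorem binaryInt_inj {x y : ℕ → Fin 2} : ∀ {n : ℕ}, binaryInt x n = binaryInt y n →
    ∀ i < n, x i = y i
  | 0, _, i, hi => absurd hi (Nat.not_lt_zero i)
  | n + 1, h, i, hi => by
    simp only [binaryInt] at h
    have hx := (x n).isLt
    have hy := (y n).isLt
    rcases Nat.lt_succ_iff_lt_or_eq.1 hi with h' | rfl
    · exact binaryInt_inj (by omega) i h'
    · ext; omega

theorem ofDigits_mem_Icc_binaryInt (x : ℕ → Fin 2) (n : ℕ) :
    (binaryInt x n : ℝ) ≤ 2 ^ n * Real.ofDigits x ∧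
      2 ^ n * Real.ofDigits x ≤ binaryInt x n + 1 := by
  have hsum : 2 ^ n * ∑ i ∈ Finset.range n, Real.ofDigitsTerm x i = binaryInt x n := by
    induction n with
    | zero => simp [binaryInt]
    | succ n ih =>
      rw [Finset.sum_range_succ, mul_add, pow_succ, mul_right_comm, ih, binaryInt,
        Real.ofDigitsTerm]
      push_cast
      field_simp
      ring
  have h := Real.ofDigits_eq_sum_add_ofDigits x n
  have h0 := Real.ofDigits_nonneg (fun i ↦ x (i + n))
  have h1 := Real.ofDigits_le_one (fun i ↦ x (i + n))
  have h2 : 2 ^ n * Real.ofDigits x = binaryInt x n + Real.ofDigits (fun i ↦ x (i + n)) := by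
    rw [h, mul_add, hsum]
    push_cast
    field_simp
  rw [h2]
  constructor <;> linarith

theorem continuous_cubeCode (k : E3) : Continuous (cubeCode k) := by
  unfold cubeCode
  refine (PiLp.continuous_toLp 2 _).comp (continuous_pi fun i => continuous_const.add ?_)
  refine Real.continuous_ofDigits.comp (continuous_pi fun n => ?_)
  exact continuous_apply _

theorem exists_cubeCode_eq {k y : E3} (h : ∀ i, y i - k i ∈ Set.Icc (0 : ℝ) 1) :
    ∃ x, cubeCode k x = y := by
  have hex : ∀ i, ∃ d : ℕ → Fin 2, Real.ofDigits d = y i - k i := fun i => by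
    obtain ⟨d, -, hd⟩ := Real.ofDigits_SurjOn (b := 2) one_lt_two (h i)
    exact ⟨d, hd⟩
  choose d hd using hex
  refine ⟨fun m => d ⟨m % 3, Nat.mod_lt _ (by norm_num)⟩ (m / 3), ?_⟩
  ext i
  have hi : subSeq (fun m => d ⟨m % 3, Nat.mod_lt _ (by norm_num)⟩ (m / 3)) i = d i := by
    funext n
    have h1 : (3 * n + (i : ℕ)) % 3 = i := by have := i.isLt; omega
    have h2 : (3 * n + (i : ℕ)) / 3 = n := by have := i.isLt; omega
    simp only [subSeq]
    have h3 : (⟨(3 * n + (i : ℕ)) % 3, Nat.mod_lt _ (by norm_num)⟩ : Fin 3) = i := Fin.ext h1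
    rw [h2, h3]
  simp only [cubeCode, hi, hd]
  ring

theorem dist_le_two_mul_of_coord {x y : E3} {r : ℝ} (hr : 0 ≤ r) (h : ∀ i, |x i - y i| ≤ r) :
    dist x y ≤ 2 * r := by
  rw [EuclideanSpace.dist_eq]
  refine Real.sqrt_le_iff.2 ⟨by positivity, ?_⟩
  rw [Fin.sum_univ_three]
  simp only [Real.dist_eq, sq_abs]
  have h' : ∀ i, (x i - y i) ^ 2 ≤ r ^ 2 := fun i => sq_le_sq' (by linarith [(abs_le.1 (h i)).1])
    (abs_le.1 (h i)).2
  nlinarith [h' 0, h' 1, h' 2, sq_nonneg r]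

theorem dist_cubeCode_le {k : E3} {x y : ℕ → Fin 2} {n : ℕ} (h : ∀ i < 3 * n, x i = y i) :
    dist (cubeCode k x) (cubeCode k y) ≤ 2 * ((2 : ℝ) ^ n)⁻¹ := by
  refine dist_le_two_mul_of_coord (by positivity) fun i => ?_
  simp only [cubeCode, add_sub_add_left_eq_sub]
  have := Real.abs_ofDigits_sub_ofDigits_le (x := subSeq x i) (y := subSeq y i) (n := n)
    (fun j hj => h _ (by have := i.isLt; omega))
  simpa using this

/-- In each coordinate the ball meets at most four dyadic intervals of length `2⁻ⁿ`, hence `4 ^ 3 =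
64` dyadic cubes. Prescribing `n` digits in each coordinate is prescribing the first `3 * n`
interleaved digits. -/
theorem measure_preimage_cubeCode_closedBall_le {m : Measure (ℕ → Fin 2)} {q : ℝ≥0∞}
    (hm : ∀ w, m (wordCylinder w) ≤ q ^ w.length) (k y : E3) (n : ℕ) :
    m (cubeCode k ⁻¹' Metric.closedBall y ((2 : ℝ) ^ n)⁻¹) ≤ 64 * q ^ (3 * n) := by
  classical
  -- The integer part of the digits differs from `2 ^ n` times the coordinate by at most one, and so
  -- does the coordinate from that of `y`: hence the shift by `2`.
  set A : Fin 3 → ℤ := fun i => ⌈(2 : ℝ) ^ n * (y i - k i) - 2⌉ with hA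
  set S : Finset (Fin 3 → ℤ) := Fintype.piFinset fun i => Finset.Icc (A i) (A i + 3) with hS
  have hcard : S.card = 64 := by
    rw [hS, Fintype.card_piFinset]
    have h4 : ∀ a : ℤ, (Finset.Icc a (a + 3)).card = 4 := fun a => by
      rw [Int.card_Icc]
      omega
    simp [h4]
  have hsub : cubeCode k ⁻¹' Metric.closedBall y ((2 : ℝ) ^ n)⁻¹ ⊆
      ⋃ v ∈ S, {x | ∀ i, (binaryInt (subSeq x i) n : ℤ) = v i} := by
    intro x hx
    refine Set.mem_iUnion₂.2 ⟨fun i => (binaryInt (subSeq x i) n : ℤ), ?_, fun i => rfl⟩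
    rw [hS, Fintype.mem_piFinset]
    intro i
    have h1 : |k i + Real.ofDigits (subSeq x i) - y i| ≤ ((2 : ℝ) ^ n)⁻¹ := by
      have h2 : ‖(cubeCode k x - y) i‖ ≤ ‖cubeCode k x - y‖ := PiLp.norm_apply_le _ i
      rw [← dist_eq_norm] at h2
      exact h2.trans hx
    obtain ⟨h3, h4⟩ := ofDigits_mem_Icc_binaryInt (subSeq x i) n
    have hp : (0 : ℝ) < 2 ^ n := by positivity
    rw [abs_le] at h1
    have h5 : (2 : ℝ) ^ n * (y i - k i) - 1 ≤ 2 ^ n * Real.ofDigits (subSeq x i) := by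
      have := mul_le_mul_of_nonneg_left h1.1 hp.le
      rw [mul_neg, mul_inv_cancel₀ hp.ne'] at this
      nlinarith
    have h6 : 2 ^ n * Real.ofDigits (subSeq x i) ≤ (2 : ℝ) ^ n * (y i - k i) + 1 := by
      have := mul_le_mul_of_nonneg_left h1.2 hp.le
      rw [mul_inv_cancel₀ hp.ne'] at this
      nlinarith
    rw [Finset.mem_Icc]
    constructor
    · rw [hA, Int.ceil_le]
      push_cast
      linarith
    · have : (2 : ℝ) ^ n * (y i - k i) - 2 ≤ A i := Int.le_ceil _
      have h7 : ((binaryInt (subSeq x i) n : ℤ) : ℝ) ≤ ((A i + 3 : ℤ) : ℝ) := by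
        push_cast
        linarith
      exact_mod_cast h7
  have hpiece : ∀ v : Fin 3 → ℤ, m {x | ∀ i, (binaryInt (subSeq x i) n : ℤ) = v i} ≤ q ^ (3 * n) := by
    intro v
    rcases Set.eq_empty_or_nonempty {x : ℕ → Fin 2 | ∀ i, (binaryInt (subSeq x i) n : ℤ) = v i}
      with h | ⟨x, hx⟩
    · rw [h]; simp
    · have hle := hm (PiNat.res x (3 * n))
      rw [PiNat.res_length] at hle
      refine (measure_mono fun z hz => ?_).trans hle
      simp only [wordCylinder, PiNat.res_length, Set.mem_ofPred_eq]
      rw [PiNat.res_eq_res]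
      intro j hj
      have hzx : binaryInt (subSeq z ⟨j % 3, Nat.mod_lt _ (by norm_num)⟩) n =
          binaryInt (subSeq x ⟨j % 3, Nat.mod_lt _ (by norm_num)⟩) n := by
        have := (hz ⟨j % 3, Nat.mod_lt _ (by norm_num)⟩).trans
          (hx ⟨j % 3, Nat.mod_lt _ (by norm_num)⟩).symm
        exact_mod_cast this
      have := binaryInt_inj hzx (j / 3) (by omega)
      simp only [subSeq] at this
      rwa [Nat.div_add_mod] at this
  calc m (cubeCode k ⁻¹' Metric.closedBall y ((2 : ℝ) ^ n)⁻¹)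
      ≤ ∑ v ∈ S, m {x | ∀ i, (binaryInt (subSeq x i) n : ℤ) = v i} :=
        (measure_mono hsub).trans (measure_biUnion_finset_le _ _)
    _ ≤ ∑ v ∈ S, q ^ (3 * n) := Finset.sum_le_sum fun v _ => hpiece v
    _ = 64 * q ^ (3 * n) := by rw [Finset.sum_const, hcard]; simp

/-! ### Net content against Hausdorff measure, and Frostman's lemma. -/

theorem two_rpow_pow_length (t : ℝ) (n : ℕ) :
    (ENNReal.ofReal ((2 : ℝ) ^ (-(t / 3)))) ^ n = ENNReal.ofReal ((2 : ℝ) ^ (-(t / 3) * n)) := by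
  rw [← ENNReal.ofReal_pow (by positivity), ← Real.rpow_natCast, ← Real.rpow_mul (by norm_num)]

/-- Three digits halve the side of the cube, so weight `2 ^ (-t / 3)` per digit matches diameter to
the power `t`. The factor `4 ^ t` absorbs the diagonal and the rounding of `length / 3`. -/
theorem ediam_image_wordCylinder_rpow_le (k : E3) {t : ℝ} (ht : 0 < t) (w : List (Fin 2)) :
    Metric.ediam (cubeCode k '' wordCylinder w) ^ t ≤
      ENNReal.ofReal (4 ^ t) * (ENNReal.ofReal ((2 : ℝ) ^ (-(t / 3)))) ^ w.length := by
  set n := w.length / 3 with hn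
  have hdiam : Metric.ediam (cubeCode k '' wordCylinder w) ≤
      ENNReal.ofReal (2 * ((2 : ℝ) ^ n)⁻¹) := by
    refine Metric.ediam_le ?_
    rintro _ ⟨x, hx, rfl⟩ _ ⟨y, hy, rfl⟩
    rw [edist_dist]
    refine ENNReal.ofReal_le_ofReal (dist_cubeCode_le fun i hi => ?_)
    have hxy : PiNat.res x w.length = PiNat.res y w.length := Eq.trans hx (Eq.symm hy)
    exact PiNat.res_eq_res.1 hxy (by omega)
  refine (ENNReal.rpow_le_rpow hdiam ht.le).trans ?_
  rw [two_rpow_pow_length, ENNReal.ofReal_rpow_of_nonneg (by positivity) ht.le,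
    ← ENNReal.ofReal_mul (by positivity)]
  refine ENNReal.ofReal_le_ofReal ?_
  have h1 : 2 * ((2 : ℝ) ^ n)⁻¹ ≤ 4 * 2 ^ (-(w.length / 3 : ℝ)) := by
    have hlt : (w.length : ℝ) / 3 ≤ n + 1 := by
      have : w.length ≤ 3 * n + 3 := by omega
      have h' : (w.length : ℝ) ≤ 3 * n + 3 := by exact_mod_cast this
      linarith
    have h2 : ((2 : ℝ) ^ n)⁻¹ = 2 * 2 ^ (-((n : ℝ) + 1)) := by
      rw [Real.rpow_neg (by norm_num), Real.rpow_add (by norm_num), Real.rpow_natCast,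
        Real.rpow_one]
      field_simp
    have h3 : (2 : ℝ) ^ (-((n : ℝ) + 1)) ≤ 2 ^ (-(w.length / 3 : ℝ)) :=
      Real.rpow_le_rpow_of_exponent_le (by norm_num) (by linarith)
    rw [h2]
    linarith
  refine (Real.rpow_le_rpow (by positivity) h1 ht.le).trans (le_of_eq ?_)
  rw [Real.mul_rpow (by norm_num) (by positivity), ← Real.rpow_mul (by norm_num)]
  congr 2
  ring

/-- Content puts no bound on the sizes of covering words, but a cover of small total weight consists
of words of small weight, so its cylinders have small images. -/
theorem hausdorffMeasure_image_eq_zero {k : E3} {t : ℝ} (ht : 0 < t) {A : Set (ℕ → Fin 2)}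
    (hA : netContent (ENNReal.ofReal ((2 : ℝ) ^ (-(t / 3)))) A = 0) :
    Measure.hausdorffMeasure t (cubeCode k '' A) = 0 := by
  set q := ENNReal.ofReal ((2 : ℝ) ^ (-(t / 3))) with hq
  have hex : ∀ n : ℕ, ∃ C, WordCover C A ∧ wordWeight q C < ((n : ℝ≥0∞) + 1)⁻¹ := fun n =>
    exists_wordCover_of_netContent_lt (by rw [hA]; simp)
  choose C hC hCw using hex
  have hlim : Tendsto (fun n : ℕ => ((n : ℝ≥0∞) + 1)⁻¹) atTop (𝓝 0) := by
    have := (tendsto_add_atTop_iff_nat 1).2 ENNReal.tendsto_inv_nat_nhds_zero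
    simpa using this
  have hmul : ∀ {c : ℝ≥0∞}, c ≠ ∞ → Tendsto (fun n : ℕ => c * ((n : ℝ≥0∞) + 1)⁻¹) atTop (𝓝 0) := by
    intro c hc
    simpa using ENNReal.Tendsto.const_mul hlim (Or.inr hc)
  have hr : Tendsto (fun n : ℕ => (ENNReal.ofReal (4 ^ t) * ((n : ℝ≥0∞) + 1)⁻¹) ^ t⁻¹) atTop
      (𝓝 0) := by
    have := (hmul (c := ENNReal.ofReal (4 ^ t)) ENNReal.ofReal_ne_top).ennrpow_const t⁻¹
    rwa [ENNReal.zero_rpow_of_pos (inv_pos.2 ht)] at this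
  have hterm : ∀ n, ∀ w : C n, q ^ w.1.length ≤ wordWeight q (C n) := by
    intro n w
    rw [← wordWeight_singleton]
    exact wordWeight_mono (Set.singleton_subset_iff.2 w.2)
  have key := Measure.hausdorffMeasure_le_liminf_tsum (X := E3) (β := ℕ) (ι := fun n => C n) t
    (cubeCode k '' A) (l := atTop) _ hr (fun n w => cubeCode k '' wordCylinder w.1)
    (Eventually.of_forall fun n w => by
      have h1 := ediam_image_wordCylinder_rpow_le k ht w.1
      rw [ENNReal.le_rpow_inv_iff ht]
      refine h1.trans ?_
      gcongr
      exact (hterm n w).trans (hCw n).le)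
    (Eventually.of_forall fun n => by
      rintro _ ⟨x, hx, rfl⟩
      obtain ⟨j, hj⟩ := hC n x hx
      exact Set.mem_iUnion.2 ⟨⟨_, hj⟩, x, by simp [wordCylinder], rfl⟩)
  refine le_antisymm (key.trans ?_) zero_le
  have hle : ∀ n, ∑' w : C n, Metric.ediam (cubeCode k '' wordCylinder w.1) ^ t ≤
      ENNReal.ofReal (4 ^ t) * ((n : ℝ≥0∞) + 1)⁻¹ := by
    intro n
    calc ∑' w : C n, Metric.ediam (cubeCode k '' wordCylinder w.1) ^ t
        ≤ ∑' w : C n, ENNReal.ofReal (4 ^ t) * q ^ w.1.length :=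
          ENNReal.tsum_le_tsum fun w => ediam_image_wordCylinder_rpow_le k ht w.1
      _ = ENNReal.ofReal (4 ^ t) * wordWeight q (C n) := by
          rw [ENNReal.tsum_mul_left, wordWeight,
            tsum_subtype (C n) (fun w => q ^ w.length)]
      _ ≤ _ := by gcongr; exact (hCw n).le
  refine (liminf_le_liminf (Eventually.of_forall hle)).trans ?_
  exact (hmul (c := ENNReal.ofReal (4 ^ t)) ENNReal.ofReal_ne_top).liminf_eq.le

/-- **Frostman's lemma** for analytic subsets of three-space. -/
theorem exists_frostman {B : Set E3} (hB : AnalyticSet B) {t : ℝ} (ht : 0 < t)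
    (hdim : ENNReal.ofReal t < dimH B) :
    ∃ μ : Measure E3, IsFiniteMeasure μ ∧ μ ≠ 0 ∧ (∃ K ⊆ B, IsCompact K ∧ μ Kᶜ = 0) ∧
      ∃ C : ℝ, 0 < C ∧ ∀ y r, 0 < r → μ (Metric.closedBall y r) ≤ ENNReal.ofReal (C * r ^ t) := by
  set q := ENNReal.ofReal ((2 : ℝ) ^ (-(t / 3))) with hq
  have htop : Measure.hausdorffMeasure t B = ∞ := by
    have := hausdorffMeasure_of_lt_dimH (s := B) (d := t.toNNReal) hdim
    rwa [Real.coe_toNNReal t ht.le] at this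
  -- Otherwise the parts of `B` in the countably many integer cubes would all be null, while `B` has
  -- infinite Hausdorff measure.
  obtain ⟨k, hk⟩ : ∃ k : E3, 0 < netContent q (cubeCode k ⁻¹' B) := by
    by_contra! hcon
    have hsub : B ⊆ ⋃ v : Fin 3 → ℤ, cubeCode (WithLp.toLp 2 fun i => (v i : ℝ)) ''
        (cubeCode (WithLp.toLp 2 fun i => (v i : ℝ)) ⁻¹' B) := by
      intro y hy
      obtain ⟨x, hx⟩ := exists_cubeCode_eq (k := WithLp.toLp 2 fun i => (⌊y i⌋ : ℝ)) (y := y)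
        (fun i => ⟨by simp, by
          have := (Int.lt_floor_add_one (y i)).le
          simp only
          linarith⟩)
      refine Set.mem_iUnion.2 ⟨fun i => ⌊y i⌋, x, ?_, hx⟩
      rw [Set.mem_preimage, hx]
      exact hy
    have : Measure.hausdorffMeasure t B = 0 := by
      refine measure_mono_null hsub (measure_iUnion_null fun v => ?_)
      exact hausdorffMeasure_image_eq_zero ht (le_antisymm (hcon _) zero_le)
    rw [this] at htop
    simp at htop
  obtain ⟨K, hKB, hK, hKpos⟩ := exists_isCompact_netContent_pos (continuous_cubeCode k) hB hk
  obtain ⟨m, hmf, hm0, hmK, hmw⟩ := exists_frostman_of_isClosed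
    (hK.isClosed.preimage (continuous_cubeCode k)) hKpos
  have hmeas : Measurable (cubeCode k) := (continuous_cubeCode k).measurable
  have hball : ∀ y (n : ℕ), m.map (cubeCode k) (Metric.closedBall y ((2 : ℝ) ^ n)⁻¹) ≤
      ENNReal.ofReal (64 * (((2 : ℝ) ^ n)⁻¹) ^ t) := by
    intro y n
    rw [Measure.map_apply hmeas Metric.isClosed_closedBall.measurableSet]
    refine (measure_preimage_cubeCode_closedBall_le hmw k y n).trans (le_of_eq ?_)
    rw [two_rpow_pow_length, ENNReal.ofReal_mul (by norm_num)]
    congr 1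
    · simp
    · congr 1
      rw [← Real.rpow_natCast, ← Real.rpow_neg (by norm_num), ← Real.rpow_mul (by norm_num)]
      congr 1
      push_cast
      ring
  refine ⟨m.map (cubeCode k), Measure.isFiniteMeasure_map m _, ?_, ⟨K, hKB, hK, ?_⟩,
    64 * 2 ^ t, by positivity, fun y r hr => ?_⟩
  · rwa [Ne, Measure.map_eq_zero_iff hmeas.aemeasurable]
  · rw [Measure.map_apply hmeas hK.isClosed.measurableSet.compl]
    exact hmK
  · rcases le_or_gt r 1 with h1 | h1
    · obtain ⟨n, hn1, hn2⟩ := exists_nat_pow_near_of_lt_one hr h1 (y := (2⁻¹ : ℝ))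
        (by norm_num) (by norm_num)
      rw [inv_pow] at hn1 hn2
      refine (measure_mono (Metric.closedBall_subset_closedBall hn2)).trans ((hball y n).trans ?_)
      refine ENNReal.ofReal_le_ofReal ?_
      rw [mul_assoc, ← Real.mul_rpow (by norm_num) hr.le]
      have h2 : ((2 : ℝ) ^ n)⁻¹ ≤ 2 * r := by
        rw [pow_succ, mul_inv] at hn1
        linarith
      have := Real.rpow_le_rpow (by positivity) h2 ht.le
      linarith
    -- For `r > 1` total mass at most one suffices; it comes from the empty word.
    · have huniv : m.map (cubeCode k) Set.univ ≤ 1 := by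
        rw [Measure.map_apply hmeas MeasurableSet.univ]
        have := hmw []
        simpa [wordCylinder] using this
      refine (measure_mono (Set.subset_univ _)).trans (huniv.trans ?_)
      rw [← ENNReal.ofReal_one]
      refine ENNReal.ofReal_le_ofReal ?_
      have h2 : (1 : ℝ) ≤ 2 ^ t := Real.one_le_rpow (by norm_num) ht.le
      have h3 : (1 : ℝ) ≤ r ^ t := Real.one_le_rpow h1.le ht.le
      nlinarith

/-- Frostman measures have bounded potentials of lower order. -/
theorem exists_lintegral_edist_rpow_le {μ : Measure E3} [IsFiniteMeasure μ] {t C : ℝ}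
    (hμ : ∀ y r, 0 < r → μ (Metric.closedBall y r) ≤ ENNReal.ofReal (C * r ^ t)) {p : ℝ}
    (hp : 0 < p) (hpt : p < t) :
    ∃ M : ℝ≥0∞, M ≠ ∞ ∧ ∀ y, ∫⁻ x, edist x y ^ (-p) ∂μ ≤ M := by
  have hgeo : Summable fun n : ℕ => 2 ^ p * C * ((2 : ℝ) ^ (p - t)) ^ n :=
    (summable_geometric_of_lt_one (by positivity)
      (Real.rpow_lt_one_of_one_lt_of_neg (by norm_num) (by linarith))).mul_left _
  refine ⟨μ Set.univ + ∑' n : ℕ, ENNReal.ofReal (2 ^ p * C * ((2 : ℝ) ^ (p - t)) ^ n),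
    ENNReal.add_ne_top.2 ⟨measure_ne_top _ _, hgeo.tsum_ofReal_ne_top⟩, fun y => ?_⟩
  -- Dyadic shells: if `2⁻⁽ⁿ⁺¹⁾ < |x - y| ≤ 2⁻ⁿ`, the single term `n` dominates. On the diagonal the
  -- left side is infinite, and so is the series.
  have hpt' : ∀ x, edist x y ^ (-p) ≤ 1 + ∑' n : ℕ,
      (Metric.closedBall y ((2 : ℝ) ^ n)⁻¹).indicator
        (fun _ => ENNReal.ofReal ((2 : ℝ) ^ (p * (n + 1)))) x := by
    intro x
    rcases eq_or_ne x y with rfl | hxy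
    · refine le_add_left ?_
      have : ∑' _ : ℕ, (1 : ℝ≥0∞) ≤ ∑' n : ℕ, (Metric.closedBall x ((2 : ℝ) ^ n)⁻¹).indicator
          (fun _ => ENNReal.ofReal ((2 : ℝ) ^ (p * (n + 1)))) x := by
        refine ENNReal.tsum_le_tsum fun n => ?_
        rw [Set.indicator_of_mem (Metric.mem_closedBall_self (by positivity))]
        rw [← ENNReal.ofReal_one]
        exact ENNReal.ofReal_le_ofReal (Real.one_le_rpow (by norm_num) (by positivity))
      rw [ENNReal.tsum_const_eq_top_of_ne_zero one_ne_zero] at this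
      exact le_top.trans this
    · have hd : 0 < dist x y := dist_pos.2 hxy
      rw [edist_dist, ENNReal.ofReal_rpow_of_pos hd]
      rcases le_or_gt (dist x y) 1 with h1 | h1
      · obtain ⟨n, hn1, hn2⟩ := exists_nat_pow_near_of_lt_one hd h1 (y := (2⁻¹ : ℝ))
          (by norm_num) (by norm_num)
        refine le_add_left (le_trans ?_ (ENNReal.le_tsum n))
        rw [inv_pow] at hn2
        rw [Set.indicator_of_mem (Metric.mem_closedBall.2 hn2)]
        refine ENNReal.ofReal_le_ofReal ?_
        refine (Real.rpow_le_rpow_of_nonpos (by positivity) hn1.le (by linarith)).trans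
          (le_of_eq ?_)
        rw [inv_pow, Real.inv_rpow (by positivity), Real.rpow_neg (by positivity), inv_inv,
          ← Real.rpow_natCast, ← Real.rpow_mul (by norm_num)]
        congr 1
        push_cast
        ring
      · refine le_add_right ?_
        rw [← ENNReal.ofReal_one]
        exact ENNReal.ofReal_le_ofReal
          (Real.rpow_le_one_of_one_le_of_nonpos h1.le (by linarith))
  refine (lintegral_mono hpt').trans ?_
  rw [lintegral_add_left measurable_const, lintegral_tsum (fun n =>
    (measurable_const.indicator Metric.isClosed_closedBall.measurableSet).aemeasurable)]
  refine add_le_add (by simp) (ENNReal.tsum_le_tsum fun n => ?_)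
  rw [lintegral_indicator_const Metric.isClosed_closedBall.measurableSet]
  refine (mul_le_mul_right (hμ y _ (by positivity)) _).trans ?_
  rw [← ENNReal.ofReal_mul (by positivity)]
  refine ENNReal.ofReal_le_ofReal (le_of_eq ?_)
  rw [← Real.rpow_natCast (2 ^ (p - t)), ← Real.rpow_mul (by norm_num), ← Real.rpow_natCast 2 n,
    ← Real.rpow_neg (by norm_num), ← Real.rpow_mul (by norm_num),
    show p * ((n : ℝ) + 1) = p * n + p by ring, Real.rpow_add (by norm_num),
    show (p - t) * (n : ℝ) = p * n + -(n : ℝ) * t by ring, Real.rpow_add (by norm_num)]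
  ring

/-! ### Packing dimension and the mass of dyadic balls -/

/-- The dyadic scale `2⁻ʲ`. -/
noncomputable def dyadic (j : ℕ) : ℝ := (1 / 2) ^ j

theorem dyadic_pos (j : ℕ) : 0 < dyadic j := by unfold dyadic; positivity

theorem dyadic_le_one (j : ℕ) : dyadic j ≤ 1 := pow_le_one₀ (by norm_num) (by norm_num)

theorem tendsto_dyadic : Tendsto dyadic atTop (𝓝 0) :=
  tendsto_pow_atTop_nhds_zero_of_lt_one (by norm_num) (by norm_num)

theorem summable_dyadic_rpow {a : ℝ} (ha : 0 < a) : Summable fun j => dyadic j ^ a := by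
  have h : ∀ j, dyadic j ^ a = ((1 / 2 : ℝ) ^ a) ^ j := fun j => by
    unfold dyadic
    rw [← Real.rpow_natCast, ← Real.rpow_mul (by norm_num), mul_comm, Real.rpow_mul (by norm_num),
      Real.rpow_natCast]
  simp_rw [h]
  exact summable_geometric_of_lt_one (by positivity)
    (Real.rpow_lt_one (by norm_num) (by norm_num) ha)

theorem eventually_dyadic_rpow_lt {a c : ℝ} (ha : 0 < a) (hc : 0 < c) :
    ∀ᶠ j in atTop, dyadic j ^ a < c :=
  (summable_dyadic_rpow ha).tendsto_atTop_zero.eventually_lt_const hc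

/-- `B` is a countable union of sets whose images under `p` are covered by at most `2 ^ (σ j)` balls
of radius `2⁻ʲ`, for all large `j`. -/
def HasCoverExponent {X : Type*} [PseudoMetricSpace X] (p : E3 → X) (B : Set E3) (σ : ℝ) : Prop :=
  ∃ F : ℕ → Set E3, B ⊆ ⋃ i, F i ∧ ∀ i, ∀ᶠ j in atTop, ∃ S : Finset X,
    (S.card : ℝ) ≤ dyadic j ^ (-σ) ∧ p '' F i ⊆ ⋃ c ∈ S, Metric.closedBall c (dyadic j)

/-- Only the dyadic scales of the limsup are kept, and the covers are pulled back to pieces of the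
domain. -/
theorem hasCoverExponent_of_packingDim_lt {X : Type*} [PseudoMetricSpace X] {p : E3 → X}
    {B : Set E3} {σ : ℝ} (h : packingDim (p '' B) < (σ : EReal)) : HasCoverExponent p B σ := by
  simp only [packingDim, iInf_lt_iff] at h
  obtain ⟨F, -, hF, hlt⟩ := h
  refine ⟨fun i => p ⁻¹' F i, ?_, fun i => ?_⟩
  · rw [← Set.preimage_iUnion, ← hF]
    exact Set.subset_preimage_image p B
  have hi : upperBoxDim (F i) < (σ : EReal) := (le_iSup (fun i => upperBoxDim (F i)) i).trans_lt hlt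
  have hev := eventually_lt_of_limsup_lt hi
  have htend : Tendsto (fun j => (dyadic j).toNNReal) atTop (𝓝[>] 0) := by
    refine tendsto_nhdsWithin_iff.2 ⟨?_, Eventually.of_forall fun j => ?_⟩
    · simpa [Function.comp_def] using (continuous_real_toNNReal.tendsto 0).comp tendsto_dyadic
    · simpa using dyadic_pos j
  filter_upwards [htend.eventually hev, eventually_gt_atTop 0] with j hj hj0
  have hd1 : dyadic j < 1 := pow_lt_one₀ (by norm_num) (by norm_num) hj0.ne'
  have hlog : 0 < -Real.log (dyadic j) := neg_pos.2 (Real.log_neg (dyadic_pos j) hd1)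
  rw [Real.coe_toNNReal _ (dyadic_pos j).le,
    EReal.div_lt_iff (by exact_mod_cast hlog) (EReal.coe_ne_top _), ← EReal.coe_mul] at hj
  have hN : ((Metric.externalCoveringNumber (dyadic j).toNNReal (F i) : ℕ∞) : ℝ≥0∞) <
      ENNReal.ofReal (dyadic j ^ (-σ)) := by
    have hp : 0 < dyadic j ^ (-σ) := Real.rpow_pos_of_pos (dyadic_pos j) _
    rw [← ENNReal.log_lt_log_iff, ENNReal.log_ofReal_of_pos hp, Real.log_rpow (dyadic_pos j)]
    convert hj using 2
    ring
  have hne : Metric.externalCoveringNumber (dyadic j).toNNReal (F i) ≠ ⊤ := by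
    intro htop
    rw [htop] at hN
    simp at hN
  obtain ⟨S, hS, hcard⟩ : ∃ S : Set X, Metric.IsCover (dyadic j).toNNReal (F i) S ∧
      S.encard = Metric.externalCoveringNumber (dyadic j).toNNReal (F i) := by
    have : Nonempty {S : Set X // Metric.IsCover (dyadic j).toNNReal (F i) S} := ⟨⟨F i, by simp⟩⟩
    obtain ⟨S, hS⟩ := ENat.exists_eq_iInf
      (fun S : {S : Set X // Metric.IsCover (dyadic j).toNNReal (F i) S} => S.1.encard)
    refine ⟨S.1, S.2, hS.trans ?_⟩
    rw [Metric.externalCoveringNumber, iInf_subtype]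
  have hfin : S.Finite := Set.encard_ne_top_iff.1 (hcard ▸ hne)
  refine ⟨hfin.toFinset, ?_, ?_⟩
  · rw [← hcard, hfin.encard_eq_coe_toFinset_card] at hN
    have := hN.le
    rw [ENat.toENNReal_coe, ← ENNReal.ofReal_natCast] at this
    exact (ENNReal.ofReal_le_ofReal_iff (Real.rpow_pos_of_pos (dyadic_pos j) _).le).1 this
  · rintro _ ⟨x, hx, rfl⟩
    obtain ⟨c, hc, hxc⟩ := hS hx
    refine Set.mem_iUnion₂.2 ⟨c, by simpa using hc, ?_⟩
    have h1 : edist (p x) c ≤ ((dyadic j).toNNReal : ℝ≥0∞) := hxc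
    rw [edist_dist] at h1
    exact (ENNReal.ofReal_le_ofReal_iff (dyadic_pos j).le).1 h1

/-- In the sup metric products of balls are balls, so the numbers multiply; the pieces are
intersected pairwise. -/
theorem HasCoverExponent.prodMk {X Y : Type*} [PseudoMetricSpace X] [PseudoMetricSpace Y]
    {p : E3 → X} {p' : E3 → Y} {B : Set E3} {σ : ℝ} (h : HasCoverExponent p B σ)
    (h' : HasCoverExponent p' B σ) : HasCoverExponent (fun x => (p x, p' x)) B (2 * σ) := by
  obtain ⟨F, hF, hFc⟩ := h
  obtain ⟨G, hG, hGc⟩ := h'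
  refine ⟨fun n => F n.unpair.1 ∩ G n.unpair.2, fun x hx => ?_, fun n => ?_⟩
  · obtain ⟨i, hi⟩ := Set.mem_iUnion.1 (hF hx)
    obtain ⟨k, hk⟩ := Set.mem_iUnion.1 (hG hx)
    exact Set.mem_iUnion.2 ⟨Nat.pair i k, by simpa using ⟨hi, hk⟩⟩
  · filter_upwards [hFc n.unpair.1, hGc n.unpair.2] with j ⟨S, hS, hSc⟩ ⟨T, hT, hTc⟩
    refine ⟨S ×ˢ T, ?_, ?_⟩
    · rw [Finset.card_product, show -(2 * σ) = -σ + -σ by ring, Real.rpow_add (dyadic_pos j)]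
      push_cast
      exact mul_le_mul hS hT (by positivity) (Real.rpow_nonneg (dyadic_pos j).le _)
    · rintro _ ⟨x, ⟨hx1, hx2⟩, rfl⟩
      obtain ⟨c, hc, hxc⟩ := Set.mem_iUnion₂.1 (hSc ⟨x, hx1, rfl⟩)
      obtain ⟨d, hd, hxd⟩ := Set.mem_iUnion₂.1 (hTc ⟨x, hx2, rfl⟩)
      refine Set.mem_iUnion₂.2 ⟨(c, d), by simp [hc, hd], ?_⟩
      rw [← closedBall_prod_same]
      exact ⟨hxc, hxd⟩

/-- If `p` maps `B` to a set with covering exponent less than `σ`, then almost all dyadic tubes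
`{x | dist (p x) (p y) ≤ 2 * 2⁻ʲ}` have mass at least `2 ^ (-σ j)`. -/
theorem HasCoverExponent.ae_eventually_le {X : Type*} [PseudoMetricSpace X]
    {p : E3 → X} {B : Set E3} {σ' σ : ℝ} (h : HasCoverExponent p B σ') (hσ : σ' < σ)
    {μ : Measure E3} (hμ : μ Bᶜ = 0) :
    ∀ᵐ y ∂μ, ∀ᶠ j in atTop,
      ENNReal.ofReal (dyadic j ^ σ) ≤ μ {x | dist (p x) (p y) ≤ 2 * dyadic j} := by
  obtain ⟨F, hF, hFc⟩ := h
  have hi : ∀ i, ∀ᵐ y ∂μ, y ∈ F i → ∀ᶠ j in atTop,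
      ENNReal.ofReal (dyadic j ^ σ) ≤ μ {x | dist (p x) (p y) ≤ 2 * dyadic j} := by
    intro i
    obtain ⟨j₀, hj₀⟩ := eventually_atTop.1 (hFc i)
    -- The points of `F i` with a light tube. Those landing in one covering ball all lie in the tube
    -- of any one of them, so `A j` has mass at most the number of balls times `δ^σ`. This is
    -- summable, and Borel–Cantelli applies.
    set A : ℕ → Set E3 := fun j => {y ∈ F i |
      μ {x | dist (p x) (p y) ≤ 2 * dyadic j} < ENNReal.ofReal (dyadic j ^ σ)} with hA
    have hAle : ∀ j ≥ j₀, μ (A j) ≤ ENNReal.ofReal (dyadic j ^ (σ - σ')) := by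
      intro j hj
      obtain ⟨S, hS, hSc⟩ := hj₀ j hj
      have hsub : A j ⊆ ⋃ c ∈ S, A j ∩ p ⁻¹' Metric.closedBall c (dyadic j) := by
        intro y hy
        obtain ⟨c, hc, hyc⟩ := Set.mem_iUnion₂.1 (hSc ⟨y, hy.1, rfl⟩)
        exact Set.mem_iUnion₂.2 ⟨c, hc, hy, hyc⟩
      have hpiece : ∀ c, μ (A j ∩ p ⁻¹' Metric.closedBall c (dyadic j)) ≤
          ENNReal.ofReal (dyadic j ^ σ) := by
        intro c
        rcases Set.eq_empty_or_nonempty (A j ∩ p ⁻¹' Metric.closedBall c (dyadic j))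
          with h0 | ⟨y, hy, hyc⟩
        · rw [h0]; simp
        · refine (measure_mono fun x hx => ?_).trans hy.2.le
          have h1 : dist (p x) c ≤ dyadic j := hx.2
          have h2 : dist (p y) c ≤ dyadic j := hyc
          have := dist_triangle_right (p x) (p y) c
          show dist (p x) (p y) ≤ 2 * dyadic j
          linarith
      calc μ (A j) ≤ ∑ c ∈ S, μ (A j ∩ p ⁻¹' Metric.closedBall c (dyadic j)) :=
            (measure_mono hsub).trans (measure_biUnion_finset_le _ _)
        _ ≤ ∑ c ∈ S, ENNReal.ofReal (dyadic j ^ σ) := Finset.sum_le_sum fun c _ => hpiece c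
        _ = ENNReal.ofReal (S.card * dyadic j ^ σ) := by
            rw [Finset.sum_const, nsmul_eq_mul, ENNReal.ofReal_mul (by positivity)]
            simp
        _ ≤ ENNReal.ofReal (dyadic j ^ (σ - σ')) := by
            refine ENNReal.ofReal_le_ofReal ?_
            rw [sub_eq_neg_add, Real.rpow_add (dyadic_pos j)]
            exact mul_le_mul_of_nonneg_right hS (Real.rpow_nonneg (dyadic_pos j).le _)
    have hsum : ∑' j, μ (A (j + j₀)) ≠ ∞ := by
      refine ne_top_of_le_ne_top ?_ (ENNReal.tsum_le_tsum fun j => hAle (j + j₀) (by omega))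
      exact ((summable_nat_add_iff j₀).2
        (summable_dyadic_rpow (sub_pos.2 hσ))).tsum_ofReal_ne_top
    filter_upwards [ae_eventually_notMem hsum] with y hy hyF
    have hy' := (tendsto_sub_atTop_nat j₀).eventually hy
    filter_upwards [hy', eventually_ge_atTop j₀] with j hj hjj
    rw [Nat.sub_add_cancel hjj] at hj
    by_contra hcon
    exact hj ⟨hyF, not_le.1 hcon⟩
  have hB : ∀ᵐ y ∂μ, y ∈ B := hμ
  filter_upwards [ae_all_iff.2 hi, hB] with y hy hyB
  obtain ⟨i, hyi⟩ := Set.mem_iUnion.1 (hF hyB)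
  exact hy i hyi

/-! ### Borel–Cantelli arguments for incidence relations -/

/-- Markov's inequality leaves an exceptional set of measure `O(δᵃ)` at each scale, and
Borel–Cantelli removes these sets. -/
theorem ae_eventually_le_dyadic {α : Type*} [MeasurableSpace α] {m : Measure α}
    {f : ℕ → α → ℝ≥0∞} (hf : ∀ j, Measurable (f j)) {C a b c : ℝ} (ha : 0 < a) (hc : 0 < c)
    (h : ∀ᶠ j in atTop, ∫⁻ x, f j x ∂m ≤ ENNReal.ofReal (C * dyadic j ^ (b + a))) :
    ∀ᵐ x ∂m, ∀ᶠ j in atTop, f j x ≤ ENNReal.ofReal (c * dyadic j ^ b) := by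
  obtain ⟨j₀, hj₀⟩ := eventually_atTop.1 h
  have hpos : ∀ j, 0 < c * dyadic j ^ b := fun j =>
    mul_pos hc (Real.rpow_pos_of_pos (dyadic_pos j) _)
  have hbound : ∀ j ≥ j₀, m {x | ENNReal.ofReal (c * dyadic j ^ b) ≤ f j x} ≤
      ENNReal.ofReal (C / c * dyadic j ^ a) := by
    intro j hj
    have h1 := meas_ge_le_lintegral_div (hf j).aemeasurable (μ := m)
      (ε := ENNReal.ofReal (c * dyadic j ^ b)) (by simpa using hpos j) ENNReal.ofReal_ne_top
    refine h1.trans ((ENNReal.div_le_div_right (hj₀ j hj) _).trans ?_)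
    rw [← ENNReal.ofReal_div_of_pos (hpos j)]
    refine ENNReal.ofReal_le_ofReal (le_of_eq ?_)
    rw [Real.rpow_add (dyadic_pos j)]
    have := (Real.rpow_pos_of_pos (dyadic_pos j) b).ne'
    field_simp
  have hsum : ∑' j, m {x | ENNReal.ofReal (c * dyadic (j + j₀) ^ b) ≤ f (j + j₀) x} ≠ ∞ := by
    refine ne_top_of_le_ne_top ?_ (ENNReal.tsum_le_tsum fun j => hbound (j + j₀) (by omega))
    exact ((summable_nat_add_iff (f := fun j => C / c * dyadic j ^ a) j₀).2
      ((summable_dyadic_rpow ha).mul_left _)).tsum_ofReal_ne_top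
  filter_upwards [ae_eventually_notMem hsum] with x hx
  have hx' := (tendsto_sub_atTop_nat j₀).eventually hx
  filter_upwards [hx', eventually_ge_atTop j₀] with j hj hjj
  rw [Nat.sub_add_cancel hjj] at hj
  exact (not_le.1 hj).le

/-- An average smaller by a factor `δᵃ` forces `f j ≤ (c / 2) δᵇ` eventually, almost everywhere. `A`
need not be measurable: it is enclosed in a null set of parameters. This matters because the
exceptional sets of projections are used without proving them measurable. -/
theorem null_of_eventually_ge {P : Type*} [MeasurableSpace P] {ν : Measure P} {μ : Measure E3}
    [SFinite ν] [SFinite μ] (hμ : μ ≠ 0) {f : ℕ → P × E3 → ℝ≥0∞} (hf : ∀ j, Measurable (f j))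
    {C a b c : ℝ} (ha : 0 < a) (hc : 0 < c)
    (h : ∀ᶠ j in atTop, ∫⁻ z, f j z ∂(ν.prod μ) ≤ ENNReal.ofReal (C * dyadic j ^ (b + a)))
    {A : Set P} (hA : ∀ p ∈ A, ∀ᵐ y ∂μ, ∀ᶠ j in atTop,
      ENNReal.ofReal (c * dyadic j ^ b) ≤ f j (p, y)) : ν A = 0 := by
  have h1 := Measure.ae_ae_of_ae_prod (ae_eventually_le_dyadic hf ha (half_pos hc) h)
  refine measure_mono_null (t := {p | ¬ ∀ᵐ y ∂μ, ∀ᶠ j in atTop,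
    f j (p, y) ≤ ENNReal.ofReal (c / 2 * dyadic j ^ b)}) ?_ (ae_iff.1 h1)
  intro p hp hcon
  have h2 : ∀ᵐ _y ∂μ, False := by
    filter_upwards [hA p hp, hcon] with y hy1 hy2
    obtain ⟨j, hj1, hj2⟩ := (hy1.and hy2).exists
    have hd := Real.rpow_pos_of_pos (dyadic_pos j) b
    have := (ENNReal.ofReal_le_ofReal_iff (by positivity)).1 (hj1.trans hj2)
    nlinarith
  rw [ae_iff] at h2
  exact hμ (Measure.measure_univ_eq_zero.1 (by simpa using h2))

section Relations

variable {μ : Measure E3} [IsFiniteMeasure μ] {P : Type*} [MeasurableSpace P]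

theorem measurable_measure_fibre {R : Set (P × E3 × E3)} (hR : MeasurableSet R) :
    Measurable fun z : P × E3 => μ {x | (z.1, z.2, x) ∈ R} :=
  measurable_measure_prodMk_left (ν := μ) (s := {w : (P × E3) × E3 | (w.1.1, w.1.2, w.2) ∈ R})
    (MeasurableEquiv.prodAssoc.measurable hR)

theorem measurable_measure_params {R : Set (P × E3 × E3)} (hR : MeasurableSet R) (lam : Measure P)
    [SFinite lam] : Measurable fun z : E3 × E3 => lam {θ | (θ, z.1, z.2) ∈ R} :=
  measurable_measure_prodMk_right hR

/-- Tonelli turns masses of tubes averaged over directions into lengths of parameter sets averaged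
over points. -/
theorem lintegral_measure_fibre_eq {R : Set (P × E3 × E3)} (hR : MeasurableSet R) (lam : Measure P)
    [SFinite lam] (y : E3) :
    ∫⁻ θ, μ {x | (θ, y, x) ∈ R} ∂lam = ∫⁻ x, lam {θ | (θ, y, x) ∈ R} ∂μ := by
  have hs : MeasurableSet {w : P × E3 | (w.1, y, w.2) ∈ R} :=
    (show Measurable fun w : P × E3 => (w.1, y, w.2) by fun_prop) hR
  have h1 := Measure.prod_apply (μ := lam) (ν := μ) hs
  have h2 := Measure.prod_apply_symm (μ := lam) (ν := μ) hs
  exact h1.symm.trans h2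

theorem lintegral_prod_measure_fibre_eq {R : Set (P × E3 × E3)} (hR : MeasurableSet R)
    (lam : Measure P) [SFinite lam] :
    ∫⁻ z : P × E3, μ {x | (z.1, z.2, x) ∈ R} ∂(lam.prod μ) =
      ∫⁻ y, ∫⁻ x, lam {θ | (θ, y, x) ∈ R} ∂μ ∂μ := by
  rw [lintegral_prod_symm' _ (measurable_measure_fibre hR)]
  exact lintegral_congr fun y => lintegral_measure_fibre_eq hR lam y

/-- Fibres of a relation that is small on average are small almost surely. -/
theorem ae_ae_eventually_measure_fibre_le {lam : Measure P} [SFinite lam]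
    {T : ℕ → Set (P × E3 × E3)} (hT : ∀ j, MeasurableSet (T j)) {C a b c : ℝ} (ha : 0 < a)
    (hc : 0 < c)
    (h : ∀ᶠ j in atTop, ∀ y, ∫⁻ x, lam {θ | (θ, y, x) ∈ T j} ∂μ ≤
      ENNReal.ofReal (C * dyadic j ^ (b + a))) :
    ∀ᵐ θ ∂lam, ∀ᵐ y ∂μ, ∀ᶠ j in atTop,
      μ {x | (θ, y, x) ∈ T j} ≤ ENNReal.ofReal (c * dyadic j ^ b) := by
  have h1 : ∀ᶠ j in atTop, ∫⁻ z : P × E3, μ {x | (z.1, z.2, x) ∈ T j} ∂(lam.prod μ) ≤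
      ENNReal.ofReal (((μ Set.univ).toReal * C) * dyadic j ^ (b + a)) := by
    filter_upwards [h] with j hj
    rw [lintegral_prod_measure_fibre_eq (hT j)]
    refine (lintegral_mono hj).trans (le_of_eq ?_)
    rw [lintegral_const, mul_assoc, ENNReal.ofReal_mul ENNReal.toReal_nonneg,
      ENNReal.ofReal_toReal (measure_ne_top _ _), mul_comm]
  exact Measure.ae_ae_of_ae_prod
    (ae_eventually_le_dyadic (fun j => measurable_measure_fibre (hT j)) ha hc h1)

/-- Two families of parameters whose fibres are large cannot both be non-null if the relation has
few incidence triples. -/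
theorem null_or_null_of_incidences (hμ : μ ≠ 0) {lam₁ lam₂ : Measure ℝ} [SFinite lam₁]
    [SFinite lam₂] {R : ℕ → Set (ℝ × E3 × E3)} (hR : ∀ j, MeasurableSet (R j)) {C a σ c : ℝ}
    (ha : 0 < a) (hc : 0 < c)
    (h : ∀ᶠ j in atTop, ∫⁻ X : E3 × E3, ∫⁻ y, lam₁ {θ | (θ, y, X.1) ∈ R j} *
      lam₂ {θ | (θ, y, X.2) ∈ R j} ∂μ ∂(μ.prod μ) ≤ ENNReal.ofReal (C * dyadic j ^ (2 * σ + a)))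
    {A₁ A₂ : Set ℝ}
    (hA₁ : ∀ θ ∈ A₁, ∀ᵐ y ∂μ, ∀ᶠ j in atTop,
      ENNReal.ofReal (c * dyadic j ^ σ) ≤ μ {x | (θ, y, x) ∈ R j})
    (hA₂ : ∀ θ ∈ A₂, ∀ᵐ y ∂μ, ∀ᶠ j in atTop,
      ENNReal.ofReal (c * dyadic j ^ σ) ≤ μ {x | (θ, y, x) ∈ R j}) :
    lam₁ A₁ = 0 ∨ lam₂ A₂ = 0 := by
  rw [← mul_eq_zero, ← Measure.prod_prod]
  have hq : ∀ j, Measurable fun z : ℝ × E3 => μ {x | (z.1, z.2, x) ∈ R j} := fun j =>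
    measurable_measure_fibre (hR j)
  have hw : ∀ (lam : Measure ℝ) [SFinite lam] (j : ℕ),
      Measurable fun z : E3 × E3 => lam {θ | (θ, z.1, z.2) ∈ R j} := fun lam _ j =>
    measurable_measure_params (hR j) lam
  have hf : ∀ j, Measurable fun z : (ℝ × ℝ) × E3 =>
      μ {x | (z.1.1, z.2, x) ∈ R j} * μ {x | (z.1.2, z.2, x) ∈ R j} := fun j =>
    ((hq j).comp (measurable_fst.fst.prodMk measurable_snd)).mul
      ((hq j).comp (measurable_fst.snd.prodMk measurable_snd))
  refine null_of_eventually_ge (c := c ^ 2) (b := 2 * σ) (C := C) (a := a) hμ hf ha (by positivity)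
    ?_ ?_
  · filter_upwards [h] with j hj
    refine le_trans (le_of_eq ?_) hj
    rw [lintegral_prod_symm' _ (hf j)]
    have hqy : ∀ y, Measurable fun θ : ℝ => μ {x | (θ, y, x) ∈ R j} := fun y =>
      (hq j).comp (measurable_id.prodMk measurable_const)
    have hwy : ∀ (lam : Measure ℝ) [SFinite lam] y,
        Measurable fun x : E3 => lam {θ | (θ, y, x) ∈ R j} := fun lam _ y =>
      (hw lam j).comp (measurable_const.prodMk measurable_id)
    -- For fixed `y` the integral of the product factors, Tonelli applies to each factor, and the
    -- factors recombine over independent points.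
    have h1 : ∀ y, ∫⁻ Θ : ℝ × ℝ, μ {x | (Θ.1, y, x) ∈ R j} * μ {x | (Θ.2, y, x) ∈ R j}
        ∂(lam₁.prod lam₂) = ∫⁻ X : E3 × E3, lam₁ {θ | (θ, y, X.1) ∈ R j} *
          lam₂ {θ | (θ, y, X.2) ∈ R j} ∂(μ.prod μ) := by
      intro y
      rw [lintegral_prod_mul (hqy y).aemeasurable (hqy y).aemeasurable,
        lintegral_prod_mul (hwy lam₁ y).aemeasurable (hwy lam₂ y).aemeasurable,
        lintegral_measure_fibre_eq (hR j), lintegral_measure_fibre_eq (hR j)]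
    simp only [h1]
    rw [lintegral_lintegral_swap]
    refine Measurable.aemeasurable ?_
    exact ((hw lam₁ j).comp (measurable_fst.prodMk measurable_snd.fst)).mul
      ((hw lam₂ j).comp (measurable_fst.prodMk measurable_snd.snd))
  · rintro ⟨θ₁, θ₂⟩ ⟨h1, h2⟩
    filter_upwards [hA₁ θ₁ h1, hA₂ θ₂ h2] with y hy1 hy2
    filter_upwards [hy1, hy2] with j hj1 hj2
    refine le_trans (le_of_eq ?_) (mul_le_mul' hj1 hj2)
    have := (Real.rpow_pos_of_pos (dyadic_pos j) σ)
    rw [← ENNReal.ofReal_mul (by positivity), show 2 * σ = σ + σ by ring,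
      Real.rpow_add (dyadic_pos j)]
    congr 1
    ring

/-- Three families of parameters whose fibres are large cannot all be non-null if the relation has
few incidence quadruples. -/
theorem null_or_null_or_null_of_incidences (hμ : μ ≠ 0) {lam₁ lam₂ lam₃ : Measure ℝ} [SFinite lam₁]
    [SFinite lam₂] [SFinite lam₃] {R : ℕ → Set (ℝ × E3 × E3)} (hR : ∀ j, MeasurableSet (R j))
    {C a σ c : ℝ} (ha : 0 < a) (hc : 0 < c)
    (h : ∀ᶠ j in atTop, ∫⁻ X : E3 × E3 × E3, ∫⁻ y, lam₁ {θ | (θ, y, X.1) ∈ R j} *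
      (lam₂ {θ | (θ, y, X.2.1) ∈ R j} * lam₃ {θ | (θ, y, X.2.2) ∈ R j})
        ∂μ ∂(μ.prod (μ.prod μ)) ≤ ENNReal.ofReal (C * dyadic j ^ (3 * σ + a)))
    {A₁ A₂ A₃ : Set ℝ}
    (hA₁ : ∀ θ ∈ A₁, ∀ᵐ y ∂μ, ∀ᶠ j in atTop,
      ENNReal.ofReal (c * dyadic j ^ σ) ≤ μ {x | (θ, y, x) ∈ R j})
    (hA₂ : ∀ θ ∈ A₂, ∀ᵐ y ∂μ, ∀ᶠ j in atTop,
      ENNReal.ofReal (c * dyadic j ^ σ) ≤ μ {x | (θ, y, x) ∈ R j})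
    (hA₃ : ∀ θ ∈ A₃, ∀ᵐ y ∂μ, ∀ᶠ j in atTop,
      ENNReal.ofReal (c * dyadic j ^ σ) ≤ μ {x | (θ, y, x) ∈ R j}) :
    lam₁ A₁ = 0 ∨ lam₂ A₂ = 0 ∨ lam₃ A₃ = 0 := by
  rw [← mul_eq_zero, ← mul_eq_zero, ← Measure.prod_prod, ← Measure.prod_prod]
  have hq : ∀ j, Measurable fun z : ℝ × E3 => μ {x | (z.1, z.2, x) ∈ R j} := fun j =>
    measurable_measure_fibre (hR j)
  have hw : ∀ (lam : Measure ℝ) [SFinite lam] (j : ℕ),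
      Measurable fun z : E3 × E3 => lam {θ | (θ, z.1, z.2) ∈ R j} := fun lam _ j =>
    measurable_measure_params (hR j) lam
  have hf : ∀ j, Measurable fun z : (ℝ × ℝ × ℝ) × E3 =>
      μ {x | (z.1.1, z.2, x) ∈ R j} * (μ {x | (z.1.2.1, z.2, x) ∈ R j} *
        μ {x | (z.1.2.2, z.2, x) ∈ R j}) := fun j =>
    ((hq j).comp (measurable_fst.fst.prodMk measurable_snd)).mul
      (((hq j).comp (measurable_fst.snd.fst.prodMk measurable_snd)).mul
      ((hq j).comp (measurable_fst.snd.snd.prodMk measurable_snd)))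
  refine null_of_eventually_ge (c := c ^ 3) (b := 3 * σ) (C := C) (a := a) hμ hf ha (by positivity)
    ?_ ?_
  · filter_upwards [h] with j hj
    refine le_trans (le_of_eq ?_) hj
    rw [lintegral_prod_symm' _ (hf j)]
    have hqy : ∀ y, Measurable fun θ : ℝ => μ {x | (θ, y, x) ∈ R j} := fun y =>
      (hq j).comp (measurable_id.prodMk measurable_const)
    have hwy : ∀ (lam : Measure ℝ) [SFinite lam] y,
        Measurable fun x : E3 => lam {θ | (θ, y, x) ∈ R j} := fun lam _ y =>
      (hw lam j).comp (measurable_const.prodMk measurable_id)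
    have h1 : ∀ y, ∫⁻ Θ : ℝ × ℝ × ℝ, μ {x | (Θ.1, y, x) ∈ R j} * (μ {x | (Θ.2.1, y, x) ∈ R j} *
          μ {x | (Θ.2.2, y, x) ∈ R j}) ∂(lam₁.prod (lam₂.prod lam₃)) =
        ∫⁻ X : E3 × E3 × E3, lam₁ {θ | (θ, y, X.1) ∈ R j} * (lam₂ {θ | (θ, y, X.2.1) ∈ R j} *
          lam₃ {θ | (θ, y, X.2.2) ∈ R j}) ∂(μ.prod (μ.prod μ)) := by
      intro y
      rw [lintegral_prod_mul (g := fun Θ : ℝ × ℝ => μ {x | (Θ.1, y, x) ∈ R j} *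
          μ {x | (Θ.2, y, x) ∈ R j}) (hqy y).aemeasurable
          (((hqy y).comp measurable_fst).mul ((hqy y).comp measurable_snd)).aemeasurable,
        lintegral_prod_mul (hqy y).aemeasurable (hqy y).aemeasurable,
        lintegral_prod_mul (g := fun X : E3 × E3 => lam₂ {θ | (θ, y, X.1) ∈ R j} *
          lam₃ {θ | (θ, y, X.2) ∈ R j}) (hwy lam₁ y).aemeasurable
          (((hwy lam₂ y).comp measurable_fst).mul ((hwy lam₃ y).comp measurable_snd)).aemeasurable,
        lintegral_prod_mul (hwy lam₂ y).aemeasurable (hwy lam₃ y).aemeasurable,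
        lintegral_measure_fibre_eq (hR j), lintegral_measure_fibre_eq (hR j),
        lintegral_measure_fibre_eq (hR j)]
    simp only [h1]
    rw [lintegral_lintegral_swap]
    refine Measurable.aemeasurable ?_
    exact ((hw lam₁ j).comp (measurable_fst.prodMk measurable_snd.fst)).mul
      (((hw lam₂ j).comp (measurable_fst.prodMk measurable_snd.snd.fst)).mul
      ((hw lam₃ j).comp (measurable_fst.prodMk measurable_snd.snd.snd)))
  · rintro ⟨θ₁, θ₂, θ₃⟩ ⟨h1, h2, h3⟩
    filter_upwards [hA₁ θ₁ h1, hA₂ θ₂ h2, hA₃ θ₃ h3] with y hy1 hy2 hy3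
    filter_upwards [hy1, hy2, hy3] with j hj1 hj2 hj3
    refine le_trans (le_of_eq ?_) (mul_le_mul' hj1 (mul_le_mul' hj2 hj3))
    have := (Real.rpow_pos_of_pos (dyadic_pos j) σ)
    rw [← ENNReal.ofReal_mul (by positivity), ← ENNReal.ofReal_mul (by positivity),
      show 3 * σ = σ + σ + σ by ring, Real.rpow_add (dyadic_pos j), Real.rpow_add (dyadic_pos j)]
    congr 1
    ring

end Relations

/-! ### Sublevel estimates for functions of one variable -/

theorem exists_hasDerivAt_sub_eq {J : Set ℝ} (hJ : J.OrdConnected) {f f' : ℝ → ℝ}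
    (hf : ∀ x ∈ J, HasDerivAt f (f' x) x) {a b : ℝ} (ha : a ∈ J) (hb : b ∈ J) (hab : a < b) :
    ∃ c ∈ Set.Ioo a b, f b - f a = f' c * (b - a) := by
  have hsub : Set.Icc a b ⊆ J := hJ.out ha hb
  obtain ⟨c, hc, h⟩ := exists_hasDerivAt_eq_slope f f' hab
    (fun x hx => (hf x (hsub hx)).continuousAt.continuousWithinAt)
    (fun x hx => hf x (hsub (Set.Ioo_subset_Icc_self hx)))
  refine ⟨c, hc, ?_⟩
  have : b - a ≠ 0 := (sub_pos.2 hab).ne'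
  rw [h]
  field_simp

theorem abs_sub_ge_of_abs_deriv_ge {J : Set ℝ} (hJ : J.OrdConnected) {f f' : ℝ → ℝ}
    (hf : ∀ x ∈ J, HasDerivAt f (f' x) x) {l : ℝ} (hl : ∀ x ∈ J, l ≤ |f' x|) {a b : ℝ} (ha : a ∈ J)
    (hb : b ∈ J) : l * |b - a| ≤ |f b - f a| := by
  rcases lt_trichotomy a b with h | rfl | h
  · obtain ⟨c, hc, h'⟩ := exists_hasDerivAt_sub_eq hJ hf ha hb h
    rw [h', abs_mul]
    exact mul_le_mul_of_nonneg_right (hl c (hJ.out ha hb (Set.Ioo_subset_Icc_self hc)))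
      (abs_nonneg _)
  · simp
  · obtain ⟨c, hc, h'⟩ := exists_hasDerivAt_sub_eq hJ hf hb ha h
    rw [abs_sub_comm (f b), abs_sub_comm b, h', abs_mul]
    exact mul_le_mul_of_nonneg_right (hl c (hJ.out hb ha (Set.Ioo_subset_Icc_self hc)))
      (abs_nonneg _)

theorem rolle_of_ne {J : Set ℝ} (hJ : J.OrdConnected) {f f' : ℝ → ℝ}
    (hf : ∀ x ∈ J, HasDerivAt f (f' x) x) {a b : ℝ} (ha : a ∈ J) (hb : b ∈ J) (hab : a ≠ b)
    (h : f a = f b) : ∃ c ∈ J, min a b < c ∧ c < max a b ∧ f' c = 0 := by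
  rcases lt_or_gt_of_ne hab with hlt | hlt
  · obtain ⟨c, hc, h'⟩ := exists_hasDerivAt_sub_eq hJ hf ha hb hlt
    refine ⟨c, hJ.out ha hb (Set.Ioo_subset_Icc_self hc), ?_, ?_, ?_⟩
    · rw [min_eq_left hlt.le]; exact hc.1
    · rw [max_eq_right hlt.le]; exact hc.2
    · rw [h, sub_self, eq_comm, mul_eq_zero] at h'
      exact h'.resolve_right (sub_pos.2 hlt).ne'
  · obtain ⟨c, hc, h'⟩ := exists_hasDerivAt_sub_eq hJ hf hb ha hlt
    refine ⟨c, hJ.out hb ha (Set.Ioo_subset_Icc_self hc), ?_, ?_, ?_⟩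
    · rw [min_eq_right hlt.le]; exact hc.1
    · rw [max_eq_left hlt.le]; exact hc.2
    · rw [h, sub_self, eq_comm, mul_eq_zero] at h'
      exact h'.resolve_right (sub_pos.2 hlt).ne'

/-- Second order Taylor expansion with Lagrange remainder. -/
theorem exists_taylor_two {J : Set ℝ} (hJ : J.OrdConnected) {f f' f'' : ℝ → ℝ}
    (hf : ∀ x ∈ J, HasDerivAt f (f' x) x) (hf' : ∀ x ∈ J, HasDerivAt f' (f'' x) x) {a b : ℝ}
    (ha : a ∈ J) (hb : b ∈ J) :
    ∃ c ∈ J, f b = f a + f' a * (b - a) + f'' c / 2 * (b - a) ^ 2 := by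
  rcases eq_or_ne a b with rfl | hab
  · exact ⟨a, ha, by simp⟩
  have hne : b - a ≠ 0 := sub_ne_zero.2 hab.symm
  set K : ℝ := (f b - f a - f' a * (b - a)) / (b - a) ^ 2 with hK
  have hKe : f b = f a + f' a * (b - a) + K * (b - a) ^ 2 := by
    rw [hK]; field_simp; ring
  have h1 : ∀ x ∈ J, HasDerivAt (fun x => f x - f' a * (x - a) - K * (x - a) ^ 2)
      (f' x - f' a - 2 * K * (x - a)) x := by
    intro x hx
    have h := ((hf x hx).sub (((hasDerivAt_id x).sub_const a).const_mul (f' a))).sub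
      ((((hasDerivAt_id x).sub_const a).pow 2).const_mul K)
    exact h.congr_deriv (by simp; ring)
  have h2 : ∀ x ∈ J, HasDerivAt (fun x => f' x - f' a - 2 * K * (x - a)) (f'' x - 2 * K) x := by
    intro x hx
    have h := ((hf' x hx).sub_const (f' a)).sub (((hasDerivAt_id x).sub_const a).const_mul (2 * K))
    exact h.congr_deriv (by simp)
  obtain ⟨c, hcJ, hc1, hc2, hc⟩ := rolle_of_ne hJ h1 ha hb hab (by rw [hKe]; ring)
  have hac : a ≠ c := by
    rintro rfl
    rcases le_total a b with h | h
    · rw [min_eq_left h] at hc1; exact lt_irrefl _ hc1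
    · rw [max_eq_left h] at hc2; exact lt_irrefl _ hc2
  obtain ⟨d, hdJ, -, -, hd⟩ := rolle_of_ne hJ h2 ha hcJ hac (by rw [hc]; ring)
  refine ⟨d, hdJ, ?_⟩
  rw [hKe, show f'' d = 2 * K by linarith]
  ring

theorem volume_sublevel_le {S : Set ℝ} {f : ℝ → ℝ} {l d : ℝ} (hl : 0 < l)
    (h : ∀ x ∈ S, ∀ y ∈ S, l * |y - x| ≤ |f y - f x|) :
    volume {x ∈ S | |f x| ≤ d} ≤ ENNReal.ofReal (2 * d / l) := by
  refine (Real.volume_le_diam _).trans (Metric.ediam_le ?_)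
  rintro x ⟨hx, hfx⟩ y ⟨hy, hfy⟩
  rw [edist_dist, Real.dist_eq]
  refine ENNReal.ofReal_le_ofReal ?_
  rw [le_div_iff₀ hl, mul_comm]
  refine (h y hy x hx).trans ?_
  have := abs_sub (f x) (f y)
  linarith

theorem volume_sublevel_le_of_deriv {J : Set ℝ} (hJ : J.OrdConnected) {f f' : ℝ → ℝ}
    (hf : ∀ x ∈ J, HasDerivAt f (f' x) x) {l d : ℝ} (hl : 0 < l) (h : ∀ x ∈ J, l ≤ |f' x|) :
    volume {x ∈ J | |f x| ≤ d} ≤ ENNReal.ofReal (2 * d / l) :=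
  volume_sublevel_le hl fun _ hx _ hy => abs_sub_ge_of_abs_deriv_ge hJ hf h hx hy

theorem monotoneOn_or_antitoneOn_of_deriv_ne_zero {J : Set ℝ} (hJ : J.OrdConnected)
    {f f' : ℝ → ℝ} (hf : ∀ x ∈ J, HasDerivAt f (f' x) x) (h : ∀ x ∈ J, f' x ≠ 0) :
    MonotoneOn f J ∨ AntitoneOn f J := by
  rcases hasDerivWithinAt_forall_lt_or_forall_gt_of_forall_ne hJ.convex
    (fun x hx => (hf x hx).hasDerivWithinAt) h with h' | h'
  · right
    intro x hx y hy hxy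
    rcases hxy.eq_or_lt with rfl | hlt
    · exact le_rfl
    obtain ⟨c, hc, hce⟩ := exists_hasDerivAt_sub_eq hJ hf hx hy hlt
    have := h' c (hJ.out hx hy (Set.Ioo_subset_Icc_self hc))
    nlinarith [sub_pos.2 hlt]
  · left
    intro x hx y hy hxy
    rcases hxy.eq_or_lt with rfl | hlt
    · exact le_rfl
    obtain ⟨c, hc, hce⟩ := exists_hasDerivAt_sub_eq hJ hf hx hy hlt
    have := h' c (hJ.out hx hy (Set.Ioo_subset_Icc_self hc))
    nlinarith [sub_pos.2 hlt]

/-- A nonvanishing `f''` makes `f'` monotone, so `{f' ≥ b}` and `{f' ≤ -b}` are intervals, and the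
mean value theorem applies on each. -/
theorem volume_sublevel_steep_le {J : Set ℝ} (hJ : J.OrdConnected) {f f' f'' : ℝ → ℝ}
    (hf : ∀ x ∈ J, HasDerivAt f (f' x) x) (hf' : ∀ x ∈ J, HasDerivAt f' (f'' x) x)
    (h : ∀ x ∈ J, f'' x ≠ 0) {b d : ℝ} (hb : 0 < b) (hd : 0 ≤ d) :
    volume {x ∈ J | |f x| ≤ d ∧ b ≤ |f' x|} ≤ ENNReal.ofReal (4 * d / b) := by
  have hmono := monotoneOn_or_antitoneOn_of_deriv_ne_zero hJ hf' h
  have h1 : ({x ∈ J | b ≤ f' x}).OrdConnected := by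
    refine ⟨fun x hx y hy z hz => ?_⟩
    have hzJ := hJ.out hx.1 hy.1 hz
    rcases hmono with hm | hm
    · exact ⟨hzJ, hx.2.trans (hm hx.1 hzJ hz.1)⟩
    · exact ⟨hzJ, hy.2.trans (hm hzJ hy.1 hz.2)⟩
  have h2 : ({x ∈ J | f' x ≤ -b}).OrdConnected := by
    refine ⟨fun x hx y hy z hz => ?_⟩
    have hzJ := hJ.out hx.1 hy.1 hz
    rcases hmono with hm | hm
    · exact ⟨hzJ, (hm hzJ hy.1 hz.2).trans hy.2⟩
    · exact ⟨hzJ, (hm hx.1 hzJ hz.1).trans hx.2⟩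
  have h3 := volume_sublevel_le_of_deriv h1 (f := f) (f' := f') (fun x hx => hf x hx.1) (d := d) hb
    (fun x hx => hx.2.trans (le_abs_self _))
  have h4 := volume_sublevel_le_of_deriv h2 (f := f) (f' := f') (fun x hx => hf x hx.1) (d := d) hb
    (fun x hx => (le_neg.1 hx.2).trans (neg_le_abs _))
  calc volume {x ∈ J | |f x| ≤ d ∧ b ≤ |f' x|}
      ≤ volume ({x ∈ {x ∈ J | b ≤ f' x} | |f x| ≤ d} ∪ {x ∈ {x ∈ J | f' x ≤ -b} | |f x| ≤ d}) := by
        refine measure_mono ?_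
        rintro x ⟨hx, hxd, hxb⟩
        rcases le_abs.1 hxb with hb' | hb'
        · exact Or.inl ⟨⟨hx, hb'⟩, hxd⟩
        · exact Or.inr ⟨⟨hx, le_neg.1 hb'⟩, hxd⟩
    _ ≤ ENNReal.ofReal (2 * d / b) + ENNReal.ofReal (2 * d / b) :=
        (measure_union_le _ _).trans (add_le_add h3 h4)
    _ = ENNReal.ofReal (4 * d / b) := by
        rw [← ENNReal.ofReal_add (by positivity) (by positivity)]
        congr 1
        ring

theorem volume_sublevel_le_sqrt {J : Set ℝ} (hJ : J.OrdConnected) {f f' f'' : ℝ → ℝ}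
    (hf : ∀ x ∈ J, HasDerivAt f (f' x) x) (hf' : ∀ x ∈ J, HasDerivAt f' (f'' x) x) {l d : ℝ}
    (hl : 0 < l) (h : ∀ x ∈ J, l ≤ |f'' x|) (hd : 0 < d) :
    volume {x ∈ J | |f x| ≤ d} ≤ ENNReal.ofReal (6 * √(d / l)) := by
  -- This slope balances the flat part, of length about `b / l`, against the steep part, of length
  -- about `d / b`.
  set b := √(d * l) with hb
  have hb0 : 0 < b := Real.sqrt_pos.2 (by positivity)
  have h1 := volume_sublevel_steep_le hJ hf hf'
    (fun x hx => abs_pos.1 (hl.trans_le (h x hx))) hb0 hd.le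
  have h2 := volume_sublevel_le_of_deriv hJ hf' (d := b) hl h
  have e1 : b / l = √(d / l) := by
    rw [hb, Real.sqrt_mul hd.le, Real.sqrt_div hd.le, div_eq_div_iff hl.ne' (Real.sqrt_pos.2 hl).ne',
      mul_assoc, Real.mul_self_sqrt hl.le]
  have e2 : d / b = √(d / l) := by
    rw [hb, Real.sqrt_mul hd.le, Real.sqrt_div hd.le,
      div_eq_div_iff (mul_pos (Real.sqrt_pos.2 hd) (Real.sqrt_pos.2 hl)).ne'
        (Real.sqrt_pos.2 hl).ne', ← mul_assoc, Real.mul_self_sqrt hd.le]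
  calc volume {x ∈ J | |f x| ≤ d}
      ≤ volume ({x ∈ J | |f' x| ≤ b} ∪ {x ∈ J | |f x| ≤ d ∧ b ≤ |f' x|}) := by
        refine measure_mono ?_
        rintro x ⟨hx, hxd⟩
        rcases le_total (|f' x|) b with hb' | hb'
        · exact Or.inl ⟨hx, hb'⟩
        · exact Or.inr ⟨hx, hxd, hb'⟩
    _ ≤ ENNReal.ofReal (2 * b / l) + ENNReal.ofReal (4 * d / b) :=
        (measure_union_le _ _).trans (add_le_add h2 h1)
    _ = ENNReal.ofReal (6 * √(d / l)) := by
        rw [← ENNReal.ofReal_add (by positivity) (by positivity), mul_div_assoc, mul_div_assoc, e1,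
          e2]
        congr 1
        ring

/-- A function with large second derivative that is small at two separated points is steep
there. -/
theorem steep_of_small_at_separated {J : Set ℝ} (hJ : J.OrdConnected) {f f' f'' : ℝ → ℝ}
    (hf : ∀ x ∈ J, HasDerivAt f (f' x) x) (hf' : ∀ x ∈ J, HasDerivAt f' (f'' x) x) {l d e : ℝ}
    (hl : 0 < l) (h : ∀ x ∈ J, l ≤ |f'' x|) {a b : ℝ} (ha : a ∈ J) (hb : b ∈ J) (he : 0 < e)
    (hab : e ≤ |b - a|) (hfa : |f a| ≤ d) (hfb : |f b| ≤ d) (hd : 8 * d < l * e ^ 2) :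
    l * e / 4 ≤ |f' a| := by
  by_contra! hcon
  obtain ⟨c, hc, hce⟩ := exists_taylor_two hJ hf hf' ha hb
  have h1 : |f'' c / 2 * (b - a) ^ 2| ≤ |f b| + |f a| + |f' a * (b - a)| := by
    have : f'' c / 2 * (b - a) ^ 2 = f b - f a - f' a * (b - a) := by linarith
    rw [this]
    exact (abs_sub _ _).trans (add_le_add_left (abs_sub _ _) _)
  rw [abs_mul, abs_div, abs_two, abs_mul, abs_of_nonneg (sq_nonneg (b - a)), ← sq_abs (b - a)] at h1
  set D := |b - a| with hD
  have h2 := h c hc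
  have hD0 : 0 < D := he.trans_le hab
  -- With `|f' a| < l e / 4`, Taylor gives `l D² / 2 ≤ 2 d + l e D / 4`, which is less than `l D² /
  -- 2`.
  have h3 : |f' a| * D ≤ l * e / 4 * D := mul_le_mul_of_nonneg_right hcon.le hD0.le
  have h4 : l / 2 * D ^ 2 ≤ |f'' c| / 2 * D ^ 2 := by gcongr
  have h5 : l * e * D ≤ l * D ^ 2 := by nlinarith [mul_pos hl hD0]
  have h6 : l * e ^ 2 ≤ l * D ^ 2 := by gcongr
  linarith

/-- The product of the measures of two separated pieces of a sublevel set. -/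
theorem volume_mul_volume_sublevel_le {J : Set ℝ} (hJ : J.OrdConnected) (hJ1 : volume J ≤ 1)
    {f f' f'' : ℝ → ℝ}
    (hf : ∀ x ∈ J, HasDerivAt f (f' x) x) (hf' : ∀ x ∈ J, HasDerivAt f' (f'' x) x) {l d e : ℝ}
    (hl : 0 < l) (h : ∀ x ∈ J, l ≤ |f'' x|) {I₁ I₂ : Set ℝ} (h₁ : I₁ ⊆ J) (h₂ : I₂ ⊆ J)
    (he : 0 < e) (he1 : e ≤ 1) (hsep : ∀ x ∈ I₁, ∀ y ∈ I₂, e ≤ |y - x|) (hd : 0 < d) :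
    volume {x ∈ I₁ | |f x| ≤ d} * volume {x ∈ I₂ | |f x| ≤ d} ≤
      ENNReal.ofReal ((16 * d / (l * e ^ 2)) ^ 2) := by
  have hle : ∀ {I : Set ℝ}, I ⊆ J → volume {x ∈ I | |f x| ≤ d} ≤ 1 := fun hI =>
    (measure_mono fun x hx => hI hx.1).trans hJ1
  -- For larger `d` the right side exceeds one and the bound is trivial. Otherwise a small value in
  -- one piece forces slope `l e / 4` at all small values in the other.
  rcases lt_or_ge (8 * d) (l * e ^ 2) with hde | hde
  · rcases Set.eq_empty_or_nonempty {x ∈ I₁ | |f x| ≤ d} with h0 | ⟨x₀, hx₀⟩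
    · rw [h0]; simp
    rcases Set.eq_empty_or_nonempty {x ∈ I₂ | |f x| ≤ d} with h0 | ⟨y₀, hy₀⟩
    · rw [h0]; simp
    have key : ∀ {I : Set ℝ} (_ : I ⊆ J) {z : ℝ} (_ : z ∈ J) (_ : |f z| ≤ d)
        (_ : ∀ x ∈ I, e ≤ |z - x|), volume {x ∈ I | |f x| ≤ d} ≤
          ENNReal.ofReal (16 * d / (l * e ^ 2)) := by
      intro I hI z hz hfz hs
      have hst := volume_sublevel_steep_le hJ hf hf' (b := l * e / 4) (d := d)
        (fun x hx => abs_pos.1 (hl.trans_le (h x hx))) (by positivity) hd.le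
      refine (measure_mono ?_).trans (hst.trans ?_)
      · rintro x ⟨hx, hfx⟩
        exact ⟨hI hx, hfx, steep_of_small_at_separated hJ hf hf' hl h (hI hx) hz he (hs x hx) hfx
          hfz hde⟩
      · refine ENNReal.ofReal_le_ofReal ?_
        rw [div_le_div_iff₀ (by positivity) (by positivity)]
        have : l * e ^ 2 ≤ l * e := by
          have : e ^ 2 ≤ e := by nlinarith
          gcongr
        nlinarith
    rw [sq, ENNReal.ofReal_mul (by positivity)]
    refine mul_le_mul' (key h₁ (h₂ hy₀.1) hy₀.2 fun x hx => hsep x hx y₀ hy₀.1)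
      (key h₂ (h₁ hx₀.1) hx₀.2 fun x hx => ?_)
    rw [abs_sub_comm]
    exact hsep x₀ hx₀.1 x hx
  · refine (mul_le_mul' (hle h₁) (hle h₂)).trans ?_
    rw [mul_one, ← ENNReal.ofReal_one]
    refine ENNReal.ofReal_le_ofReal (one_le_pow₀ ?_)
    rw [one_le_div₀ (by positivity)]
    linarith

/-! ### Short arcs of nondegenerate curves -/

/-- Quantitative nondegeneracy of a spherical curve `g₀`, with derivatives `g₁` and `g₂`, on a short
open interval `J`. -/
structure IsShortArc (J : Set ℝ) (g₀ g₁ g₂ : ℝ → E3) (m M : ℝ) : Prop where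
  isOpen : IsOpen J
  ordConnected : J.OrdConnected
  volume_le : volume J ≤ 1
  m_pos : 0 < m
  one_le : 1 ≤ M
  hasDerivAt₀ : ∀ θ ∈ J, HasDerivAt g₀ (g₁ θ) θ
  hasDerivAt₁ : ∀ θ ∈ J, HasDerivAt g₁ (g₂ θ) θ
  measurable₀ : Measurable g₀
  measurable₁ : Measurable g₁
  norm_eq_one : ∀ θ ∈ J, ‖g₀ θ‖ = 1
  norm_le₁ : ∀ θ ∈ J, ‖g₁ θ‖ ≤ M
  norm_le₂ : ∀ θ ∈ J, ‖g₂ θ‖ ≤ M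
  trichotomy : ∀ z : E3, (∀ θ ∈ J, m * ‖z‖ ≤ |inner ℝ (g₀ θ) z|) ∨
    (∀ θ ∈ J, m * ‖z‖ ≤ |inner ℝ (g₁ θ) z|) ∨ (∀ θ ∈ J, m * ‖z‖ ≤ |inner ℝ (g₂ θ) z|)
  mul_abs_sub_le : ∀ θ ∈ J, ∀ θ' ∈ J, m * |θ - θ'| ≤ ‖g₀ θ - g₀ θ'‖
  inner_nonneg : ∀ θ ∈ J, ∀ θ' ∈ J, 0 ≤ inner ℝ (g₀ θ) (g₀ θ')

/-- The three inner products form an injective linear map on a finite-dimensional space, hence one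
bounded below. -/
theorem exists_mul_norm_le_of_span_eq_top {a b c : E3} (h : Submodule.span ℝ {a, b, c} = ⊤) :
    ∃ k > 0, ∀ z : E3, k * ‖z‖ ≤ max |inner ℝ a z| (max |inner ℝ b z| |inner ℝ c z|) := by
  let L : E3 →ₗ[ℝ] (ℝ × ℝ × ℝ) :=
    (innerₛₗ ℝ a).prod ((innerₛₗ ℝ b).prod (innerₛₗ ℝ c))
  have hker : LinearMap.ker L = ⊥ := by
    rw [LinearMap.ker_eq_bot']
    intro z hz
    have hz' : inner ℝ a z = 0 ∧ inner ℝ b z = 0 ∧ inner ℝ c z = 0 := by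
      simpa [L, Prod.ext_iff] using hz
    have hmem : z ∈ (Submodule.span ℝ {a, b, c})ᗮ := by
      rw [Submodule.mem_orthogonal]
      intro u hu
      induction hu using Submodule.span_induction with
      | mem x hx =>
        rcases hx with rfl | rfl | rfl
        exacts [hz'.1, hz'.2.1, hz'.2.2]
      | zero => simp
      | add x y _ _ hx hy => rw [inner_add_left, hx, hy, add_zero]
      | smul r x _ hx => rw [inner_smul_left, hx, mul_zero]
    rw [h] at hmem
    simpa using hmem
  obtain ⟨K, hK, hL⟩ := L.exists_antilipschitzWith hker
  have hK' : (0 : ℝ) < K := by exact_mod_cast hK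
  refine ⟨(K : ℝ)⁻¹, inv_pos.2 hK', fun z => ?_⟩
  have h1 := hL.le_mul_dist z 0
  rw [map_zero, dist_zero_right, dist_zero_right] at h1
  rw [inv_mul_le_iff₀ hK']
  exact h1

/-- For each `z` one of `γ`, `γ'`, `γ''` at `θ₀` has a large inner product with `z`. By continuity
the same one works throughout a neighbourhood not depending on `z`. -/
theorem IsNondegenerateCurve.exists_isShortArc {U : Set ℝ} {γ : ℝ → E3}
    (h : IsNondegenerateCurve U γ) {θ₀ : ℝ} (hθ₀ : θ₀ ∈ U) :
    ∃ J ∈ 𝓝 θ₀, J ⊆ U ∧ ∃ g₀ g₁ g₂ m M, IsShortArc J g₀ g₁ g₂ m M ∧ ∀ θ ∈ J, g₀ θ = γ θ := by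
  have hc1 : ContDiffOn ℝ 2 (deriv γ) U := by
    have := (contDiffOn_succ_iff_deriv_of_isOpen (n := 2) h.isOpen).1
      (by simpa using h.contDiffOn.of_le (by norm_num))
    exact this.2.2
  have hc2 : ContDiffOn ℝ 1 (deriv (deriv γ)) U := by
    have := (contDiffOn_succ_iff_deriv_of_isOpen (n := 1) h.isOpen).1
      (by simpa using hc1.of_le (by norm_num))
    exact this.2.2
  have hd0 : ∀ θ ∈ U, HasDerivAt γ (deriv γ θ) θ := fun θ hθ =>
    ((h.contDiffOn.differentiableOn (by norm_num)).differentiableAt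
      (h.isOpen.mem_nhds hθ)).hasDerivAt
  have hd1 : ∀ θ ∈ U, HasDerivAt (deriv γ) (deriv (deriv γ) θ) θ := fun θ hθ =>
    ((hc1.differentiableOn (by norm_num)).differentiableAt (h.isOpen.mem_nhds hθ)).hasDerivAt
  have hd2 : ContinuousAt (deriv (deriv γ)) θ₀ :=
    hc2.continuousOn.continuousAt (h.isOpen.mem_nhds hθ₀)
  obtain ⟨k, hk, hkz⟩ := exists_mul_norm_le_of_span_eq_top (h.span_eq_top θ₀ hθ₀)
  have hv : deriv γ θ₀ ≠ 0 := by
    intro hv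
    have hspan := h.span_eq_top θ₀ hθ₀
    rw [hv] at hspan
    -- With zero velocity, two vectors would span three-space.
    have h2 : Submodule.span ℝ {γ θ₀, deriv (deriv γ) θ₀} = ⊤ := by
      rw [eq_top_iff, ← hspan, Submodule.span_le]
      rintro x (rfl | rfl | rfl)
      · exact Submodule.subset_span (by simp)
      · exact Submodule.zero_mem _
      · exact Submodule.subset_span (by simp)
    have h3 : Module.finrank ℝ (Submodule.span ℝ ({γ θ₀, deriv (deriv γ) θ₀} : Set E3)) ≤ 2 := by
      classical
      have := finrank_span_le_card (R := ℝ) ({γ θ₀, deriv (deriv γ) θ₀} : Set E3)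
      refine this.trans ?_
      rw [Set.toFinset_card]
      simpa [Set.toFinset_insert] using Finset.card_le_two (a := γ θ₀) (b := deriv (deriv γ) θ₀)
    rw [h2, finrank_top] at h3
    simp at h3
  set v := deriv γ θ₀ with hvdef
  have hvn : 0 < ‖v‖ := norm_pos_iff.2 hv
  -- `k / 2` preserves the lower bounds on inner products, `‖v‖ / 2` makes chords comparable to
  -- parameter differences, and `1 / 2` keeps chords at most one, so that inner products on the arc
  -- are nonnegative.
  set ε := min (k / 2) (min (‖v‖ / 2) (1 / 2)) with hε
  have hε0 : 0 < ε := by positivity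
  have e0 : ∀ᶠ θ in 𝓝 θ₀, ‖γ θ - γ θ₀‖ < ε := by
    have := (hd0 θ₀ hθ₀).continuousAt.eventually (Metric.ball_mem_nhds _ hε0)
    simpa [dist_eq_norm] using this
  have e1 : ∀ᶠ θ in 𝓝 θ₀, ‖deriv γ θ - v‖ < ε := by
    have := (hd1 θ₀ hθ₀).continuousAt.eventually (Metric.ball_mem_nhds _ hε0)
    simpa [dist_eq_norm] using this
  have e2 : ∀ᶠ θ in 𝓝 θ₀, ‖deriv (deriv γ) θ - deriv (deriv γ) θ₀‖ < ε := by
    have := hd2.eventually (Metric.ball_mem_nhds _ hε0)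
    simpa [dist_eq_norm] using this
  have eU : ∀ᶠ θ in 𝓝 θ₀, θ ∈ U := h.isOpen.mem_nhds hθ₀
  obtain ⟨r, hr, hball⟩ := Metric.eventually_nhds_iff_ball.1 ((eU.and e0).and (e1.and e2))
  set r' := min r (1 / 2) with hr'
  have hr'0 : 0 < r' := by positivity
  set J := Metric.ball θ₀ r' with hJ
  have hJr : ∀ θ ∈ J, (θ ∈ U ∧ ‖γ θ - γ θ₀‖ < ε) ∧ ‖deriv γ θ - v‖ < ε ∧
      ‖deriv (deriv γ) θ - deriv (deriv γ) θ₀‖ < ε := fun θ hθ =>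
    hball θ (Metric.ball_subset_ball (min_le_left _ _) hθ)
  have hεk : ε ≤ k / 2 := min_le_left _ _
  have hεv : ε ≤ ‖v‖ / 2 := (min_le_right _ _).trans (min_le_left _ _)
  have hε1 : ε ≤ 1 / 2 := (min_le_right _ _).trans (min_le_right _ _)
  have hind : ∀ θ ∈ J, J.indicator γ θ = γ θ := fun θ hθ => Set.indicator_of_mem hθ _
  have hJo : IsOpen J := Metric.isOpen_ball
  have hJc : J.OrdConnected := (convex_ball θ₀ r').ordConnected
  have hpert : ∀ {a a' z : E3}, ‖a' - a‖ < ε → k * ‖z‖ ≤ |inner ℝ a z| →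
      min (k / 2) (‖v‖ / 2) * ‖z‖ ≤ |inner ℝ a' z| := by
    intro a a' z ha hz
    have h1 : |inner ℝ a z| ≤ |inner ℝ a' z| + ‖a' - a‖ * ‖z‖ := by
      have h2 : inner ℝ a z = inner ℝ a' z - inner ℝ (a' - a) z := by rw [inner_sub_left]; ring
      rw [h2]
      exact (abs_sub _ _).trans (add_le_add_right (abs_real_inner_le_norm _ _) _)
    have h3 : ‖a' - a‖ * ‖z‖ ≤ k / 2 * ‖z‖ :=
      mul_le_mul_of_nonneg_right (ha.le.trans hεk) (norm_nonneg _)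
    have h4 : min (k / 2) (‖v‖ / 2) * ‖z‖ ≤ k / 2 * ‖z‖ :=
      mul_le_mul_of_nonneg_right (min_le_left _ _) (norm_nonneg _)
    linarith
  -- The curve is cut off outside `J` to be measurable on the whole line.
  refine ⟨J, Metric.ball_mem_nhds _ hr'0, fun θ hθ => (hJr θ hθ).1.1, J.indicator γ, deriv γ,
    deriv (deriv γ), min (k / 2) (‖v‖ / 2), 1 + (‖v‖ + ‖deriv (deriv γ) θ₀‖),
    ⟨hJo, hJc, ?_, by positivity, ?_, ?_, ?_, ?_, measurable_deriv γ, ?_, ?_, ?_, ?_, ?_, ?_⟩, hind⟩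
  · rw [hJ, Real.volume_ball, ← ENNReal.ofReal_one]
    refine ENNReal.ofReal_le_ofReal ?_
    have := min_le_right r (1 / 2)
    linarith
  · have := norm_nonneg v
    have := norm_nonneg (deriv (deriv γ) θ₀)
    linarith
  · intro θ hθ
    refine (hd0 θ (hJr θ hθ).1.1).congr_of_eventuallyEq ?_
    filter_upwards [hJo.mem_nhds hθ] with t ht using hind t ht
  · exact fun θ hθ => hd1 θ (hJr θ hθ).1.1
  · classical
    have hcont : ContinuousOn γ J := fun θ hθ =>
      (hd0 θ (hJr θ hθ).1.1).continuousAt.continuousWithinAt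
    have := hcont.measurable_piecewise (g := 0) continuousOn_const hJo.measurableSet
    rwa [Set.piecewise_eq_indicator] at this
  · intro θ hθ
    rw [hind θ hθ]
    exact h.norm_eq_one θ (hJr θ hθ).1.1
  · intro θ hθ
    have h1 := (hJr θ hθ).2.1
    have h2 := norm_le_insert' (deriv γ θ) v
    have h3 := norm_nonneg (deriv (deriv γ) θ₀)
    linarith
  · intro θ hθ
    have h1 := (hJr θ hθ).2.2
    have h2 := norm_le_insert' (deriv (deriv γ) θ) (deriv (deriv γ) θ₀)
    have h3 := norm_nonneg v
    linarith
  · intro z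
    have hz := hkz z
    rw [le_max_iff, le_max_iff] at hz
    rcases hz with hz | hz | hz
    · left
      intro θ hθ
      rw [hind θ hθ]
      exact hpert (hJr θ hθ).1.2 hz
    · right; left
      exact fun θ hθ => hpert (hJr θ hθ).2.1 hz
    · right; right
      exact fun θ hθ => hpert (hJr θ hθ).2.2 hz
  · intro θ hθ θ' hθ'
    rw [hind θ hθ, hind θ' hθ']
    have hder : ∀ t ∈ J, HasDerivAt (fun t => inner ℝ v (γ t)) (inner ℝ v (deriv γ t)) t :=
      fun t ht => by
        simpa using (hasDerivAt_const t v).inner ℝ (hd0 t (hJr t ht).1.1)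
    have hlow : ∀ t ∈ J, ‖v‖ * (‖v‖ / 2) ≤ |inner ℝ v (deriv γ t)| := by
      intro t ht
      have h1 : inner ℝ v (deriv γ t) = ‖v‖ ^ 2 + inner ℝ v (deriv γ t - v) := by
        rw [inner_sub_right, real_inner_self_eq_norm_sq]; ring
      have h2 := abs_real_inner_le_norm v (deriv γ t - v)
      have h3 : ‖v‖ * ‖deriv γ t - v‖ ≤ ‖v‖ * (‖v‖ / 2) :=
        mul_le_mul_of_nonneg_left ((hJr t ht).2.1.le.trans hεv) hvn.le
      have h4 := (abs_le.1 (h2.trans h3)).1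
      refine le_trans ?_ (le_abs_self _)
      rw [h1]
      nlinarith
    have h1 := abs_sub_ge_of_abs_deriv_ge hJc hder hlow hθ' hθ
    rw [← inner_sub_right] at h1
    have h2 := h1.trans (abs_real_inner_le_norm v (γ θ - γ θ'))
    rw [mul_assoc] at h2
    have h3 := le_of_mul_le_mul_left h2 hvn
    exact (mul_le_mul_of_nonneg_right (min_le_right _ _) (abs_nonneg _)).trans h3
  · intro θ hθ θ' hθ'
    rw [hind θ hθ, hind θ' hθ']
    have h1 := (hJr θ hθ).1.2
    have h2 := (hJr θ' hθ').1.2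
    have h3 : ‖γ θ - γ θ'‖ ≤ 1 := by
      have : γ θ - γ θ' = (γ θ - γ θ₀) - (γ θ' - γ θ₀) := by abel
      rw [this]
      exact (norm_sub_le _ _).trans (by linarith)
    have h4 := @norm_sub_sq_real E3 _ _ (γ θ) (γ θ')
    rw [h.norm_eq_one θ (hJr θ hθ).1.1, h.norm_eq_one θ' (hJr θ' hθ').1.1] at h4
    have h5 : ‖γ θ - γ θ'‖ ^ 2 ≤ 1 := pow_le_one₀ (norm_nonneg _) h3
    linarith

namespace IsShortArc

variable {J : Set ℝ} {g₀ g₁ g₂ : ℝ → E3} {m M : ℝ}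

theorem hasDerivAt_inner₀ (h : IsShortArc J g₀ g₁ g₂ m M) (z : E3) :
    ∀ θ ∈ J, HasDerivAt (fun θ => inner ℝ (g₀ θ) z) (inner ℝ (g₁ θ) z) θ := fun θ hθ => by
  simpa using (h.hasDerivAt₀ θ hθ).inner ℝ (hasDerivAt_const θ z)

theorem hasDerivAt_inner₁ (h : IsShortArc J g₀ g₁ g₂ m M) (z : E3) :
    ∀ θ ∈ J, HasDerivAt (fun θ => inner ℝ (g₁ θ) z) (inner ℝ (g₂ θ) z) θ := fun θ hθ => by
  simpa using (h.hasDerivAt₁ θ hθ).inner ℝ (hasDerivAt_const θ z)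

theorem volume_sep_le_one (h : IsShortArc J g₀ g₁ g₂ m M) (p : ℝ → Prop) :
    volume {θ ∈ J | p θ} ≤ 1 :=
  (measure_mono fun _ hx => hx.1).trans h.volume_le

/-- If `γ'` is the dominant vector the length is linear in `d / (m ‖z‖)`, if `γ''` is, it is its
square root; the worst case is the square root. If `γ` dominates, small `d` leaves no parameters at
all. -/
theorem volume_inner_le (h : IsShortArc J g₀ g₁ g₂ m M) {z : E3} (hz : z ≠ 0) {d : ℝ}
    (hd : 0 < d) :
    volume {θ ∈ J | |inner ℝ (g₀ θ) z| ≤ d} ≤ ENNReal.ofReal (6 * √(d / (m * ‖z‖))) := by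
  have hz' : 0 < m * ‖z‖ := mul_pos h.m_pos (norm_pos_iff.2 hz)
  have hbig : 1 ≤ 2 * (d / (m * ‖z‖)) →
      volume {θ ∈ J | |inner ℝ (g₀ θ) z| ≤ d} ≤ ENNReal.ofReal (6 * √(d / (m * ‖z‖))) := by
    intro h1
    refine (h.volume_sep_le_one _).trans ?_
    rw [← ENNReal.ofReal_one]
    refine ENNReal.ofReal_le_ofReal ?_
    have : (1 / 2 : ℝ) ≤ √(d / (m * ‖z‖)) := Real.le_sqrt_of_sq_le (by linarith)
    linarith
  rcases h.trichotomy z with h0 | h0 | h0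
  · rcases Set.eq_empty_or_nonempty {θ ∈ J | |inner ℝ (g₀ θ) z| ≤ d} with h1 | ⟨θ, hθ, hθd⟩
    · rw [h1]; simp
    · refine hbig ?_
      have := (one_le_div₀ hz').2 ((h0 θ hθ).trans hθd)
      linarith
  · rcases le_total 1 (2 * (d / (m * ‖z‖))) with h1 | h1
    · exact hbig h1
    · refine (volume_sublevel_le_of_deriv h.ordConnected (h.hasDerivAt_inner₀ z) hz' h0).trans ?_
      refine ENNReal.ofReal_le_ofReal ?_
      have h2 : d / (m * ‖z‖) ≤ √(d / (m * ‖z‖)) := by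
        refine Real.le_sqrt_of_sq_le ?_
        have : 0 < d / (m * ‖z‖) := by positivity
        nlinarith
      have h3 := Real.sqrt_nonneg (d / (m * ‖z‖))
      rw [mul_div_assoc]
      linarith
  · exact volume_sublevel_le_sqrt h.ordConnected (h.hasDerivAt_inner₀ z) (h.hasDerivAt_inner₁ z) hz'
      h0 hd

/-- Steepness at one point forces `b ≤ M ‖z‖`, so bounds in terms of `‖z‖` become bounds in terms of
`b`. -/
theorem volume_inner_steep_le (h : IsShortArc J g₀ g₁ g₂ m M) (z : E3) {b d : ℝ} (hb : 0 < b)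
    (hd : 0 < d) :
    volume {θ ∈ J | |inner ℝ (g₀ θ) z| ≤ d ∧ b ≤ |inner ℝ (g₁ θ) z|} ≤
      ENNReal.ofReal ((4 + 2 * M / m) * (d / b)) := by
  have hM : 0 < M := zero_lt_one.trans_le h.one_le
  have hm := h.m_pos
  rcases Set.eq_empty_or_nonempty {θ ∈ J | |inner ℝ (g₀ θ) z| ≤ d ∧ b ≤ |inner ℝ (g₁ θ) z|}
    with h1 | ⟨θ, hθ, hθd, hθb⟩
  · rw [h1]; simp
  have hbz : b ≤ M * ‖z‖ := hθb.trans ((abs_real_inner_le_norm _ _).trans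
    (mul_le_mul_of_nonneg_right (h.norm_le₁ θ hθ) (norm_nonneg _)))
  have hz : 0 < ‖z‖ := by
    by_contra! hcon
    have := mul_nonpos_of_nonneg_of_nonpos hM.le hcon
    linarith
  have hz' : 0 < m * ‖z‖ := mul_pos hm hz
  have hcmp : d / (m * ‖z‖) ≤ M / m * (d / b) := by
    rw [div_mul_div_comm, div_le_div_iff₀ hz' (by positivity)]
    nlinarith [mul_pos hm hd]
  have hsplit : (4 + 2 * M / m) * (d / b) = 4 * (d / b) + 2 * (M / m * (d / b)) := by ring
  have hdb : 0 < d / b := by positivity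
  rcases h.trichotomy z with h0 | h0 | h0
  · refine (h.volume_sep_le_one _).trans ?_
    rw [← ENNReal.ofReal_one]
    refine ENNReal.ofReal_le_ofReal ?_
    have := (one_le_div₀ hz').2 ((h0 θ hθ).trans hθd)
    linarith
  · refine (measure_mono ?_).trans ((volume_sublevel_le_of_deriv h.ordConnected
      (h.hasDerivAt_inner₀ z) (d := d) hz' h0).trans (ENNReal.ofReal_le_ofReal ?_))
    · exact fun t ht => ⟨ht.1, ht.2.1⟩
    · rw [mul_div_assoc]
      linarith
  · refine (volume_sublevel_steep_le h.ordConnected (h.hasDerivAt_inner₀ z) (h.hasDerivAt_inner₁ z)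
      (fun t ht => abs_pos.1 (hz'.trans_le (h0 t ht))) hb hd.le).trans
      (ENNReal.ofReal_le_ofReal ?_)
    rw [mul_div_assoc]
    have : 0 < M / m * (d / b) := by positivity
    linarith

/-- Separation upgrades two square-root bounds to two linear ones, giving exponent `2`. Lower
exponents follow because the product is also at most one. -/
theorem volume_mul_volume_inner_le (h : IsShortArc J g₀ g₁ g₂ m M) {I₁ I₂ : Set ℝ} (h₁ : I₁ ⊆ J)
    (h₂ : I₂ ⊆ J) {e : ℝ} (he : 0 < e) (he1 : e ≤ 1) (hsep : ∀ x ∈ I₁, ∀ y ∈ I₂, e ≤ |y - x|)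
    {z : E3} (hz : z ≠ 0) {d : ℝ} (hd : 0 < d) {p : ℝ} (hp0 : 0 ≤ p) (hp : p ≤ 2) :
    volume {θ ∈ I₁ | |inner ℝ (g₀ θ) z| ≤ d} * volume {θ ∈ I₂ | |inner ℝ (g₀ θ) z| ≤ d} ≤
      ENNReal.ofReal ((16 * d / (m * ‖z‖ * e ^ 2)) ^ p) := by
  have hz' : 0 < m * ‖z‖ := mul_pos h.m_pos (norm_pos_iff.2 hz)
  set X := 16 * d / (m * ‖z‖ * e ^ 2) with hX
  have hX0 : 0 < X := by positivity
  have hdX : 2 * d / (m * ‖z‖) ≤ X := by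
    rw [hX, div_le_div_iff₀ hz' (by positivity)]
    have : e ^ 2 ≤ 1 := pow_le_one₀ he.le he1
    nlinarith [mul_pos hd hz']
  have hle : ∀ {I : Set ℝ}, I ⊆ J → volume {x ∈ I | |inner ℝ (g₀ x) z| ≤ d} ≤ 1 := fun hI =>
    (measure_mono fun x hx => hI hx.1).trans h.volume_le
  have hone : volume {θ ∈ I₁ | |inner ℝ (g₀ θ) z| ≤ d} * volume {θ ∈ I₂ | |inner ℝ (g₀ θ) z| ≤ d}
      ≤ 1 := by
    simpa using mul_le_mul' (hle h₁) (hle h₂)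
  rcases le_or_gt 1 X with hX1 | hX1
  · refine hone.trans ?_
    rw [← ENNReal.ofReal_one]
    exact ENNReal.ofReal_le_ofReal (Real.one_le_rpow hX1 hp0)
  have hsq : volume {θ ∈ I₁ | |inner ℝ (g₀ θ) z| ≤ d} * volume {θ ∈ I₂ | |inner ℝ (g₀ θ) z| ≤ d}
      ≤ ENNReal.ofReal (X ^ 2) := by
    rcases h.trichotomy z with h0 | h0 | h0
    · rcases Set.eq_empty_or_nonempty {θ ∈ I₁ | |inner ℝ (g₀ θ) z| ≤ d} with h1 | ⟨θ, hθ, hθd⟩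
      · rw [h1]; simp
      · have h3 := (one_le_div₀ hz').2 ((h0 θ (h₁ hθ)).trans hθd)
        rw [mul_div_assoc] at hdX
        linarith
    · have key : ∀ {I : Set ℝ}, I ⊆ J → volume {x ∈ I | |inner ℝ (g₀ x) z| ≤ d} ≤
          ENNReal.ofReal X := fun hI =>
        (measure_mono (t := {x ∈ J | |inner ℝ (g₀ x) z| ≤ d})
          fun x hx => ⟨hI hx.1, hx.2⟩).trans ((volume_sublevel_le_of_deriv
          h.ordConnected (h.hasDerivAt_inner₀ z) (d := d) hz' h0).trans
          (ENNReal.ofReal_le_ofReal hdX))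
      rw [sq, ENNReal.ofReal_mul hX0.le]
      exact mul_le_mul' (key h₁) (key h₂)
    · exact volume_mul_volume_sublevel_le h.ordConnected h.volume_le (h.hasDerivAt_inner₀ z)
        (h.hasDerivAt_inner₁ z) hz' h0 h₁ h₂ he he1 hsep hd
  refine hsq.trans (ENNReal.ofReal_le_ofReal ?_)
  rw [← Real.rpow_natCast]
  exact Real.rpow_le_rpow_of_exponent_ge hX0 hX1.le (by simpa using hp)

end IsShortArc

/-! ### Pairs of projections onto lines -/

/-- A substitute for density points that needs no measurability; avoiding a finite set produces
distinct points. -/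
theorem exists_notMem_forall_nhds_pos {E : Set ℝ} (hE : volume E ≠ 0) {F : Set ℝ}
    (hF : F.Finite) : ∃ a ∈ E, a ∉ F ∧ ∀ u ∈ 𝓝 a, volume (E ∩ u) ≠ 0 := by
  have h1 : volume (E \ F) ≠ 0 := by
    rwa [measure_sdiff_null (hF.measure_zero _)]
  obtain ⟨a, ha, h⟩ := exists_mem_forall_mem_nhdsWithin_pos_measure h1
  refine ⟨a, ha.1, ha.2, fun u hu => ?_⟩
  refine (lt_of_lt_of_le (h _ (inter_mem_nhdsWithin (E \ F) hu)) (measure_mono ?_)).ne'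
  exact Set.inter_subset_inter_left _ Set.sdiff_subset

theorem ofReal_div_norm_rpow_le {x y : E3} {c p : ℝ} (hc : 0 < c) (hxy : x ≠ y) :
    ENNReal.ofReal ((c / ‖x - y‖) ^ p) ≤ ENNReal.ofReal (c ^ p) * edist x y ^ (-p) := by
  have h0 : 0 < ‖x - y‖ := norm_pos_iff.2 (sub_ne_zero.2 hxy)
  rw [edist_dist, dist_eq_norm, ENNReal.ofReal_rpow_of_pos h0, ← ENNReal.ofReal_mul (by positivity),
    Real.div_rpow hc.le h0.le, Real.rpow_neg h0.le, div_eq_mul_inv]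

theorem const_mul_edist_self_rpow {x : E3} {c : ℝ≥0∞} (hc : c ≠ 0) {p : ℝ} (hp : 0 < p) :
    c * edist x x ^ (-p) = ∞ := by
  rw [edist_self, ENNReal.zero_rpow_of_neg (neg_lt_zero.2 hp), ENNReal.mul_top hc]

theorem dist_lineProj (γ : ℝ → E3) (θ : ℝ) (x y : E3) :
    dist (lineProj γ θ x) (lineProj γ θ y) = |inner ℝ (γ θ) (x - y)| := by
  rw [Real.dist_eq, lineProj, lineProj, inner_sub_right]

/-- For two bad parameters the joint projection to `ℝ × ℝ` has covering exponent `2 σ`, so joint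
tubes have mass about `δ^(2σ)` at least. Averaged over separated pairs of parameters, that mass is
`O(δᵖ)` by the potential bound. -/
theorem IsShortArc.volume_hasCoverExponent_eq_zero {J : Set ℝ} {g₀ g₁ g₂ : ℝ → E3} {m M : ℝ}
    (h : IsShortArc J g₀ g₁ g₂ m M) {B : Set E3} {μ : Measure E3} [IsFiniteMeasure μ] (hμ : μ ≠ 0)
    (hB : μ Bᶜ = 0) {p : ℝ} (hp0 : 0 < p) (hp2 : p ≤ 2) {W : ℝ≥0∞} (hW : W ≠ ∞)
    (hpot : ∀ y, ∫⁻ x, edist x y ^ (-p) ∂μ ≤ W) {σ : ℝ} (hσ : 2 * σ < p) :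
    volume {θ ∈ J | HasCoverExponent (lineProj g₀ θ) B σ} = 0 := by
  set E := {θ ∈ J | HasCoverExponent (lineProj g₀ θ) B σ} with hEdef
  by_contra hE
  obtain ⟨a, haE, -, ha⟩ := exists_notMem_forall_nhds_pos hE Set.finite_empty
  obtain ⟨b, hbE, hba, hb⟩ := exists_notMem_forall_nhds_pos hE (Set.finite_singleton a)
  have hab : 0 < |a - b| := abs_pos.2 (sub_ne_zero.2 fun h => hba h.symm)
  set e := min (|a - b| / 3) 1 with he
  have he0 : 0 < e := by positivity
  have he1 : e ≤ 1 := min_le_right _ _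
  have he3 : e ≤ |a - b| / 3 := min_le_left _ _
  set I₁ := J ∩ Metric.ball a e with hI₁
  set I₂ := J ∩ Metric.ball b e with hI₂
  have hsep : ∀ x ∈ I₁, ∀ y ∈ I₂, e ≤ |y - x| := by
    rintro x ⟨-, hx⟩ y ⟨-, hy⟩
    rw [Metric.mem_ball, Real.dist_eq] at hx hy
    have h1 : |a - b| ≤ |x - a| + |y - x| + |y - b| := by
      have : a - b = -(x - a) - (y - x) + (y - b) := by ring
      rw [this]
      refine (abs_add_le _ _).trans (add_le_add_left ((abs_sub _ _).trans ?_) _)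
      rw [abs_neg]
    linarith
  have hI₁m : MeasurableSet I₁ := h.isOpen.measurableSet.inter measurableSet_ball
  have hI₂m : MeasurableSet I₂ := h.isOpen.measurableSet.inter measurableSet_ball
  have hdm : ∀ (d : ℝ) (z : E3), MeasurableSet {θ | |inner ℝ (g₀ θ) z| ≤ d} := fun d z =>
    measurableSet_le (h.measurable₀.inner measurable_const).abs measurable_const
  set R : ℕ → Set ((ℝ × ℝ) × E3 × E3) := fun j => {w | |inner ℝ (g₀ w.1.1) (w.2.2 - w.2.1)| ≤
    2 * dyadic j ∧ |inner ℝ (g₀ w.1.2) (w.2.2 - w.2.1)| ≤ 2 * dyadic j} with hR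
  have hRm : ∀ j, MeasurableSet (R j) := by
    intro j
    have h1 : MeasurableSet {w : (ℝ × ℝ) × E3 × E3 |
        |inner ℝ (g₀ w.1.1) (w.2.2 - w.2.1)| ≤ 2 * dyadic j} :=
      measurableSet_le ((h.measurable₀.comp measurable_fst.fst).inner
        (measurable_snd.snd.sub measurable_snd.fst)).abs measurable_const
    have h2 : MeasurableSet {w : (ℝ × ℝ) × E3 × E3 |
        |inner ℝ (g₀ w.1.2) (w.2.2 - w.2.1)| ≤ 2 * dyadic j} :=
      measurableSet_le ((h.measurable₀.comp measurable_fst.snd).inner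
        (measurable_snd.snd.sub measurable_snd.fst)).abs measurable_const
    exact h1.inter h2
  have hm := h.m_pos
  set D : ℝ := (32 / (m * e ^ 2)) ^ p with hD
  have hD0 : 0 < D := by positivity
  have hpt : ∀ j y x, ((volume.restrict I₁).prod (volume.restrict I₂)) {Θ | (Θ, y, x) ∈ R j} ≤
      ENNReal.ofReal (D * dyadic j ^ p) * edist x y ^ (-p) := by
    intro j y x
    have hd := dyadic_pos j
    have hc0 : ENNReal.ofReal (D * dyadic j ^ p) ≠ 0 := by
      have := Real.rpow_pos_of_pos hd p
      simpa using mul_pos hD0 this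
    rcases eq_or_ne x y with rfl | hxy
    · rw [const_mul_edist_self_rpow hc0 hp0]
      exact le_top
    have hset : {Θ : ℝ × ℝ | (Θ, y, x) ∈ R j} = {θ | |inner ℝ (g₀ θ) (x - y)| ≤ 2 * dyadic j} ×ˢ
        {θ | |inner ℝ (g₀ θ) (x - y)| ≤ 2 * dyadic j} := rfl
    rw [hset, Measure.prod_prod, Measure.restrict_apply (hdm _ _), Measure.restrict_apply (hdm _ _)]
    have h1 := h.volume_mul_volume_inner_le (I₁ := I₁) (I₂ := I₂) Set.inter_subset_left
      Set.inter_subset_left he0 he1 hsep (sub_ne_zero.2 hxy) (d := 2 * dyadic j) (by positivity)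
      hp0.le hp2
    rw [Set.inter_comm, Set.inter_comm _ I₂]
    refine h1.trans ?_
    have h2 := ofReal_div_norm_rpow_le (c := 32 / (m * e ^ 2) * dyadic j) (by positivity) (p := p) hxy
    rw [Real.mul_rpow (by positivity) hd.le] at h2
    refine le_trans (le_of_eq ?_) h2
    congr 2
    have : ‖x - y‖ ≠ 0 := norm_ne_zero_iff.2 (sub_ne_zero.2 hxy)
    field_simp
    norm_num
  have hnull : ((volume.restrict I₁).prod (volume.restrict I₂)) (E ×ˢ E) = 0 := by
    -- Room on both sides: above `2 σ` for the lower mass bound, below `p` for Borel–Cantelli.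
    obtain ⟨σ', hσ1, hσ2⟩ := exists_between hσ
    refine null_of_eventually_ge (b := σ') (a := p - σ') (c := 1)
      (C := (W * μ Set.univ).toReal * D) hμ
      (fun j => measurable_measure_fibre (μ := μ) (hRm j)) (by linarith) one_pos
      (Eventually.of_forall fun j => ?_) ?_
    · rw [lintegral_prod_measure_fibre_eq (hRm j)]
      calc ∫⁻ y, ∫⁻ x, ((volume.restrict I₁).prod (volume.restrict I₂)) {Θ | (Θ, y, x) ∈ R j} ∂μ ∂μ
          ≤ ∫⁻ y, ENNReal.ofReal (D * dyadic j ^ p) * W ∂μ := by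
            refine lintegral_mono fun y => (lintegral_mono (hpt j y)).trans ?_
            rw [lintegral_const_mul' _ _ ENNReal.ofReal_ne_top]
            gcongr
            exact hpot y
        _ = ENNReal.ofReal ((W * μ Set.univ).toReal * D * dyadic j ^ (σ' + (p - σ'))) := by
            rw [lintegral_const, mul_assoc, mul_assoc, ENNReal.ofReal_mul ENNReal.toReal_nonneg,
              ENNReal.ofReal_toReal (ENNReal.mul_ne_top hW (measure_ne_top _ _)), mul_comm]
            congr 3
            ring_nf
    · rintro ⟨θ₁, θ₂⟩ ⟨h1, h2⟩
      filter_upwards [(h1.2.prodMk h2.2).ae_eventually_le hσ1 hB] with y hy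
      filter_upwards [hy] with j hj
      rw [one_mul]
      refine hj.trans (measure_mono fun x hx => ?_)
      have hx' : max (dist (lineProj g₀ θ₁ x) (lineProj g₀ θ₁ y))
          (dist (lineProj g₀ θ₂ x) (lineProj g₀ θ₂ y)) ≤ 2 * dyadic j := hx
      rw [max_le_iff, dist_lineProj, dist_lineProj] at hx'
      exact hx'
  rw [Measure.prod_prod, mul_eq_zero] at hnull
  have hpos : ∀ {c : ℝ}, c ∈ E → (∀ u ∈ 𝓝 c, volume (E ∩ u) ≠ 0) →
      volume.restrict (J ∩ Metric.ball c e) E ≠ 0 := by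
    intro c hc hcu
    rw [Measure.restrict_apply' (h.isOpen.measurableSet.inter measurableSet_ball)]
    exact hcu _ (inter_mem (h.isOpen.mem_nhds hc.1) (Metric.ball_mem_nhds _ he0))
  rcases hnull with h1 | h1
  · exact hpos haE ha h1
  · exact hpos hbE hb h1

/-! ### Projections onto planes -/

/-- The distance from `z` to the line spanned by the unit vector `g`. -/
noncomputable def lineDist (g z : E3) : ℝ := ‖z - inner ℝ g z • g‖

theorem lineDist_le_norm {g : E3} (hg : ‖g‖ = 1) (z : E3) : lineDist g z ≤ ‖z‖ := by
  have h1 : ‖z - inner ℝ g z • g‖ ^ 2 = ‖z‖ ^ 2 - inner ℝ g z ^ 2 := by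
    rw [norm_sub_sq_real, inner_smul_right, norm_smul, hg, real_inner_comm, Real.norm_eq_abs, mul_one,
      sq_abs]
    ring
  refine le_of_sq_le_sq ?_ (norm_nonneg z)
  rw [lineDist, h1]
  nlinarith [sq_nonneg (inner ℝ g z)]

theorem lineDist_add_le (g z w : E3) : lineDist g (z + w) ≤ lineDist g z + lineDist g w := by
  unfold lineDist
  refine le_trans (le_of_eq ?_) (norm_add_le _ _)
  congr 1
  rw [inner_add_right]
  module

theorem lineDist_smul (g z : E3) (c : ℝ) : lineDist g (c • z) = |c| * lineDist g z := by
  unfold lineDist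
  rw [← Real.norm_eq_abs, ← norm_smul]
  congr 1
  rw [inner_smul_right]
  module

/-- With `u` the inner product, the claim is `(1 - u) / 2 ≤ 1 - u²`. Nonnegativity of `u` excludes
nearly antipodal vectors, which span nearly the same line. -/
theorem half_norm_sub_le_lineDist {g g' : E3} (hg : ‖g‖ = 1) (hg' : ‖g'‖ = 1)
    (h : 0 ≤ inner ℝ g g') : ‖g - g'‖ / 2 ≤ lineDist g g' := by
  have h1 : ‖g' - inner ℝ g g' • g‖ ^ 2 = 1 - inner ℝ g g' ^ 2 := by
    rw [norm_sub_sq_real, inner_smul_right, norm_smul, hg, hg', real_inner_comm, Real.norm_eq_abs,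
      mul_one, sq_abs]
    ring
  have h2 : ‖g - g'‖ ^ 2 = 2 - 2 * inner ℝ g g' := by
    rw [norm_sub_sq_real, hg, hg']; ring
  have h3 : inner ℝ g g' ≤ 1 := by
    have := real_inner_le_norm g g'
    rwa [hg, hg', one_mul] at this
  refine le_of_sq_le_sq ?_ (norm_nonneg _)
  rw [lineDist, div_pow, h1, h2]
  nlinarith

theorem dist_planeProj {γ : ℝ → E3} {θ : ℝ} (h : ‖γ θ‖ = 1) (x y : E3) :
    dist (planeProj γ θ x) (planeProj γ θ y) = lineDist (γ θ) (x - y) := by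
  rw [dist_eq_norm, planeProj, planeProj, ← map_sub, ← Submodule.norm_coe, lineDist]
  congr 1
  rw [← Submodule.starProjection_unit_singleton ℝ h]
  exact Submodule.starProjection_orthogonal_val _

/-! ### Lines with directions on the curve. -/

namespace IsShortArc

variable {J : Set ℝ} {g₀ g₁ g₂ : ℝ → E3} {m M : ℝ}

theorem norm_sub_le (h : IsShortArc J g₀ g₁ g₂ m M) {θ θ' : ℝ} (hθ : θ ∈ J) (hθ' : θ' ∈ J) :
    ‖g₀ θ - g₀ θ'‖ ≤ M * |θ - θ'| :=
  h.ordConnected.convex.norm_image_sub_le_of_norm_hasDerivWithin_le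
    (fun t ht => (h.hasDerivAt₀ t ht).hasDerivWithinAt) h.norm_le₁ hθ' hθ

/-- If `z` is close to the lines of two parameters, these lines make an angle `O(d / ‖z‖)`, hence
the parameters differ by that order. The summand `2` serves the trivial range `‖z‖ ≤ 2 d`. -/
theorem volume_lineDist_le (h : IsShortArc J g₀ g₁ g₂ m M) {z : E3} (hz : z ≠ 0) {d : ℝ}
    (hd : 0 < d) :
    volume {θ ∈ J | lineDist (g₀ θ) z ≤ d} ≤ ENNReal.ofReal ((8 / m + 2) * (d / ‖z‖)) := by
  have hz' : 0 < ‖z‖ := norm_pos_iff.2 hz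
  have hm := h.m_pos
  have hdz : 0 < d / ‖z‖ := by positivity
  rcases le_or_gt ‖z‖ (2 * d) with hle | hlt
  · refine (h.volume_sep_le_one _).trans ?_
    rw [← ENNReal.ofReal_one]
    refine ENNReal.ofReal_le_ofReal ?_
    have h1 : 1 ≤ 2 * (d / ‖z‖) := by
      rw [← mul_div_assoc, one_le_div₀ hz']
      exact hle
    have : 0 < 8 / m * (d / ‖z‖) := by positivity
    linarith
  refine (Real.volume_le_diam _).trans (Metric.ediam_le ?_)
  rintro θ ⟨hθ, hθd⟩ θ' ⟨hθ', hθd'⟩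
  rw [edist_dist, Real.dist_eq]
  refine ENNReal.ofReal_le_ofReal ?_
  set ρ := inner ℝ (g₀ θ') z with hρ
  set e := z - ρ • g₀ θ' with he
  have hze : z = ρ • g₀ θ' + e := by rw [he]; abel
  have hen : ‖e‖ ≤ d := hθd'
  have hρz : ‖z‖ / 2 ≤ |ρ| := by
    have h1 : ‖z‖ ≤ |ρ| + ‖e‖ := by
      conv_lhs => rw [hze]
      refine (norm_add_le _ _).trans (le_of_eq ?_)
      rw [norm_smul, h.norm_eq_one θ' hθ', mul_one, Real.norm_eq_abs]
    linarith
  have h1 : |ρ| * lineDist (g₀ θ) (g₀ θ') ≤ 2 * d := by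
    rw [← lineDist_smul]
    have h2 : ρ • g₀ θ' = z + (-1 : ℝ) • e := by rw [hze]; module
    rw [h2]
    refine (lineDist_add_le _ _ _).trans ?_
    rw [lineDist_smul, abs_neg, abs_one, one_mul]
    have := lineDist_le_norm (h.norm_eq_one θ hθ) e
    linarith
  have h2 : m * |θ - θ'| / 2 ≤ lineDist (g₀ θ) (g₀ θ') :=
    (div_le_div_of_nonneg_right (h.mul_abs_sub_le θ hθ θ' hθ') zero_le_two).trans
      (half_norm_sub_le_lineDist (h.norm_eq_one θ hθ) (h.norm_eq_one θ' hθ')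
        (h.inner_nonneg θ hθ θ' hθ'))
  have h3 : ‖z‖ / 2 * (m * |θ - θ'| / 2) ≤ 2 * d :=
    (mul_le_mul hρz h2 (by positivity) (abs_nonneg _)).trans h1
  have h4 : |θ - θ'| ≤ 8 / m * (d / ‖z‖) := by
    rw [div_mul_div_comm, le_div_iff₀ (by positivity)]
    linarith
  linarith

/-- Near two distinct parameters `a` and `b`, the coefficient of `g₀ θ₁` is controlled by the norm of
a combination of `g₀ θ₁`, `g₀ θ₂` and a chord of the curve at `θ₂`. -/
theorem exists_abs_coeff_le (h : IsShortArc J g₀ g₁ g₂ m M) {a b : ℝ} (ha : a ∈ J) (hb : b ∈ J)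
    (hab : a ≠ b) :
    ∃ C > 0, ∃ e > 0, Metric.ball a e ⊆ J ∧ Metric.ball b e ⊆ J ∧
      ∀ θ₁ ∈ Metric.ball a e, ∀ θ₂ ∈ Metric.ball b e, ∀ θ₂' ∈ Metric.ball b e, ∀ α β ρ : ℝ,
        |α| ≤ C * ‖α • g₀ θ₁ + β • g₀ θ₂ + ρ • (g₀ θ₂' - g₀ θ₂)‖ := by
  have hm := h.m_pos
  let L : (ℝ × ℝ × ℝ) →ₗ[ℝ] E3 :=
    (LinearMap.toSpanSingleton ℝ E3 (g₀ a)).coprod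
      ((LinearMap.toSpanSingleton ℝ E3 (g₀ b)).coprod (LinearMap.toSpanSingleton ℝ E3 (g₁ b)))
  have hL : ∀ α β κ : ℝ, L (α, β, κ) = α • g₀ a + (β • g₀ b + κ • g₁ b) := fun α β κ => by
    simp [L]
  -- A vector orthogonal to `g₀ a`, `g₀ b` and `g₁ b` gives a function with a double zero at `b` and
  -- a zero at `a`, so its second derivative vanishes somewhere too; the trichotomy then kills the
  -- vector.
  have hker : LinearMap.ker L = ⊥ := by
    rw [LinearMap.ker_eq_bot, LinearMap.injective_iff_surjective_of_finrank_eq_finrank (by simp),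
      ← LinearMap.range_eq_top, ← Submodule.orthogonal_eq_bot_iff, eq_bot_iff]
    intro w hw
    rw [Submodule.mem_orthogonal] at hw
    have w0 : inner ℝ (g₀ a) w = 0 := by
      simpa [hL] using hw _ (LinearMap.mem_range_self L (1, 0, 0))
    have w1 : inner ℝ (g₀ b) w = 0 := by
      simpa [hL] using hw _ (LinearMap.mem_range_self L (0, 1, 0))
    have w2 : inner ℝ (g₁ b) w = 0 := by
      simpa [hL] using hw _ (LinearMap.mem_range_self L (0, 0, 1))
    have key : ∀ {v : E3}, m * ‖w‖ ≤ |inner ℝ v w| → inner ℝ v w = 0 → w = 0 := by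
      intro v h1 h2
      rw [h2, abs_zero] at h1
      have := nonpos_of_mul_nonpos_right h1 hm
      simpa using this
    rw [Submodule.mem_bot]
    rcases h.trichotomy w with h0 | h0 | h0
    · exact key (h0 a ha) w0
    · exact key (h0 b hb) w2
    · obtain ⟨c, hc, hce⟩ := exists_taylor_two h.ordConnected (h.hasDerivAt_inner₀ w)
        (h.hasDerivAt_inner₁ w) hb ha
      simp only [w0, w1, w2] at hce
      refine key (h0 c hc) ?_
      have : (a - b) ^ 2 ≠ 0 := pow_ne_zero 2 (sub_ne_zero.2 hab)
      have h3 : inner ℝ (g₂ c) w / 2 * (a - b) ^ 2 = 0 := by linarith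
      have h4 := (mul_eq_zero.1 h3).resolve_right this
      linarith
  obtain ⟨K, hK, hanti⟩ := L.exists_antilipschitzWith hker
  have hK' : (0 : ℝ) < K := by exact_mod_cast hK
  have hlow : ∀ α β κ : ℝ, max |α| (max |β| |κ|) ≤ K * ‖α • g₀ a + (β • g₀ b + κ • g₁ b)‖ := by
    intro α β κ
    have h1 := hanti.le_mul_dist (α, β, κ) 0
    rw [map_zero, dist_zero_right, dist_zero_right, hL] at h1
    exact h1
  -- Three perturbations of size `ε X` contribute `3 K ε X = X / 2`, which is absorbed.
  set ε := (6 * (K : ℝ))⁻¹ with hε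
  have hε0 : 0 < ε := by positivity
  have ea : ∀ᶠ θ in 𝓝 a, θ ∈ J ∧ ‖g₀ θ - g₀ a‖ ≤ ε := by
    have e1 : ∀ᶠ θ in 𝓝 a, θ ∈ J := h.isOpen.mem_nhds ha
    filter_upwards [e1, (h.hasDerivAt₀ a ha).continuousAt.eventually
      (Metric.ball_mem_nhds _ hε0)] with θ h1 h2
    rw [dist_eq_norm] at h2
    exact ⟨h1, h2.le⟩
  have eb : ∀ᶠ θ in 𝓝 b, θ ∈ J ∧ ‖g₀ θ - g₀ b‖ ≤ ε ∧ ‖g₁ θ - g₁ b‖ ≤ ε := by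
    have e1 : ∀ᶠ θ in 𝓝 b, θ ∈ J := h.isOpen.mem_nhds hb
    filter_upwards [e1, (h.hasDerivAt₀ b hb).continuousAt.eventually
      (Metric.ball_mem_nhds _ hε0), (h.hasDerivAt₁ b hb).continuousAt.eventually
      (Metric.ball_mem_nhds _ hε0)] with θ h1 h2 h3
    rw [dist_eq_norm] at h2 h3
    exact ⟨h1, h2.le, h3.le⟩
  obtain ⟨r₁, hr₁, hr₁'⟩ := Metric.eventually_nhds_iff_ball.1 ea
  obtain ⟨r₂, hr₂, hr₂'⟩ := Metric.eventually_nhds_iff_ball.1 eb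
  refine ⟨2 * K, by positivity, min r₁ r₂, lt_min hr₁ hr₂,
    fun θ hθ => (hr₁' θ (Metric.ball_subset_ball (min_le_left _ _) hθ)).1,
    fun θ hθ => (hr₂' θ (Metric.ball_subset_ball (min_le_right _ _) hθ)).1, ?_⟩
  intro θ₁ h₁ θ₂ h₂ θ₂' h₂' α β ρ
  replace h₁ := (hr₁' θ₁ (Metric.ball_subset_ball (min_le_left _ _) h₁)).2
  replace h₂ := Metric.ball_subset_ball (min_le_right r₁ r₂) h₂
  replace h₂' := Metric.ball_subset_ball (min_le_right r₁ r₂) h₂'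
  -- After removing the linear motion along `g₁ b` the curve is `ε`-Lipschitz, so the chord is
  -- nearly a multiple of `g₁ b`, and its error is proportional to that multiple `κ`.
  have hchord : ‖(g₀ θ₂' - θ₂' • g₁ b) - (g₀ θ₂ - θ₂ • g₁ b)‖ ≤ ε * ‖θ₂' - θ₂‖ := by
    refine (convex_ball b r₂).norm_image_sub_le_of_norm_hasDerivWithin_le
      (f := fun t => g₀ t - t • g₁ b) (f' := fun t => g₁ t - g₁ b)
      (fun t ht => ?_) (fun t ht => (hr₂' t ht).2.2) h₂ h₂'
    have := (h.hasDerivAt₀ t (hr₂' t ht).1).sub ((hasDerivAt_id t).smul_const (g₁ b))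
    exact (this.congr_deriv (by simp)).hasDerivWithinAt
  set κ := ρ * (θ₂' - θ₂) with hκ
  set V := α • g₀ θ₁ + β • g₀ θ₂ + ρ • (g₀ θ₂' - g₀ θ₂) with hV
  have hdiff : α • g₀ a + (β • g₀ b + κ • g₁ b) = V - (α • (g₀ θ₁ - g₀ a) + β • (g₀ θ₂ - g₀ b) +
      ρ • ((g₀ θ₂' - θ₂' • g₁ b) - (g₀ θ₂ - θ₂ • g₁ b))) := by
    rw [hV, hκ]; module
  set X := max |α| (max |β| |κ|) with hX
  have hα : |α| ≤ X := le_max_left _ _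
  have hβ : |β| ≤ X := (le_max_left _ _).trans (le_max_right _ _)
  have hκX : |κ| ≤ X := (le_max_right _ _).trans (le_max_right _ _)
  have t1 : ‖α • (g₀ θ₁ - g₀ a)‖ ≤ X * ε := by
    rw [norm_smul, Real.norm_eq_abs]
    exact mul_le_mul hα h₁ (norm_nonneg _) ((abs_nonneg _).trans hα)
  have t2 : ‖β • (g₀ θ₂ - g₀ b)‖ ≤ X * ε := by
    rw [norm_smul, Real.norm_eq_abs]
    exact mul_le_mul hβ (hr₂' θ₂ h₂).2.1 (norm_nonneg _) ((abs_nonneg _).trans hα)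
  have t3 : ‖ρ • ((g₀ θ₂' - θ₂' • g₁ b) - (g₀ θ₂ - θ₂ • g₁ b))‖ ≤ X * ε := by
    rw [norm_smul, Real.norm_eq_abs]
    calc |ρ| * ‖(g₀ θ₂' - θ₂' • g₁ b) - (g₀ θ₂ - θ₂ • g₁ b)‖
        ≤ |ρ| * (ε * ‖θ₂' - θ₂‖) := mul_le_mul_of_nonneg_left hchord (abs_nonneg _)
      _ = |κ| * ε := by rw [hκ, abs_mul, Real.norm_eq_abs]; ring
      _ ≤ X * ε := mul_le_mul_of_nonneg_right hκX hε0.le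
  have h5 := hlow α β κ
  rw [hdiff] at h5
  have h6 : ‖V - (α • (g₀ θ₁ - g₀ a) + β • (g₀ θ₂ - g₀ b) +
      ρ • ((g₀ θ₂' - θ₂' • g₁ b) - (g₀ θ₂ - θ₂ • g₁ b)))‖ ≤ ‖V‖ + 3 * (X * ε) := by
    refine (_root_.norm_sub_le _ _).trans (add_le_add_right ?_ _)
    refine (norm_add_le _ _).trans ?_
    have := norm_add_le (α • (g₀ θ₁ - g₀ a)) (β • (g₀ θ₂ - g₀ b))
    linarith
  have h7 : X ≤ K * ‖V‖ + X / 2 := by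
    refine h5.trans ((mul_le_mul_of_nonneg_left h6 hK'.le).trans (le_of_eq ?_))
    rw [hε]
    field_simp
    ring
  linarith

end IsShortArc

/-! ### Measures of sets covered by small pieces -/

theorem measure_le_card_mul {ι : Type*} [Fintype ι] {μ : Measure E3} {S : Set E3} {T : ι → Set E3}
    {k : ℝ≥0∞} (hS : ∀ y ∈ S, ∃ i, y ∈ T i) (hT : ∀ i, μ (T i) ≤ k) :
    μ S ≤ Fintype.card ι * k := by
  calc μ S ≤ μ (⋃ i, T i) := measure_mono fun y hy => Set.mem_iUnion.2 (hS y hy)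
    _ ≤ ∑ i, μ (T i) := measure_iUnion_fintype_le _ _
    _ ≤ ∑ _i : ι, k := Finset.sum_le_sum fun i _ => hT i
    _ = Fintype.card ι * k := by simp

theorem measure_le_of_forall_norm_sub_le {μ : Measure E3} {C s : ℝ}
    (hfro : ∀ y r, 0 < r → μ (Metric.closedBall y r) ≤ ENNReal.ofReal (C * r ^ s)) {T : Set E3}
    {r : ℝ} (hr : 0 < r) (hT : ∀ y ∈ T, ∀ y' ∈ T, ‖y - y'‖ ≤ r) :
    μ T ≤ ENNReal.ofReal (C * r ^ s) := by
  rcases Set.eq_empty_or_nonempty T with h | ⟨y', hy'⟩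
  · rw [h]; simp
  · refine (measure_mono fun y hy => ?_).trans (hfro y' r hr)
    rw [mem_closedBall_iff_norm]
    exact hT y hy y' hy'

theorem ofReal_half_mul_le_of_le_add {x : ℝ} {u v : ℝ≥0∞} (hx : 0 ≤ x)
    (h : ENNReal.ofReal x ≤ u + v) (hu : u ≤ ENNReal.ofReal (1 / 2 * x)) :
    ENNReal.ofReal (1 / 2 * x) ≤ v := by
  have h1 : ENNReal.ofReal x = ENNReal.ofReal (1 / 2 * x) + ENNReal.ofReal (1 / 2 * x) := by
    rw [← ENNReal.ofReal_add (by positivity) (by positivity)]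
    congr 1
    ring
  rw [h1] at h
  exact (ENNReal.add_le_add_iff_left ENNReal.ofReal_ne_top).1 (h.trans (add_le_add_left hu v))

namespace IsShortArc

variable {J : Set ℝ} {g₀ g₁ g₂ : ℝ → E3} {m M : ℝ}

/-- The points near which a line with direction in `g₀ '' ball a e` through `x₁` meets a line with
direction in `g₀ '' ball b e` through `x₂` lie near a curve. -/
theorem exists_measure_joint_lines_le (h : IsShortArc J g₀ g₁ g₂ m M) {a b : ℝ} (ha : a ∈ J)
    (hb : b ∈ J) (hab : a ≠ b) {μ : Measure E3} {C s Rad : ℝ} (hC : 0 < C) (hRad : 0 < Rad)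
    (hfro : ∀ y r, 0 < r → μ (Metric.closedBall y r) ≤ ENNReal.ofReal (C * r ^ s)) :
    ∃ e > 0, Metric.ball a e ⊆ J ∧ Metric.ball b e ⊆ J ∧ ∃ D > 0, ∀ d, 0 < d → d ≤ 1 →
      ∀ x₁ x₂ : E3, ‖x₁‖ ≤ Rad → ‖x₂‖ ≤ Rad →
        μ {y | ‖y‖ ≤ Rad ∧ (∃ θ ∈ Metric.ball a e, lineDist (g₀ θ) (x₁ - y) ≤ 2 * d) ∧
          ∃ θ ∈ Metric.ball b e, lineDist (g₀ θ) (x₂ - y) ≤ 2 * d} ≤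
            ENNReal.ofReal (D * d ^ (s - 1)) := by
  obtain ⟨K, hK, e', he', haJ, hbJ, hcoef⟩ := h.exists_abs_coeff_le ha hb hab
  set e := min e' 1 with he
  have he0 : 0 < e := lt_min he' one_pos
  have hsub : ∀ c : ℝ, Metric.ball c e ⊆ Metric.ball c e' := fun c =>
    Metric.ball_subset_ball (min_le_left _ _)
  have hM : 0 < M := zero_lt_one.trans_le h.one_le
  set L : ℝ := K * (8 + 2 * Rad * M) + 2 * Rad * M + 4 with hL
  have hL0 : 0 < L := by positivity
  refine ⟨e, he0, (hsub a).trans haJ, (hsub b).trans hbJ, 3 * (C * L ^ s), by positivity, ?_⟩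
  intro d hd hd1 x₁ x₂ hx₁ hx₂
  -- The ball around `a` has length at most `2`. Slice it into intervals of length `d`: points `y`
  -- using the same slice lie within `L d` of each other.
  set n := ⌊2 / d⌋₊ + 1 with hn
  have hnd : (n : ℝ) ≤ 3 / d := by
    have h1 : (⌊2 / d⌋₊ : ℝ) ≤ 2 / d := Nat.floor_le (by positivity)
    have h2 : 1 ≤ 1 / d := by rwa [one_le_div₀ hd]
    have h3 : 3 / d = 2 / d + 1 / d := by ring
    rw [hn, h3]
    push_cast
    linarith
  let T : Fin n → Set E3 := fun k => {y | ‖y‖ ≤ Rad ∧ (∃ θ ∈ Metric.ball a e,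
    lineDist (g₀ θ) (x₁ - y) ≤ 2 * d ∧ ⌊(θ - (a - 1)) / d⌋₊ = k) ∧
      ∃ θ ∈ Metric.ball b e, lineDist (g₀ θ) (x₂ - y) ≤ 2 * d}
  have hT : ∀ k, μ (T k) ≤ ENNReal.ofReal (C * (L * d) ^ s) := by
    intro k
    refine measure_le_of_forall_norm_sub_le hfro (by positivity) ?_
    rintro y ⟨hy, ⟨θ₁, hθ₁, hyθ₁, hk⟩, θ₂, hθ₂, hyθ₂⟩ y' ⟨hy', ⟨θ₁', hθ₁', hyθ₁', hk'⟩, θ₂', hθ₂', hyθ₂'⟩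
    have hθd : |θ₁ - θ₁'| ≤ d := by
      have key : ∀ θ ∈ Metric.ball a e, ⌊(θ - (a - 1)) / d⌋₊ = k →
          (k : ℝ) * d ≤ θ - (a - 1) ∧ θ - (a - 1) ≤ (k + 1 : ℝ) * d := by
        intro θ hθ hθk
        rw [Metric.mem_ball, Real.dist_eq] at hθ
        have h1 := (abs_lt.1 (hθ.trans_le (min_le_right e' 1))).1
        have h2 : 0 ≤ (θ - (a - 1)) / d := div_nonneg (by linarith) hd.le
        rw [← hθk, ← le_div_iff₀ hd, ← div_le_iff₀ hd]
        exact ⟨Nat.floor_le h2, (Nat.lt_floor_add_one _).le⟩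
      have h1 := key θ₁ hθ₁ hk
      have h2 := key θ₁' hθ₁' hk'
      rw [abs_le]
      constructor <;> linarith
    have hnorm : ∀ {θ : ℝ} {z : E3}, θ ∈ J → ‖z‖ ≤ 2 * Rad → |inner ℝ (g₀ θ) z| ≤ 2 * Rad := by
      intro θ z hθ hz
      refine (abs_real_inner_le_norm _ _).trans ?_
      rwa [h.norm_eq_one θ hθ, one_mul]
    have j₁ := haJ (hsub a hθ₁)
    have j₁' := haJ (hsub a hθ₁')
    have hρ : |inner ℝ (g₀ θ₁') (x₁ - y')| ≤ 2 * Rad :=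
      hnorm j₁' ((_root_.norm_sub_le _ _).trans (by linarith))
    set ρ₁ := inner ℝ (g₀ θ₁) (x₁ - y) with hρ₁
    set ρ₁' := inner ℝ (g₀ θ₁') (x₁ - y') with hρ₁'
    set ρ₂ := inner ℝ (g₀ θ₂) (x₂ - y) with hρ₂
    set ρ₂' := inner ℝ (g₀ θ₂') (x₂ - y') with hρ₂'
    have n1 : ‖x₁ - y - ρ₁ • g₀ θ₁‖ ≤ 2 * d := hyθ₁
    have n1' : ‖x₁ - y' - ρ₁' • g₀ θ₁'‖ ≤ 2 * d := hyθ₁'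
    have n2 : ‖x₂ - y - ρ₂ • g₀ θ₂‖ ≤ 2 * d := hyθ₂
    have n2' : ‖x₂ - y' - ρ₂' • g₀ θ₂'‖ ≤ 2 * d := hyθ₂'
    have hchord : ‖ρ₁' • (g₀ θ₁' - g₀ θ₁)‖ ≤ 2 * Rad * M * d := by
      rw [norm_smul, Real.norm_eq_abs, norm_sub_rev, mul_assoc]
      refine mul_le_mul hρ ((h.norm_sub_le j₁ j₁').trans ?_) (norm_nonneg _) (by positivity)
      exact mul_le_mul_of_nonneg_left hθd hM.le
    have hα := hcoef θ₁ (hsub a hθ₁) θ₂ (hsub b hθ₂) θ₂' (hsub b hθ₂') (ρ₁ - ρ₁') (-(ρ₂ - ρ₂')) ρ₂'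
    -- Subtracting the approximate equations `xᵢ - y = ρᵢ g₀ θᵢ` for `y` and `y'` eliminates `x₁`,
    -- `x₂`, `y` and `y'`, leaving a combination of size `O(d)` to which the coefficient bound
    -- applies.
    have hcomb : (ρ₁ - ρ₁') • g₀ θ₁ + (-(ρ₂ - ρ₂')) • g₀ θ₂ + ρ₂' • (g₀ θ₂' - g₀ θ₂) =
        ((x₁ - y' - ρ₁' • g₀ θ₁') - (x₁ - y - ρ₁ • g₀ θ₁)) -
          ((x₂ - y' - ρ₂' • g₀ θ₂') - (x₂ - y - ρ₂ • g₀ θ₂)) + ρ₁' • (g₀ θ₁' - g₀ θ₁) := by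
      module
    have hcomb' : ‖(ρ₁ - ρ₁') • g₀ θ₁ + (-(ρ₂ - ρ₂')) • g₀ θ₂ + ρ₂' • (g₀ θ₂' - g₀ θ₂)‖ ≤
        (8 + 2 * Rad * M) * d := by
      rw [hcomb]
      refine (norm_add_le _ _).trans ?_
      have t1 := _root_.norm_sub_le ((x₁ - y' - ρ₁' • g₀ θ₁') - (x₁ - y - ρ₁ • g₀ θ₁))
        ((x₂ - y' - ρ₂' • g₀ θ₂') - (x₂ - y - ρ₂ • g₀ θ₂))
      have t2 := _root_.norm_sub_le (x₁ - y' - ρ₁' • g₀ θ₁') (x₁ - y - ρ₁ • g₀ θ₁)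
      have t3 := _root_.norm_sub_le (x₂ - y' - ρ₂' • g₀ θ₂') (x₂ - y - ρ₂ • g₀ θ₂)
      linarith
    have hα' : |ρ₁ - ρ₁'| ≤ K * ((8 + 2 * Rad * M) * d) :=
      hα.trans (mul_le_mul_of_nonneg_left hcomb' hK.le)
    have hyy : y - y' = ((x₁ - y' - ρ₁' • g₀ θ₁') - (x₁ - y - ρ₁ • g₀ θ₁)) -
        (ρ₁ - ρ₁') • g₀ θ₁ + ρ₁' • (g₀ θ₁' - g₀ θ₁) := by
      module
    rw [hyy]
    refine (norm_add_le _ _).trans ?_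
    have t1 := _root_.norm_sub_le ((x₁ - y' - ρ₁' • g₀ θ₁') - (x₁ - y - ρ₁ • g₀ θ₁))
      ((ρ₁ - ρ₁') • g₀ θ₁)
    have t2 := _root_.norm_sub_le (x₁ - y' - ρ₁' • g₀ θ₁') (x₁ - y - ρ₁ • g₀ θ₁)
    have t3 : ‖(ρ₁ - ρ₁') • g₀ θ₁‖ = |ρ₁ - ρ₁'| := by
      rw [norm_smul, h.norm_eq_one θ₁ j₁, mul_one, Real.norm_eq_abs]
    have t4 : L * d = K * ((8 + 2 * Rad * M) * d) + 2 * Rad * M * d + 4 * d := by rw [hL]; ring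
    linarith
  refine (measure_le_card_mul (T := T) ?_ hT).trans ?_
  · rintro y ⟨hy, ⟨θ₁, hθ₁, hyθ₁⟩, h₂⟩
    have hlt : ⌊(θ₁ - (a - 1)) / d⌋₊ < n := by
      rw [hn, Nat.lt_succ_iff]
      refine Nat.floor_le_floor (div_le_div_of_nonneg_right ?_ hd.le)
      rw [Metric.mem_ball, Real.dist_eq] at hθ₁
      have h1 := (abs_lt.1 (hθ₁.trans_le (min_le_right e' 1))).2
      linarith
    exact ⟨⟨_, hlt⟩, hy, ⟨θ₁, hθ₁, hyθ₁, rfl⟩, h₂⟩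
  · rw [Fintype.card_fin, ← ENNReal.ofReal_natCast, ← ENNReal.ofReal_mul (Nat.cast_nonneg _)]
    refine ENNReal.ofReal_le_ofReal ?_
    refine (mul_le_mul_of_nonneg_right hnd (by positivity)).trans (le_of_eq ?_)
    rw [Real.mul_rpow hL0.le hd.le, Real.rpow_sub_one hd.ne']
    ring

/-! ### Tubes at a point and exceptional planes. -/

theorem measurable_lineDist (h : IsShortArc J g₀ g₁ g₂ m M) :
    Measurable fun w : ℝ × E3 × E3 => lineDist (g₀ w.1) (w.2.2 - w.2.1) := by
  unfold lineDist
  have h1 : Measurable fun w : ℝ × E3 × E3 => g₀ w.1 := h.measurable₀.comp measurable_fst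
  have h2 : Measurable fun w : ℝ × E3 × E3 => w.2.2 - w.2.1 :=
    measurable_snd.snd.sub measurable_snd.fst
  have h3 : Measurable fun w : ℝ × E3 × E3 => inner ℝ (g₀ w.1) (w.2.2 - w.2.1) • g₀ w.1 :=
    (h1.inner (𝕜 := ℝ) h2).smul h1
  exact (h2.sub h3).norm

/-- For `‖x - y‖ < r`, the singularity `‖x - y‖⁻¹` is traded for the integrable `‖x - y‖⁻ᵖ` at the
gain `r ^ (p - 1)`. On the diagonal the right side is infinite. -/
theorem volume_lineDist_near_le (h : IsShortArc J g₀ g₁ g₂ m M) {p r d : ℝ} (hp : 1 < p)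
    (hr : 0 < r) (hd : 0 < d) (x y : E3) :
    volume {θ ∈ J | lineDist (g₀ θ) (x - y) ≤ d ∧ ‖x - y‖ < r} ≤
      ENNReal.ofReal ((8 / m + 2) * d * r ^ (p - 1)) * edist x y ^ (-p) := by
  have hm := h.m_pos
  have hrp := Real.rpow_pos_of_pos hr (p - 1)
  rcases eq_or_ne x y with rfl | hxy
  · rw [const_mul_edist_self_rpow _ (by linarith)]
    · exact le_top
    · have : 0 < (8 / m + 2) * d * r ^ (p - 1) := by positivity
      simpa using this
  have h0 : 0 < ‖x - y‖ := norm_pos_iff.2 (sub_ne_zero.2 hxy)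
  rcases le_or_gt r ‖x - y‖ with hle | hlt
  · have : {θ ∈ J | lineDist (g₀ θ) (x - y) ≤ d ∧ ‖x - y‖ < r} = ∅ := by
      ext θ
      simp only [Set.mem_ofPred_eq, Set.mem_empty_iff_false, iff_false]
      exact fun hθ => absurd hθ.2.2 (not_lt.2 hle)
    rw [this]; simp
  refine (measure_mono (t := {θ ∈ J | lineDist (g₀ θ) (x - y) ≤ d}) fun θ hθ =>
    ⟨hθ.1, hθ.2.1⟩).trans ((h.volume_lineDist_le (sub_ne_zero.2 hxy) hd).trans ?_)
  rw [edist_dist, dist_eq_norm, ENNReal.ofReal_rpow_of_pos h0, ← ENNReal.ofReal_mul (by positivity)]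
  refine ENNReal.ofReal_le_ofReal ?_
  have h1 : ‖x - y‖ ^ (p - 1) ≤ r ^ (p - 1) := Real.rpow_le_rpow h0.le hlt.le (by linarith)
  have h2 : 1 / ‖x - y‖ = ‖x - y‖ ^ (p - 1) * ‖x - y‖ ^ (-p) := by
    rw [← Real.rpow_add h0, show p - 1 + -p = -1 by ring, Real.rpow_neg_one, one_div]
  have h3 : 1 / ‖x - y‖ ≤ r ^ (p - 1) * ‖x - y‖ ^ (-p) := by
    rw [h2]
    exact mul_le_mul_of_nonneg_right h1 (Real.rpow_nonneg h0.le _)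
  calc (8 / m + 2) * (d / ‖x - y‖) = (8 / m + 2) * d * (1 / ‖x - y‖) := by ring
    _ ≤ (8 / m + 2) * d * (r ^ (p - 1) * ‖x - y‖ ^ (-p)) :=
        mul_le_mul_of_nonneg_left h3 (by positivity)
    _ = _ := by ring

/-- Two tubes through `y`, with directions at a definite angle and with far away base points. -/
theorem volume_mul_volume_lineDist_le (h : IsShortArc J g₀ g₁ g₂ m M) {r d : ℝ} (hr : 0 < r)
    (hd : 0 < d) {x₁ x₂ y : E3} (h₁ : r ≤ ‖x₁ - y‖) (h₂ : r ≤ ‖x₂ - y‖) :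
    volume {θ ∈ J | lineDist (g₀ θ) (x₁ - y) ≤ d} * volume {θ ∈ J | lineDist (g₀ θ) (x₂ - y) ≤ d} ≤
      ENNReal.ofReal (2 * ((8 / m + 2) * d) ^ 2 / r) * edist x₁ x₂ ^ (-1 : ℝ) := by
  have hm := h.m_pos
  rcases eq_or_ne x₁ x₂ with rfl | hxy
  · rw [const_mul_edist_self_rpow _ one_pos]
    · exact le_top
    · have : 0 < 2 * ((8 / m + 2) * d) ^ 2 / r := by positivity
      simpa using this
  have h0 : 0 < ‖x₁ - x₂‖ := norm_pos_iff.2 (sub_ne_zero.2 hxy)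
  have n₁ : 0 < ‖x₁ - y‖ := hr.trans_le h₁
  have n₂ : 0 < ‖x₂ - y‖ := hr.trans_le h₂
  refine (mul_le_mul' (h.volume_lineDist_le (norm_pos_iff.1 n₁) hd)
    (h.volume_lineDist_le (norm_pos_iff.1 n₂) hd)).trans ?_
  rw [edist_dist, dist_eq_norm, ENNReal.ofReal_rpow_of_pos h0, ← ENNReal.ofReal_mul (by positivity),
    ← ENNReal.ofReal_mul (by positivity), Real.rpow_neg_one]
  refine ENNReal.ofReal_le_ofReal ?_
  have h3 : r * ‖x₁ - x₂‖ ≤ 2 * (‖x₁ - y‖ * ‖x₂ - y‖) := by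
    have h4 : ‖x₁ - x₂‖ ≤ ‖x₁ - y‖ + ‖x₂ - y‖ := by
      have : x₁ - x₂ = (x₁ - y) - (x₂ - y) := by abel
      rw [this]
      exact _root_.norm_sub_le _ _
    nlinarith
  have h5 : 1 / (‖x₁ - y‖ * ‖x₂ - y‖) ≤ 2 / (r * ‖x₁ - x₂‖) := by
    rw [div_le_div_iff₀ (by positivity) (by positivity)]
    linarith
  calc (8 / m + 2) * (d / ‖x₁ - y‖) * ((8 / m + 2) * (d / ‖x₂ - y‖))
      = ((8 / m + 2) * d) ^ 2 * (1 / (‖x₁ - y‖ * ‖x₂ - y‖)) := by field_simp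
    _ ≤ ((8 / m + 2) * d) ^ 2 * (2 / (r * ‖x₁ - x₂‖)) :=
        mul_le_mul_of_nonneg_left h5 (by positivity)
    _ = _ := by field_simp

/-- Near pairs carry mass `δ^(1 + τ(p - 1))`, negligible against `δ^(1 + t)` by `hτp`. For the
others, two parameter lengths and a curve of mass `δ^(s - 1)` give `δ^(2 + (s - 1) - τ)`, smaller
than `δ^(2(1 + t))` by `hτs`. -/
theorem volume_hasCoverExponent_planeProj_eq_zero_of_params (h : IsShortArc J g₀ g₁ g₂ m M)
    {B : Set E3} {μ : Measure E3} [IsFiniteMeasure μ] (hμ : μ ≠ 0) (hB : μ Bᶜ = 0) {Rad : ℝ}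
    (hRad : 0 < Rad) (hsupp : ∀ᵐ y ∂μ, ‖y‖ ≤ Rad) {C s : ℝ} (hC : 0 < C)
    (hfro : ∀ y r, 0 < r → μ (Metric.closedBall y r) ≤ ENNReal.ofReal (C * r ^ s))
    {σ t τ p : ℝ} (hσ : σ < 1 + t) (hp1 : 1 < p) (hps : p < s) (hτp : t < τ * (p - 1))
    (hτs : τ < s - 1 - 2 * t) :
    volume {θ ∈ J | HasCoverExponent (planeProj g₀ θ) B σ} = 0 := by
  have hm := h.m_pos
  set Q : ℝ := 8 / m + 2 with hQ
  have hQ0 : 0 < Q := by positivity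
  obtain ⟨W, hW, hpot⟩ := exists_lintegral_edist_rpow_le hfro (p := p) (by linarith) hps
  obtain ⟨W₁, hW₁, hpot₁⟩ := exists_lintegral_edist_rpow_le hfro (p := 1) one_pos (by linarith)
  set T : ℕ → Set (ℝ × E3 × E3) := fun j => {w | lineDist (g₀ w.1) (w.2.2 - w.2.1) ≤ 2 * dyadic j ∧
    ‖w.2.2 - w.2.1‖ < dyadic j ^ τ} with hT
  set R : ℕ → Set (ℝ × E3 × E3) := fun j => {w | (lineDist (g₀ w.1) (w.2.2 - w.2.1) ≤ 2 * dyadic j ∧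
    dyadic j ^ τ ≤ ‖w.2.2 - w.2.1‖) ∧ ‖w.2.1‖ ≤ Rad ∧ ‖w.2.2‖ ≤ Rad} with hR
  have mdist : Measurable fun w : ℝ × E3 × E3 => ‖w.2.2 - w.2.1‖ :=
    (measurable_snd.snd.sub measurable_snd.fst).norm
  have hTm : ∀ j, MeasurableSet (T j) := by
    intro j
    have h1 := measurableSet_le h.measurable_lineDist (measurable_const (a := 2 * dyadic j))
    have h2 := measurableSet_lt mdist (measurable_const (a := dyadic j ^ τ))
    exact h1.inter h2
  have hRm : ∀ j, MeasurableSet (R j) := by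
    intro j
    have h1 := measurableSet_le h.measurable_lineDist (measurable_const (a := 2 * dyadic j))
    have h2 := measurableSet_le (measurable_const (a := dyadic j ^ τ)) mdist
    have h3 : MeasurableSet {w : ℝ × E3 × E3 | ‖w.2.1‖ ≤ Rad} :=
      measurableSet_le measurable_snd.fst.norm measurable_const
    have h4 : MeasurableSet {w : ℝ × E3 × E3 | ‖w.2.2‖ ≤ Rad} :=
      measurableSet_le measurable_snd.snd.norm measurable_const
    exact (h1.inter h2).inter (h3.inter h4)
  have hTsmall : ∀ᵐ θ ∂(volume.restrict J), ∀ᵐ y ∂μ, ∀ᶠ j in atTop,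
      μ {x | (θ, y, x) ∈ T j} ≤ ENNReal.ofReal (1 / 2 * dyadic j ^ (1 + t)) := by
    refine ae_ae_eventually_measure_fibre_le hTm (a := τ * (p - 1) - t) (C := Q * 2 * W.toReal)
      (by linarith) (by norm_num) (Eventually.of_forall fun j y => ?_)
    have hd := dyadic_pos j
    have hpt : ∀ x, (volume.restrict J) {θ | (θ, y, x) ∈ T j} ≤
        ENNReal.ofReal (Q * (2 * dyadic j) * (dyadic j ^ τ) ^ (p - 1)) * edist x y ^ (-p) := by
      intro x
      rw [Measure.restrict_apply' h.isOpen.measurableSet, Set.inter_comm]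
      exact h.volume_lineDist_near_le hp1 (Real.rpow_pos_of_pos hd τ) (by positivity) x y
    refine (lintegral_mono hpt).trans ?_
    rw [lintegral_const_mul' _ _ ENNReal.ofReal_ne_top]
    refine (mul_le_mul' le_rfl (hpot y)).trans (le_of_eq ?_)
    rw [← ENNReal.ofReal_toReal hW, ← ENNReal.ofReal_mul (by positivity),
      ENNReal.toReal_ofReal ENNReal.toReal_nonneg]
    congr 1
    rw [← Real.rpow_mul hd.le, show 1 + t + (τ * (p - 1) - t) = 1 + τ * (p - 1) by ring,
      Real.rpow_add hd, Real.rpow_one]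
    ring
  set E := {θ ∈ J | HasCoverExponent (planeProj g₀ θ) B σ} with hEdef
  -- The exceptional parameters for which at least half of each tube's lower mass bound survives the
  -- removal of near pairs; almost every exceptional parameter is of this kind.
  set E' := {θ ∈ E | ∀ᵐ y ∂μ, ∀ᶠ j in atTop,
    ENNReal.ofReal (1 / 2 * dyadic j ^ (1 + t)) ≤ μ {x | (θ, y, x) ∈ R j}} with hE'
  have hEE' : volume E = 0 ∨ volume E' ≠ 0 := by
    rw [or_iff_not_imp_right, not_not]
    intro h0
    rw [ae_restrict_iff' h.isOpen.measurableSet] at hTsmall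
    have h1 : ∀ᵐ θ : ℝ, θ ∉ E' := measure_eq_zero_iff_ae_notMem.1 h0
    refine measure_eq_zero_iff_ae_notMem.2 ?_
    filter_upwards [h1, hTsmall] with θ hθ1 hθ2 hθE
    refine hθ1 ⟨hθE, ?_⟩
    filter_upwards [hθ2 hθE.1, hθE.2.ae_eventually_le hσ hB, hsupp] with y hy1 hy2 hy3
    filter_upwards [hy1, hy2] with j hj1 hj2
    refine ofReal_half_mul_le_of_le_add (Real.rpow_nonneg (dyadic_pos j).le _) (hj2.trans ?_) hj1
    refine (measure_mono_ae ?_).trans (measure_union_le _ _)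
    filter_upwards [hsupp] with x hx hxm
    have hxm' : dist (planeProj g₀ θ x) (planeProj g₀ θ y) ≤ 2 * dyadic j := hxm
    rw [dist_planeProj (h.norm_eq_one θ hθE.1)] at hxm'
    rcases lt_or_ge ‖x - y‖ (dyadic j ^ τ) with hlt | hge
    · exact Or.inl ⟨hxm', hlt⟩
    · exact Or.inr ⟨⟨hxm', hge⟩, hy3, hx⟩
  rcases hEE' with h0 | h0
  · exact h0
  exfalso
  obtain ⟨a, haE, -, ha⟩ := exists_notMem_forall_nhds_pos h0 Set.finite_empty
  obtain ⟨b, hbE, hba, hb⟩ := exists_notMem_forall_nhds_pos h0 (Set.finite_singleton a)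
  obtain ⟨e, he, haJ, hbJ, D, hD, hjoint⟩ := h.exists_measure_joint_lines_le haE.1.1 hbE.1.1
    (fun hab => hba hab.symm) hC hRad hfro
  have hfib : ∀ {c : ℝ} (j : ℕ) (y x : E3), (volume.restrict (Metric.ball c e))
      {θ | (θ, y, x) ∈ R j} = volume (Metric.ball c e ∩ {θ | (θ, y, x) ∈ R j}) := fun j y x => by
    rw [Measure.restrict_apply' measurableSet_ball, Set.inter_comm]
  have hinc : ∀ j (X : E3 × E3), ∫⁻ y, (volume.restrict (Metric.ball a e)) {θ | (θ, y, X.1) ∈ R j} *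
      (volume.restrict (Metric.ball b e)) {θ | (θ, y, X.2) ∈ R j} ∂μ ≤
      ENNReal.ofReal (2 * (Q * (2 * dyadic j)) ^ 2 / dyadic j ^ τ * (D * dyadic j ^ (s - 1))) *
        edist X.1 X.2 ^ (-1 : ℝ) := by
    rintro j ⟨x₁, x₂⟩
    have hd := dyadic_pos j
    have hdτ := Real.rpow_pos_of_pos hd τ
    by_cases hx : ‖x₁‖ ≤ Rad ∧ ‖x₂‖ ≤ Rad
    swap
    · have hz : ∀ y, (volume.restrict (Metric.ball a e)) {θ | (θ, y, x₁) ∈ R j} *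
          (volume.restrict (Metric.ball b e)) {θ | (θ, y, x₂) ∈ R j} = 0 := by
        intro y
        rw [mul_eq_zero]
        by_contra! hne
        obtain ⟨θ, hθ⟩ := nonempty_of_measure_ne_zero hne.1
        obtain ⟨θ', hθ'⟩ := nonempty_of_measure_ne_zero hne.2
        exact hx ⟨hθ.2.2, hθ'.2.2⟩
      simp only [hz, lintegral_zero]
      exact zero_le
    set S := {y | ‖y‖ ≤ Rad ∧ (∃ θ ∈ Metric.ball a e, lineDist (g₀ θ) (x₁ - y) ≤ 2 * dyadic j) ∧
      ∃ θ ∈ Metric.ball b e, lineDist (g₀ θ) (x₂ - y) ≤ 2 * dyadic j} with hS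
    have hpt : ∀ y, (volume.restrict (Metric.ball a e)) {θ | (θ, y, x₁) ∈ R j} *
        (volume.restrict (Metric.ball b e)) {θ | (θ, y, x₂) ∈ R j} ≤
        S.indicator (fun _ => ENNReal.ofReal (2 * (Q * (2 * dyadic j)) ^ 2 / dyadic j ^ τ) *
          edist x₁ x₂ ^ (-1 : ℝ)) y := by
      intro y
      rw [hfib, hfib]
      by_cases hne : volume (Metric.ball a e ∩ {θ | (θ, y, x₁) ∈ R j}) = 0 ∨
          volume (Metric.ball b e ∩ {θ | (θ, y, x₂) ∈ R j}) = 0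
      · rw [mul_eq_zero.2 hne]
        exact zero_le
      push Not at hne
      obtain ⟨θ, hθ⟩ := nonempty_of_measure_ne_zero hne.1
      obtain ⟨θ', hθ'⟩ := nonempty_of_measure_ne_zero hne.2
      have hyS : y ∈ S := ⟨hθ.2.2.1, ⟨θ, hθ.1, hθ.2.1.1⟩, θ', hθ'.1, hθ'.2.1.1⟩
      rw [Set.indicator_of_mem hyS]
      refine le_trans (mul_le_mul' (measure_mono ?_) (measure_mono ?_))
        (h.volume_mul_volume_lineDist_le hdτ (d := 2 * dyadic j) (by positivity) hθ.2.1.2 hθ'.2.1.2)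
      · exact fun φ hφ => ⟨haJ hφ.1, hφ.2.1.1⟩
      · exact fun φ hφ => ⟨hbJ hφ.1, hφ.2.1.1⟩
    refine (lintegral_mono hpt).trans ((lintegral_indicator_const_le _ _).trans ?_)
    refine (mul_le_mul' le_rfl (hjoint _ hd (dyadic_le_one j) x₁ x₂ hx.1 hx.2)).trans (le_of_eq ?_)
    rw [ENNReal.ofReal_mul (q := D * dyadic j ^ (s - 1)) (by positivity)]
    ring
  have key := null_or_null_of_incidences hμ (lam₁ := volume.restrict (Metric.ball a e))
    (lam₂ := volume.restrict (Metric.ball b e)) hRm (σ := 1 + t) (c := 1 / 2)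
    (a := s - 1 - τ - 2 * t) (C := 8 * Q ^ 2 * D * (W₁ * μ Set.univ).toReal) (by linarith)
    (by norm_num) (Eventually.of_forall fun j => ?_) (A₁ := E') (A₂ := E') (fun θ hθ => hθ.2)
    (fun θ hθ => hθ.2)
  · rw [Measure.restrict_apply' measurableSet_ball, Measure.restrict_apply' measurableSet_ball] at key
    rcases key with h1 | h1
    · exact ha _ (Metric.ball_mem_nhds _ he) h1
    · exact hb _ (Metric.ball_mem_nhds _ he) h1
  · have hd := dyadic_pos j
    refine (lintegral_mono (hinc j)).trans ?_
    rw [lintegral_const_mul' _ _ ENNReal.ofReal_ne_top]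
    have hint : ∫⁻ X : E3 × E3, edist X.1 X.2 ^ (-1 : ℝ) ∂(μ.prod μ) ≤ W₁ * μ Set.univ := by
      rw [lintegral_prod _ (by fun_prop), ← lintegral_const]
      refine lintegral_mono fun y => ?_
      simpa only [edist_comm] using hpot₁ y
    refine (mul_le_mul' le_rfl hint).trans (le_of_eq ?_)
    have hWt : W₁ * μ Set.univ ≠ ∞ := ENNReal.mul_ne_top hW₁ (measure_ne_top _ _)
    rw [← ENNReal.ofReal_toReal hWt, ← ENNReal.ofReal_mul (by positivity),
      ENNReal.toReal_ofReal ENNReal.toReal_nonneg]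
    congr 1
    rw [show 2 * (1 + t) + (s - 1 - τ - 2 * t) = 2 + (s - 1) - τ by ring,
      Real.rpow_sub hd (2 + (s - 1)), Real.rpow_add hd, Real.rpow_two]
    ring

theorem volume_hasCoverExponent_planeProj_eq_zero (h : IsShortArc J g₀ g₁ g₂ m M)
    {B : Set E3} {μ : Measure E3} [IsFiniteMeasure μ] (hμ : μ ≠ 0) (hB : μ Bᶜ = 0) {Rad : ℝ}
    (hRad : 0 < Rad) (hsupp : ∀ᵐ y ∂μ, ‖y‖ ≤ Rad) {C s : ℝ} (hC : 0 < C)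
    (hfro : ∀ y r, 0 < r → μ (Metric.closedBall y r) ≤ ENNReal.ofReal (C * r ^ s)) (hs : 1 < s)
    {σ : ℝ} (hσ : (σ - 1) * (2 * s - 1) < (s - 1) ^ 2) :
    volume {θ ∈ J | HasCoverExponent (planeProj g₀ θ) B σ} = 0 := by
  have h1 : σ - 1 < (s - 1) ^ 2 / (2 * s - 1) := by rwa [lt_div_iff₀ (by linarith)]
  have h2 : 0 < (s - 1) ^ 2 / (2 * s - 1) := div_pos (by nlinarith) (by linarith)
  obtain ⟨t, ht1, ht2⟩ := exists_between (max_lt h1 h2)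
  rw [max_lt_iff] at ht1
  rw [lt_div_iff₀ (by linarith)] at ht2
  -- With `p` near `s`, a `τ` is needed with `t / (s - 1) < τ < s - 1 - 2 t`. The interval is
  -- nonempty exactly when `t (2 s - 1) < (s - 1)²`.
  have h3 : t / (s - 1) < s - 1 - 2 * t := by
    rw [div_lt_iff₀ (by linarith)]
    nlinarith
  obtain ⟨τ, hτ1, hτ2⟩ := exists_between h3
  have hτ0 : 0 < τ := (div_pos ht1.2 (by linarith)).trans hτ1
  have h4 : 1 + t / τ < s := by
    rw [div_lt_iff₀ (by linarith)] at hτ1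
    have : t / τ < s - 1 := by rw [div_lt_iff₀ hτ0]; linarith
    linarith
  obtain ⟨p, hp1, hp2⟩ := exists_between h4
  have h5 : 0 < t / τ := div_pos ht1.2 hτ0
  refine h.volume_hasCoverExponent_planeProj_eq_zero_of_params hμ hB hRad hsupp hC hfro (t := t)
    (τ := τ) (p := p) (by linarith) (by linarith) hp2 ?_ hτ2
  have h6 : t / τ < p - 1 := by linarith
  rw [div_lt_iff₀ hτ0] at h6
  linarith

end IsShortArc

/-! ### Triples of projections onto lines -/

/-- A set on which points at distance at most `η` are in fact at distance at most `q` is covered by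
`O(η⁻³)` pieces of diameter `q`. -/
theorem measure_le_of_norm_sub_gap {μ : Measure E3} {C s Rad : ℝ} (hC : 0 < C)
    (hRad : 0 < Rad)
    (hfro : ∀ y r, 0 < r → μ (Metric.closedBall y r) ≤ ENNReal.ofReal (C * r ^ s)) {S : Set E3}
    (hS : ∀ y ∈ S, ‖y‖ ≤ Rad) {η q : ℝ} (hη : 0 < η) (hη1 : η ≤ 1) (hq : 0 < q)
    (hgap : ∀ y ∈ S, ∀ y' ∈ S, ‖y - y'‖ ≤ η → ‖y - y'‖ ≤ q) :
    μ S ≤ ENNReal.ofReal (((4 * Rad + 1) / η) ^ 3 * (C * q ^ s)) := by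
  set n := ⌊4 * Rad / η⌋₊ + 1 with hn
  have hnd : (n : ℝ) ≤ (4 * Rad + 1) / η := by
    have h1 : (⌊4 * Rad / η⌋₊ : ℝ) ≤ 4 * Rad / η := Nat.floor_le (by positivity)
    have h2 : 1 ≤ 1 / η := by rwa [one_le_div₀ hη]
    rw [hn, add_div]
    push_cast
    linarith
  have hcoord : ∀ y ∈ S, ∀ i, 0 ≤ y i + Rad ∧ y i + Rad ≤ 2 * Rad := by
    intro y hy i
    have h1 := (PiLp.norm_apply_le y i).trans (hS y hy)
    rw [Real.norm_eq_abs, abs_le] at h1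
    constructor <;> linarith
  -- Cubes of side `η / 2` have diameter below `η`, so within each of them the gap hypothesis
  -- applies.
  let T : (Fin 3 → Fin n) → Set E3 := fun k =>
    {y | y ∈ S ∧ ∀ i, ⌊(y i + Rad) / (η / 2)⌋₊ = (k i : ℕ)}
  have hT : ∀ k, μ (T k) ≤ ENNReal.ofReal (C * q ^ s) := by
    intro k
    refine measure_le_of_forall_norm_sub_le hfro hq ?_
    rintro y ⟨hy, hyk⟩ y' ⟨hy', hyk'⟩
    refine hgap y hy y' hy' ?_
    have key : ∀ z ∈ S, ∀ i, ⌊(z i + Rad) / (η / 2)⌋₊ = (k i : ℕ) →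
        ((k i : ℕ) : ℝ) * (η / 2) ≤ z i + Rad ∧ z i + Rad ≤ ((k i : ℕ) + 1 : ℝ) * (η / 2) := by
      intro z hz i hzi
      have h2 : 0 ≤ (z i + Rad) / (η / 2) := div_nonneg (hcoord z hz i).1 (by positivity)
      rw [← hzi, ← le_div_iff₀ (by positivity), ← div_le_iff₀ (by positivity)]
      exact ⟨Nat.floor_le h2, (Nat.lt_floor_add_one _).le⟩
    have hi : ∀ i, ((y - y') i) ^ 2 ≤ (η / 2) ^ 2 := by
      intro i
      have h1 := key y hy i (hyk i)
      have h2 := key y' hy' i (hyk' i)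
      rw [sq_le_sq, abs_of_pos (half_pos hη), PiLp.sub_apply, abs_le]
      constructor <;> linarith
    refine le_of_sq_le_sq ?_ hη.le
    rw [EuclideanSpace.real_norm_sq_eq, Fin.sum_univ_three]
    have h0 := hi 0
    have h1 := hi 1
    have h2 := hi 2
    nlinarith
  refine (measure_le_card_mul (T := T) ?_ hT).trans ?_
  · intro y hy
    have hlt : ∀ i, ⌊(y i + Rad) / (η / 2)⌋₊ < n := by
      intro i
      rw [hn, Nat.lt_succ_iff]
      refine Nat.floor_le_floor ?_
      rw [div_le_div_iff₀ (by positivity) hη]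
      nlinarith [(hcoord y hy i).2]
    exact ⟨fun i => ⟨_, hlt i⟩, hy, fun i => rfl⟩
  · have hcard : Fintype.card (Fin 3 → Fin n) = n ^ 3 := by simp
    rw [hcard, ← ENNReal.ofReal_natCast, ← ENNReal.ofReal_mul (Nat.cast_nonneg _)]
    refine ENNReal.ofReal_le_ofReal (mul_le_mul_of_nonneg_right ?_ (by positivity))
    push_cast
    exact pow_le_pow_left₀ (Nat.cast_nonneg _) hnd 3

/-- Expanding the square, its part quadratic in `n` is at most `n / 2` by `hsmall` and is absorbed
on the left. -/
theorem le_of_le_quadratic {K A m M r β d n : ℝ} (hK : 0 < K) (hA : 0 < A) (hm : 0 < m)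
    (hM : 0 < M) (hr : 0 < r) (hβ : 0 < β) (hn : 0 ≤ n) (hd : d ≤ β ^ 2 / r ^ 2)
    (h : n ≤ K * (2 * (2 * d) + A * ((2 * β + M * n) / (m * r)) ^ 2))
    (hsmall : n ≤ m ^ 2 / (4 * K * A * M ^ 2) * r ^ 2) :
    n ≤ (8 * K + 16 * K * A / m ^ 2) * (β ^ 2 / r ^ 2) := by
  have e1 : ((2 * β + M * n) / (m * r)) ^ 2 ≤
      8 / m ^ 2 * (β ^ 2 / r ^ 2) + 2 * M ^ 2 * n ^ 2 / (m ^ 2 * r ^ 2) := by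
    have : 8 / m ^ 2 * (β ^ 2 / r ^ 2) + 2 * M ^ 2 * n ^ 2 / (m ^ 2 * r ^ 2) =
        (8 * β ^ 2 + 2 * M ^ 2 * n ^ 2) / (m * r) ^ 2 := by
      field_simp
    rw [this, div_pow]
    refine div_le_div_of_nonneg_right ?_ (by positivity)
    linarith [sq_nonneg (2 * β - M * n)]
  have e2 : K * (A * (2 * M ^ 2 * n ^ 2 / (m ^ 2 * r ^ 2))) ≤ n / 2 := by
    have h5 : K * (A * (2 * M ^ 2 * n ^ 2 / (m ^ 2 * r ^ 2))) =
        n / 2 * (n / (m ^ 2 / (4 * K * A * M ^ 2) * r ^ 2)) := by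
      field_simp
      ring
    rw [h5]
    refine mul_le_of_le_one_right (by positivity) ?_
    rwa [div_le_one₀ (by positivity)]
  have e3 := h.trans (mul_le_mul_of_nonneg_left (add_le_add (mul_le_mul_of_nonneg_left
    (mul_le_mul_of_nonneg_left hd zero_le_two) zero_le_two)
    (mul_le_mul_of_nonneg_left e1 hA.le)) hK.le)
  have e4 : K * (2 * (2 * (β ^ 2 / r ^ 2)) + A * (8 / m ^ 2 * (β ^ 2 / r ^ 2) +
      2 * M ^ 2 * n ^ 2 / (m ^ 2 * r ^ 2))) = (8 * K + 16 * K * A / m ^ 2) * (β ^ 2 / r ^ 2) / 2 +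
      K * (A * (2 * M ^ 2 * n ^ 2 / (m ^ 2 * r ^ 2))) := by ring
  linarith

namespace IsShortArc

variable {J : Set ℝ} {g₀ g₁ g₂ : ℝ → E3} {m M : ℝ}

/-- A vector orthogonal to three points of the arc gives a function with three zeros; by Rolle its
first and second derivatives also vanish somewhere, against the trichotomy. -/
theorem span_eq_top (h : IsShortArc J g₀ g₁ g₂ m M) {a b c : ℝ} (ha : a ∈ J) (hb : b ∈ J)
    (hc : c ∈ J) (hab : a ≠ b) (hbc : b ≠ c) (hac : a ≠ c) :
    Submodule.span ℝ {g₀ a, g₀ b, g₀ c} = ⊤ := by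
  rw [← Submodule.orthogonal_eq_bot_iff, eq_bot_iff]
  intro w hw
  rw [Submodule.mem_orthogonal] at hw
  have wa : inner ℝ (g₀ a) w = 0 := hw _ (Submodule.subset_span (by simp))
  have wb : inner ℝ (g₀ b) w = 0 := hw _ (Submodule.subset_span (by simp))
  have wc : inner ℝ (g₀ c) w = 0 := hw _ (Submodule.subset_span (by simp))
  have key : ∀ {v : E3}, m * ‖w‖ ≤ |inner ℝ v w| → inner ℝ v w = 0 → w = 0 := by
    intro v h1 h2
    rw [h2, abs_zero] at h1
    simpa using nonpos_of_mul_nonpos_right h1 h.m_pos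
  rw [Submodule.mem_bot]
  obtain ⟨x, hxJ, hx1, hx2, hx⟩ :=
    rolle_of_ne h.ordConnected (h.hasDerivAt_inner₀ w) ha hb hab (wa.trans wb.symm)
  obtain ⟨y, hyJ, hy1, hy2, hy⟩ :=
    rolle_of_ne h.ordConnected (h.hasDerivAt_inner₀ w) hb hc hbc (wb.trans wc.symm)
  obtain ⟨z, hzJ, hz1, hz2, hz⟩ :=
    rolle_of_ne h.ordConnected (h.hasDerivAt_inner₀ w) ha hc hac (wa.trans wc.symm)
  rcases h.trichotomy w with h0 | h0 | h0
  · exact key (h0 a ha) wa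
  · exact key (h0 x hxJ) hx
  · by_cases hxy : x = y
    · by_cases hxz : x = z
      -- No order of `a`, `b`, `c` is assumed. One point cannot lie strictly between the members of
      -- all three pairs, so two of the zeros of the derivative are distinct.
      · subst hxy hxz
        exfalso
        rw [min_lt_iff] at hx1 hy1 hz1
        rw [lt_max_iff] at hx2 hy2 hz2
        rcases hx1 with hx1 | hx1 <;> rcases hx2 with hx2 | hx2 <;> rcases hy1 with hy1 | hy1 <;>
          rcases hy2 with hy2 | hy2 <;> rcases hz1 with hz1 | hz1 <;> rcases hz2 with hz2 | hz2 <;>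
          linarith
      · obtain ⟨v, hvJ, -, -, hv⟩ := rolle_of_ne h.ordConnected (h.hasDerivAt_inner₁ w) hxJ hzJ hxz
          (hx.trans hz.symm)
        exact key (h0 v hvJ) hv
    · obtain ⟨v, hvJ, -, -, hv⟩ := rolle_of_ne h.ordConnected (h.hasDerivAt_inner₁ w) hxJ hyJ hxy
        (hx.trans hy.symm)
      exact key (h0 v hvJ) hv

theorem exists_norm_le_inner (h : IsShortArc J g₀ g₁ g₂ m M) {a b c : ℝ} (ha : a ∈ J) (hb : b ∈ J)
    (hc : c ∈ J) (hab : a ≠ b) (hbc : b ≠ c) (hac : a ≠ c) :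
    ∃ K > 0, ∃ e > 0, Metric.ball a e ⊆ J ∧ Metric.ball b e ⊆ J ∧ Metric.ball c e ⊆ J ∧
      ∀ θ₁ ∈ Metric.ball a e, ∀ θ₂ ∈ Metric.ball b e, ∀ θ₃ ∈ Metric.ball c e, ∀ (w : E3) (l : ℝ),
        |inner ℝ (g₀ θ₁) w| ≤ l → |inner ℝ (g₀ θ₂) w| ≤ l → |inner ℝ (g₀ θ₃) w| ≤ l →
          ‖w‖ ≤ K * l := by
  obtain ⟨k, hk, hkz⟩ := exists_mul_norm_le_of_span_eq_top (h.span_eq_top ha hb hc hab hbc hac)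
  have hnear : ∀ x ∈ J, ∃ r > 0, ∀ θ ∈ Metric.ball x r, θ ∈ J ∧ ‖g₀ θ - g₀ x‖ < k / 2 := by
    intro x hx
    have e1 : ∀ᶠ θ in 𝓝 x, θ ∈ J := h.isOpen.mem_nhds hx
    have e2 : ∀ᶠ θ in 𝓝 x, ‖g₀ θ - g₀ x‖ < k / 2 := by
      have := (h.hasDerivAt₀ x hx).continuousAt.eventually (Metric.ball_mem_nhds _ (half_pos hk))
      simpa [dist_eq_norm] using this
    exact Metric.eventually_nhds_iff_ball.1 (e1.and e2)
  obtain ⟨r₁, hr₁, hr₁'⟩ := hnear a ha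
  obtain ⟨r₂, hr₂, hr₂'⟩ := hnear b hb
  obtain ⟨r₃, hr₃, hr₃'⟩ := hnear c hc
  set e := min r₁ (min r₂ r₃) with he
  replace hr₁' : ∀ θ ∈ Metric.ball a e, _ := fun θ hθ =>
    hr₁' θ (Metric.ball_subset_ball (min_le_left _ _) hθ)
  replace hr₂' : ∀ θ ∈ Metric.ball b e, _ := fun θ hθ =>
    hr₂' θ (Metric.ball_subset_ball ((min_le_right _ _).trans (min_le_left _ _)) hθ)
  replace hr₃' : ∀ θ ∈ Metric.ball c e, _ := fun θ hθ =>
    hr₃' θ (Metric.ball_subset_ball ((min_le_right _ _).trans (min_le_right _ _)) hθ)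
  refine ⟨2 / k, by positivity, e, by positivity, fun θ hθ => (hr₁' θ hθ).1,
    fun θ hθ => (hr₂' θ hθ).1, fun θ hθ => (hr₃' θ hθ).1, ?_⟩
  intro θ₁ h₁ θ₂ h₂ θ₃ h₃ w l l₁ l₂ l₃
  have hpert : ∀ {u v : E3}, ‖u - v‖ < k / 2 → |inner ℝ u w| ≤ l →
      |inner ℝ v w| ≤ l + k / 2 * ‖w‖ := by
    intro u v huv hu
    have h2 : inner ℝ v w = inner ℝ u w - inner ℝ (u - v) w := by rw [inner_sub_left]; ring
    rw [h2]
    refine (abs_sub _ _).trans (add_le_add hu ((abs_real_inner_le_norm _ _).trans ?_))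
    exact mul_le_mul_of_nonneg_right huv.le (norm_nonneg _)
  have h4 := (hkz w).trans (max_le (hpert (hr₁' θ₁ h₁).2 l₁)
    (max_le (hpert (hr₂' θ₂ h₂).2 l₂) (hpert (hr₃' θ₃ h₃).2 l₃)))
  rw [div_mul_eq_mul_div, le_div_iff₀ hk]
  linarith

/-- If the planes orthogonal to `g₀ θ` and `g₀ θ'` are nearly tangent, along `x - y` and `x - y'`, to
the cone with vertex `x`, then `y - y'` is nearly orthogonal to `g₀ θ`. -/
theorem abs_inner_sub_le_of_tangent (h : IsShortArc J g₀ g₁ g₂ m M) {Rad δ β r : ℝ}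
    (hr : 0 < r) (hβ : 0 < β) (hδr : δ < m * r) (hβr : β < m * r) {θ θ' : ℝ} (hθ : θ ∈ J)
    (hθ' : θ' ∈ J) {x y y' : E3} (hz : r ≤ ‖x - y‖) (hz' : ‖x - y'‖ ≤ 2 * Rad)
    (hrz' : r ≤ ‖x - y'‖) (h₀ : |inner ℝ (g₀ θ) (x - y)| ≤ δ) (h₁ : |inner ℝ (g₁ θ) (x - y)| ≤ β)
    (h₀' : |inner ℝ (g₀ θ') (x - y')| ≤ δ) (h₁' : |inner ℝ (g₁ θ') (x - y')| ≤ β) :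
    |inner ℝ (g₀ θ) (y - y')| ≤
      2 * δ + (m + M) * Rad * ((2 * β + M * ‖y - y'‖) / (m * r)) ^ 2 := by
  have hm := h.m_pos
  have hmz : m * r ≤ m * ‖x - y‖ := mul_le_mul_of_nonneg_left hz hm.le
  have hM : 0 < M := zero_lt_one.trans_le h.one_le
  have hRad : 0 < Rad := by linarith
  -- The thresholds on `δ` and `β` exclude the first two alternatives of the trichotomy.
  have h2 : ∀ t ∈ J, m * ‖x - y‖ ≤ |inner ℝ (g₂ t) (x - y)| := by
    rcases h.trichotomy (x - y) with h0 | h0 | h0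
    · have := h0 θ hθ
      linarith
    · have := h0 θ hθ
      linarith
    · exact h0
  set w := y - y' with hw
  set Δ := (2 * β + M * ‖w‖) / (m * r) with hΔ
  have hmr : 0 < m * r := mul_pos hm hr
  have hβΔ : 2 * β ≤ m * r * Δ := by
    rw [hΔ, mul_div_cancel₀ _ hmr.ne']
    have : 0 ≤ M * ‖w‖ := by positivity
    linarith
  have hΔ0 : 0 < Δ := by positivity
  -- The parameter of tangency is where the first derivative is nearly zero. As the second
  -- derivative is large, moving `y` to `y'` shifts it by at most `Δ`.
  have hdist : |θ - θ'| ≤ Δ := by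
    have h3 := abs_sub_ge_of_abs_deriv_ge h.ordConnected (h.hasDerivAt_inner₁ (x - y))
      (fun t ht => hmz.trans (h2 t ht)) hθ' hθ
    have h4 : inner ℝ (g₁ θ') (x - y) = inner ℝ (g₁ θ') (x - y') - inner ℝ (g₁ θ') w := by
      rw [← inner_sub_right, hw]
      congr 1
      abel
    have h5 : |inner ℝ (g₁ θ') w| ≤ M * ‖w‖ := (abs_real_inner_le_norm _ _).trans
      (mul_le_mul_of_nonneg_right (h.norm_le₁ θ' hθ') (norm_nonneg _))
    rw [h4] at h3
    rw [hΔ, le_div_iff₀ hmr]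
    have h6 := abs_sub (inner ℝ (g₁ θ) (x - y)) (inner ℝ (g₁ θ') (x - y') - inner ℝ (g₁ θ') w)
    have h7 := abs_sub (inner ℝ (g₁ θ') (x - y')) (inner ℝ (g₁ θ') w)
    linarith
  -- At `θ'` both value and derivative are small, so the value at `θ` is `O(δ + Δ²)`.
  obtain ⟨c, hc, hce⟩ := exists_taylor_two h.ordConnected (h.hasDerivAt_inner₀ (x - y'))
    (h.hasDerivAt_inner₁ (x - y')) hθ' hθ
  have hsplit : inner ℝ (g₀ θ) w = inner ℝ (g₀ θ) (x - y') - inner ℝ (g₀ θ) (x - y) := by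
    rw [← inner_sub_right, hw]
    congr 1
    abel
  have t1 : |inner ℝ (g₁ θ') (x - y') * (θ - θ')| ≤ m * Rad * Δ ^ 2 := by
    rw [abs_mul]
    calc |inner ℝ (g₁ θ') (x - y')| * |θ - θ'| ≤ β * Δ :=
          mul_le_mul h₁' hdist (abs_nonneg _) hβ.le
      _ ≤ m * Rad * Δ ^ 2 := by
          have h8 : β ≤ m * Rad * Δ := by nlinarith [mul_pos hm hΔ0]
          nlinarith
  have t2 : |inner ℝ (g₂ c) (x - y') / 2 * (θ - θ') ^ 2| ≤ M * Rad * Δ ^ 2 := by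
    have h9 : |inner ℝ (g₂ c) (x - y')| ≤ M * (2 * Rad) := (abs_real_inner_le_norm _ _).trans
      (mul_le_mul (h.norm_le₂ c hc) hz' (norm_nonneg _) hM.le)
    rw [abs_mul, abs_div, abs_two, abs_pow]
    refine mul_le_mul (by linarith) (pow_le_pow_left₀ (abs_nonneg _) hdist 2) (by positivity)
      (by positivity)
  rw [hsplit, hce]
  have t3 := abs_sub (inner ℝ (g₀ θ') (x - y') + inner ℝ (g₁ θ') (x - y') * (θ - θ') +
    inner ℝ (g₂ c) (x - y') / 2 * (θ - θ') ^ 2) (inner ℝ (g₀ θ) (x - y))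
  have t4 := abs_add_three (inner ℝ (g₀ θ') (x - y')) (inner ℝ (g₁ θ') (x - y') * (θ - θ'))
    (inner ℝ (g₂ c) (x - y') / 2 * (θ - θ') ^ 2)
  linarith

/-- The points `y`, not too close to `x`, such that `x - y` nearly annihilates both `g₀` and its
derivative at some parameter in `I`. -/
def tangentSet (g₀ g₁ : ℝ → E3) (d β r : ℝ) (I : Set ℝ) (x : E3) : Set E3 :=
  {y | ∃ θ ∈ I, |inner ℝ (g₀ θ) (x - y)| ≤ 2 * d ∧ |inner ℝ (g₁ θ) (x - y)| ≤ β ∧ r ≤ ‖x - y‖}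

/-- The difference of two points of the set is nearly orthogonal to three independent normals, with
an error quadratic in its own length. Hence differences below `κ r²` are in fact `O(β² / r²)`, and
about `r⁻⁶` balls of that size suffice. -/
theorem exists_measure_joint_tangent_le (h : IsShortArc J g₀ g₁ g₂ m M) {a b c : ℝ} (ha : a ∈ J)
    (hb : b ∈ J) (hc : c ∈ J) (hab : a ≠ b) (hbc : b ≠ c) (hac : a ≠ c) {μ : Measure E3}
    {C s Rad : ℝ} (hC : 0 < C) (hRad : 0 < Rad)
    (hfro : ∀ y r, 0 < r → μ (Metric.closedBall y r) ≤ ENNReal.ofReal (C * r ^ s)) :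
    ∃ e > 0, Metric.ball a e ⊆ J ∧ Metric.ball b e ⊆ J ∧ Metric.ball c e ⊆ J ∧ ∃ D > 0,
      ∀ d r β, 0 < d → 0 < r → r ≤ 1 → 0 < β → d ≤ β ^ 2 → 2 * d < m * r → β < m * r →
      ∀ x₁ x₂ x₃ : E3, ‖x₁‖ ≤ Rad → ‖x₂‖ ≤ Rad → ‖x₃‖ ≤ Rad →
        μ {y | ‖y‖ ≤ Rad ∧ y ∈ tangentSet g₀ g₁ d β r (Metric.ball a e) x₁ ∧
          y ∈ tangentSet g₀ g₁ d β r (Metric.ball b e) x₂ ∧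
          y ∈ tangentSet g₀ g₁ d β r (Metric.ball c e) x₃} ≤
            ENNReal.ofReal (D * (r ^ 6)⁻¹ * (β ^ 2 / r ^ 2) ^ s) := by
  obtain ⟨K, hK, e, he, haJ, hbJ, hcJ, hnorm⟩ := h.exists_norm_le_inner ha hb hc hab hbc hac
  have hm := h.m_pos
  have hM : 0 < M := zero_lt_one.trans_le h.one_le
  set A := (m + M) * Rad with hA
  have hA0 : 0 < A := by positivity
  set κ := min 1 (m ^ 2 / (4 * K * A * M ^ 2)) with hκ
  have hκ0 : 0 < κ := by positivity
  set L := 8 * K + 16 * K * A / m ^ 2 with hL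
  have hL0 : 0 < L := by positivity
  refine ⟨e, he, haJ, hbJ, hcJ, ((4 * Rad + 1) / κ) ^ 3 * (C * L ^ s), by positivity, ?_⟩
  intro d r β hd hr hr1 hβ hdβ hdr hβr x₁ x₂ x₃ hx₁ hx₂ hx₃
  have hη1 : κ * r ^ 2 ≤ 1 :=
    mul_le_one₀ (min_le_left _ _) (by positivity) (pow_le_one₀ hr.le hr1)
  have hd2 : d ≤ β ^ 2 / r ^ 2 := by
    rw [le_div_iff₀ (by positivity)]
    have := pow_le_one₀ hr.le hr1 (n := 2)
    nlinarith
  refine (measure_le_of_norm_sub_gap hC hRad hfro (η := κ * r ^ 2) (q := L * (β ^ 2 / r ^ 2))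
    (fun y hy => hy.1) (by positivity) hη1 (by positivity) ?_).trans (le_of_eq ?_)
  · rintro y ⟨hy, ⟨θ₁, h₁, p₁⟩, ⟨θ₂, h₂, p₂⟩, ⟨θ₃, h₃, p₃⟩⟩ y' ⟨hy', ⟨θ₁', h₁', p₁'⟩,
      ⟨θ₂', h₂', p₂'⟩, ⟨θ₃', h₃', p₃'⟩⟩ hyy
    have key : ∀ {θ θ' : ℝ} {x : E3}, θ ∈ J → θ' ∈ J → ‖x‖ ≤ Rad →
        (|inner ℝ (g₀ θ) (x - y)| ≤ 2 * d ∧ |inner ℝ (g₁ θ) (x - y)| ≤ β ∧ r ≤ ‖x - y‖) →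
        (|inner ℝ (g₀ θ') (x - y')| ≤ 2 * d ∧ |inner ℝ (g₁ θ') (x - y')| ≤ β ∧ r ≤ ‖x - y'‖) →
        |inner ℝ (g₀ θ) (y - y')| ≤ 2 * (2 * d) + A * ((2 * β + M * ‖y - y'‖) / (m * r)) ^ 2 := by
      intro θ θ' x hθ hθ' hx q q'
      exact h.abs_inner_sub_le_of_tangent hr hβ hdr hβr hθ hθ' q.2.2
        ((_root_.norm_sub_le _ _).trans (by linarith)) q'.2.2 q.1 q.2.1 q'.1 q'.2.1
    have hw := hnorm θ₁ h₁ θ₂ h₂ θ₃ h₃ (y - y') _ (key (haJ h₁) (haJ h₁') hx₁ p₁ p₁')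
      (key (hbJ h₂) (hbJ h₂') hx₂ p₂ p₂') (key (hcJ h₃) (hcJ h₃') hx₃ p₃ p₃')
    exact le_of_le_quadratic hK hA0 hm hM hr hβ (norm_nonneg _) hd2 hw
      (hyy.trans (mul_le_mul_of_nonneg_right (min_le_right _ _) (by positivity)))
  · congr 1
    rw [Real.mul_rpow hL0.le (by positivity)]
    field_simp

/-- Here the singularity is `‖x - y‖ ^ (-1/2)`, so any `p > 1/2` yields a gain `r ^ (p - 1/2)`. -/
theorem volume_inner_near_le (h : IsShortArc J g₀ g₁ g₂ m M) {p r d : ℝ} (hp : 1 / 2 < p)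
    (hr : 0 < r) (hd : 0 < d) (x y : E3) :
    volume {θ ∈ J | |inner ℝ (g₀ θ) (x - y)| ≤ d ∧ ‖x - y‖ < r} ≤
      ENNReal.ofReal (6 * √(d / m) * r ^ (p - 1 / 2)) * edist x y ^ (-p) := by
  have hm := h.m_pos
  have hrp := Real.rpow_pos_of_pos hr (p - 1 / 2)
  have hsq : 0 < √(d / m) := Real.sqrt_pos.2 (by positivity)
  rcases eq_or_ne x y with rfl | hxy
  · rw [const_mul_edist_self_rpow _ (by linarith)]
    · exact le_top
    · have : 0 < 6 * √(d / m) * r ^ (p - 1 / 2) := by positivity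
      rw [ENNReal.ofReal_ne_zero_iff]
      exact this
  have h0 : 0 < ‖x - y‖ := norm_pos_iff.2 (sub_ne_zero.2 hxy)
  rcases le_or_gt r ‖x - y‖ with hle | hlt
  · have : {θ ∈ J | |inner ℝ (g₀ θ) (x - y)| ≤ d ∧ ‖x - y‖ < r} = ∅ := by
      ext θ
      simp only [Set.mem_ofPred_eq, Set.mem_empty_iff_false, iff_false]
      exact fun hθ => absurd hθ.2.2 (not_lt.2 hle)
    rw [this]; simp
  refine (measure_mono (t := {θ ∈ J | |inner ℝ (g₀ θ) (x - y)| ≤ d}) fun θ hθ =>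
    ⟨hθ.1, hθ.2.1⟩).trans ((h.volume_inner_le (sub_ne_zero.2 hxy) hd).trans ?_)
  rw [edist_dist, dist_eq_norm, ENNReal.ofReal_rpow_of_pos h0, ← ENNReal.ofReal_mul (by positivity)]
  refine ENNReal.ofReal_le_ofReal ?_
  have h1 : ‖x - y‖ ^ (p - 1 / 2) ≤ r ^ (p - 1 / 2) := Real.rpow_le_rpow h0.le hlt.le (by linarith)
  have h2 : √(d / (m * ‖x - y‖)) = √(d / m) * (‖x - y‖ ^ (p - 1 / 2) * ‖x - y‖ ^ (-p)) := by
    rw [← Real.rpow_add h0, show p - 1 / 2 + -p = -(1 / 2) by ring, Real.rpow_neg h0.le,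
      ← Real.sqrt_eq_rpow, ← div_div, Real.sqrt_div (by positivity), div_eq_mul_inv]
  rw [h2]
  calc 6 * (√(d / m) * (‖x - y‖ ^ (p - 1 / 2) * ‖x - y‖ ^ (-p)))
      ≤ 6 * (√(d / m) * (r ^ (p - 1 / 2) * ‖x - y‖ ^ (-p))) := by gcongr
    _ = _ := by ring

end IsShortArc

/-! ### Exceptional lines. -/

namespace IsShortArc

variable {J : Set ℝ} {g₀ g₁ g₂ : ℝ → E3} {m M : ℝ}

/-- Pairs closer than `δ^τ` are negligible by `hτp`, and pairs with slope above `β = δ^(1/2 - τ')`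
by `hτ'`. For the rest, three parameter lengths `δ^((1 - τ)/2)` and the confinement of `y` beat
`δ^(3(1/2 + t))`; `hsum` is this comparison of exponents. -/
theorem volume_hasCoverExponent_lineProj_eq_zero_of_params (h : IsShortArc J g₀ g₁ g₂ m M)
    {B : Set E3} {μ : Measure E3} [IsFiniteMeasure μ] (hμ : μ ≠ 0) (hB : μ Bᶜ = 0) {Rad : ℝ}
    (hRad : 0 < Rad) (hsupp : ∀ᵐ y ∂μ, ‖y‖ ≤ Rad) {C s : ℝ} (hC : 0 < C)
    (hfro : ∀ y r, 0 < r → μ (Metric.closedBall y r) ≤ ENNReal.ofReal (C * r ^ s))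
    {σ t τ τ' p : ℝ} (hσ : σ < 1 / 2 + t) (ht : 0 < t) (hp : 1 / 2 < p) (hps : p < s)
    (hτp : t < τ * (p - 1 / 2)) (hτ' : t < τ')
    (hsum : 3 * t + 15 / 2 * τ < s * (1 - 2 * τ' - 2 * τ)) :
    volume {θ ∈ J | HasCoverExponent (lineProj g₀ θ) B σ} = 0 := by
  have hm := h.m_pos
  have hM : 0 < M := zero_lt_one.trans_le h.one_le
  have hτ0 : 0 < τ := by
    by_contra! hcon
    have := mul_nonpos_of_nonpos_of_nonneg hcon (sub_pos.2 hp).le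
    linarith
  have hττ' : 2 * τ' + 2 * τ < 1 := by
    by_contra! hcon
    have : s * (1 - 2 * τ' - 2 * τ) ≤ 0 :=
      mul_nonpos_of_nonneg_of_nonpos (by linarith) (by linarith)
    linarith
  obtain ⟨W, hW, hpot⟩ := exists_lintegral_edist_rpow_le hfro (p := p) (by linarith) hps
  set T : ℕ → Set (ℝ × E3 × E3) := fun j => {w | |inner ℝ (g₀ w.1) (w.2.2 - w.2.1)| ≤ 2 * dyadic j ∧
    ‖w.2.2 - w.2.1‖ < dyadic j ^ τ} with hT
  set T' : ℕ → Set (ℝ × E3 × E3) := fun j => {w | |inner ℝ (g₀ w.1) (w.2.2 - w.2.1)| ≤ 2 * dyadic j ∧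
    dyadic j ^ (1 / 2 - τ') ≤ |inner ℝ (g₁ w.1) (w.2.2 - w.2.1)|} with hT'
  set R : ℕ → Set (ℝ × E3 × E3) := fun j => {w | (|inner ℝ (g₀ w.1) (w.2.2 - w.2.1)| ≤ 2 * dyadic j ∧
    |inner ℝ (g₁ w.1) (w.2.2 - w.2.1)| ≤ dyadic j ^ (1 / 2 - τ') ∧
    dyadic j ^ τ ≤ ‖w.2.2 - w.2.1‖) ∧ ‖w.2.1‖ ≤ Rad ∧ ‖w.2.2‖ ≤ Rad} with hR
  have msub : Measurable fun w : ℝ × E3 × E3 => w.2.2 - w.2.1 :=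
    measurable_snd.snd.sub measurable_snd.fst
  have m₀ : Measurable fun w : ℝ × E3 × E3 => |inner ℝ (g₀ w.1) (w.2.2 - w.2.1)| :=
    ((h.measurable₀.comp measurable_fst).inner msub).abs
  have m₁ : Measurable fun w : ℝ × E3 × E3 => |inner ℝ (g₁ w.1) (w.2.2 - w.2.1)| :=
    ((h.measurable₁.comp measurable_fst).inner msub).abs
  have hTm : ∀ j, MeasurableSet (T j) := by
    intro j
    have h1 := measurableSet_le m₀ (measurable_const (a := 2 * dyadic j))
    have h2 := measurableSet_lt msub.norm (measurable_const (a := dyadic j ^ τ))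
    exact h1.inter h2
  have hTm' : ∀ j, MeasurableSet (T' j) := by
    intro j
    have h1 := measurableSet_le m₀ (measurable_const (a := 2 * dyadic j))
    have h2 := measurableSet_le (measurable_const (a := dyadic j ^ (1 / 2 - τ'))) m₁
    exact h1.inter h2
  have hRm : ∀ j, MeasurableSet (R j) := by
    intro j
    have h1 := measurableSet_le m₀ (measurable_const (a := 2 * dyadic j))
    have h2 := measurableSet_le m₁ (measurable_const (a := dyadic j ^ (1 / 2 - τ')))
    have h2' := measurableSet_le (measurable_const (a := dyadic j ^ τ)) msub.norm
    have h3 : MeasurableSet {w : ℝ × E3 × E3 | ‖w.2.1‖ ≤ Rad} :=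
      measurableSet_le measurable_snd.fst.norm measurable_const
    have h4 : MeasurableSet {w : ℝ × E3 × E3 | ‖w.2.2‖ ≤ Rad} :=
      measurableSet_le measurable_snd.snd.norm measurable_const
    exact (h1.inter (h2.inter h2')).inter (h3.inter h4)
  have hTsmall : ∀ᵐ θ ∂(volume.restrict J), ∀ᵐ y ∂μ, ∀ᶠ j in atTop,
      μ {x | (θ, y, x) ∈ T j} ≤ ENNReal.ofReal (1 / 4 * dyadic j ^ (1 / 2 + t)) := by
    refine ae_ae_eventually_measure_fibre_le hTm (a := τ * (p - 1 / 2) - t)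
      (C := 6 * √(2 / m) * W.toReal) (by linarith) (by norm_num) (Eventually.of_forall fun j y => ?_)
    have hd := dyadic_pos j
    have hpt : ∀ x, (volume.restrict J) {θ | (θ, y, x) ∈ T j} ≤
        ENNReal.ofReal (6 * √(2 * dyadic j / m) * (dyadic j ^ τ) ^ (p - 1 / 2)) *
          edist x y ^ (-p) := by
      intro x
      rw [Measure.restrict_apply' h.isOpen.measurableSet, Set.inter_comm]
      exact h.volume_inner_near_le hp (Real.rpow_pos_of_pos hd τ) (by positivity) x y
    refine (lintegral_mono hpt).trans ?_
    rw [lintegral_const_mul' _ _ ENNReal.ofReal_ne_top]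
    refine (mul_le_mul' le_rfl (hpot y)).trans (le_of_eq ?_)
    rw [← ENNReal.ofReal_toReal hW, ← ENNReal.ofReal_mul (by positivity),
      ENNReal.toReal_ofReal ENNReal.toReal_nonneg]
    congr 1
    rw [← Real.rpow_mul hd.le,
      show 1 / 2 + t + (τ * (p - 1 / 2) - t) = 1 / 2 + τ * (p - 1 / 2) by ring,
      Real.rpow_add hd, ← Real.sqrt_eq_rpow, show 2 * dyadic j / m = 2 / m * dyadic j by ring,
      Real.sqrt_mul (by positivity)]
    ring
  have hTsmall' : ∀ᵐ θ ∂(volume.restrict J), ∀ᵐ y ∂μ, ∀ᶠ j in atTop,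
      μ {x | (θ, y, x) ∈ T' j} ≤ ENNReal.ofReal (1 / 4 * dyadic j ^ (1 / 2 + t)) := by
    refine ae_ae_eventually_measure_fibre_le hTm' (a := τ' - t)
      (C := (4 + 2 * M / m) * 2 * (μ Set.univ).toReal) (by linarith) (by norm_num)
      (Eventually.of_forall fun j y => ?_)
    have hd := dyadic_pos j
    have hpt : ∀ x, (volume.restrict J) {θ | (θ, y, x) ∈ T' j} ≤
        ENNReal.ofReal ((4 + 2 * M / m) * (2 * dyadic j / dyadic j ^ (1 / 2 - τ'))) := by
      intro x
      rw [Measure.restrict_apply' h.isOpen.measurableSet, Set.inter_comm]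
      exact h.volume_inner_steep_le (x - y) (Real.rpow_pos_of_pos hd _) (by positivity)
    refine (lintegral_mono hpt).trans (le_of_eq ?_)
    rw [lintegral_const, ← ENNReal.ofReal_toReal (measure_ne_top μ Set.univ),
      ← ENNReal.ofReal_mul (by positivity), ENNReal.toReal_ofReal ENNReal.toReal_nonneg]
    congr 1
    rw [show 1 / 2 + t + (τ' - t) = 1 - (1 / 2 - τ') by ring, Real.rpow_sub hd 1, Real.rpow_one]
    ring
  set E := {θ ∈ J | HasCoverExponent (lineProj g₀ θ) B σ} with hEdef
  set E' := {θ ∈ E | ∀ᵐ y ∂μ, ∀ᶠ j in atTop,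
    ENNReal.ofReal (1 / 2 * dyadic j ^ (1 / 2 + t)) ≤ μ {x | (θ, y, x) ∈ R j}} with hE'
  have hEE' : volume E = 0 ∨ volume E' ≠ 0 := by
    rw [or_iff_not_imp_right, not_not]
    intro h0
    rw [ae_restrict_iff' h.isOpen.measurableSet] at hTsmall hTsmall'
    have h1 : ∀ᵐ θ : ℝ, θ ∉ E' := measure_eq_zero_iff_ae_notMem.1 h0
    refine measure_eq_zero_iff_ae_notMem.2 ?_
    filter_upwards [h1, hTsmall, hTsmall'] with θ hθ1 hθ2 hθ3 hθE
    refine hθ1 ⟨hθE, ?_⟩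
    filter_upwards [hθ2 hθE.1, hθ3 hθE.1, hθE.2.ae_eventually_le hσ hB, hsupp] with y hy1 hy1' hy2 hy3
    filter_upwards [hy1, hy1', hy2] with j hj1 hj1' hj2
    have hdt : 0 ≤ dyadic j ^ (1 / 2 + t) := Real.rpow_nonneg (dyadic_pos j).le _
    have hj3 : μ {x | (θ, y, x) ∈ T j} + μ {x | (θ, y, x) ∈ T' j} ≤
        ENNReal.ofReal (1 / 2 * dyadic j ^ (1 / 2 + t)) := by
      refine (add_le_add hj1 hj1').trans (le_of_eq ?_)
      rw [← ENNReal.ofReal_add (by positivity) (by positivity)]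
      congr 1
      ring
    refine ofReal_half_mul_le_of_le_add hdt (hj2.trans ?_) hj3
    refine (measure_mono_ae ?_).trans ((measure_union_le ({x | (θ, y, x) ∈ T j} ∪
      {x | (θ, y, x) ∈ T' j}) {x | (θ, y, x) ∈ R j}).trans
        (add_le_add_left (measure_union_le _ _) _))
    filter_upwards [hsupp] with x hx hxm
    have hxm' : dist (lineProj g₀ θ x) (lineProj g₀ θ y) ≤ 2 * dyadic j := hxm
    rw [dist_lineProj] at hxm'
    rcases lt_or_ge ‖x - y‖ (dyadic j ^ τ) with hlt | hge
    · exact Or.inl (Or.inl ⟨hxm', hlt⟩)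
    rcases le_total (dyadic j ^ (1 / 2 - τ')) |inner ℝ (g₁ θ) (x - y)| with hle | hle
    · exact Or.inl (Or.inr ⟨hxm', hle⟩)
    · exact Or.inr ⟨⟨hxm', hle, hge⟩, hy3, hx⟩
  rcases hEE' with h0 | h0
  · exact h0
  exfalso
  obtain ⟨a, haE, -, ha⟩ := exists_notMem_forall_nhds_pos h0 Set.finite_empty
  obtain ⟨b, hbE, hba, hb⟩ := exists_notMem_forall_nhds_pos h0 (Set.finite_singleton a)
  obtain ⟨c, hcE, hcab, hc⟩ := exists_notMem_forall_nhds_pos h0 (Set.toFinite {a, b})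
  simp only [Set.mem_singleton_iff, Set.mem_insert_iff, not_or] at hba hcab
  obtain ⟨e, he, haJ, hbJ, hcJ, D, hD, hjoint⟩ := h.exists_measure_joint_tangent_le haE.1.1 hbE.1.1
    hcE.1.1 (Ne.symm hba) (Ne.symm hcab.2) (Ne.symm hcab.1) hC hRad hfro
  have hfib : ∀ {c : ℝ}, Metric.ball c e ⊆ J → ∀ (j : ℕ) (y x : E3),
      (volume.restrict (Metric.ball c e)) {θ | (θ, y, x) ∈ R j} ≠ 0 →
      (‖y‖ ≤ Rad ∧ ‖x‖ ≤ Rad ∧ y ∈ tangentSet g₀ g₁ (dyadic j) (dyadic j ^ (1 / 2 - τ'))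
        (dyadic j ^ τ) (Metric.ball c e) x) ∧
      (volume.restrict (Metric.ball c e)) {θ | (θ, y, x) ∈ R j} ≤
        ENNReal.ofReal (6 * √(2 / m) * dyadic j ^ ((1 - τ) / 2)) := by
    intro c hcJ j y x hne
    have hd := dyadic_pos j
    have hdτ := Real.rpow_pos_of_pos hd τ
    rw [Measure.restrict_apply' measurableSet_ball, Set.inter_comm] at hne ⊢
    obtain ⟨θ, hθ⟩ := nonempty_of_measure_ne_zero hne
    refine ⟨⟨hθ.2.2.1, hθ.2.2.2, θ, hθ.1, hθ.2.1⟩, ?_⟩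
    have hz : 0 < ‖x - y‖ := hdτ.trans_le hθ.2.1.2.2
    refine (measure_mono (t := {θ ∈ J | |inner ℝ (g₀ θ) (x - y)| ≤ 2 * dyadic j}) fun φ hφ =>
      ⟨hcJ hφ.1, hφ.2.1.1⟩).trans ((h.volume_inner_le (norm_pos_iff.1 hz) (by positivity)).trans
        (ENNReal.ofReal_le_ofReal ?_))
    have h1 : 2 * dyadic j / (m * ‖x - y‖) ≤ 2 / m * dyadic j ^ (1 - τ) := by
      rw [Real.rpow_sub hd, Real.rpow_one, div_mul_div_comm]
      exact div_le_div_of_nonneg_left (by positivity) (by positivity)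
        (mul_le_mul_of_nonneg_left hθ.2.1.2.2 hm.le)
    have h2 : dyadic j ^ ((1 - τ) / 2) = √(dyadic j ^ (1 - τ)) := by
      rw [Real.sqrt_eq_rpow, ← Real.rpow_mul hd.le]
      congr 1
      ring
    rw [h2, mul_assoc, ← Real.sqrt_mul (by positivity)]
    exact mul_le_mul_of_nonneg_left (Real.sqrt_le_sqrt h1) (by norm_num)
  set v : ℕ → ℝ := fun j => 6 * √(2 / m) * dyadic j ^ ((1 - τ) / 2) with hv
  have hv0 : ∀ j, 0 ≤ v j := fun j =>
    mul_nonneg (by positivity) (Real.rpow_nonneg (dyadic_pos j).le _)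
  -- Only small scales qualify: the tangency estimate needs `2 δ < m δ^τ` and `β < m δ^τ`.
  have hinc : ∀ᶠ j in atTop, ∀ X : E3 × E3 × E3,
      ∫⁻ y, (volume.restrict (Metric.ball a e)) {θ | (θ, y, X.1) ∈ R j} *
        ((volume.restrict (Metric.ball b e)) {θ | (θ, y, X.2.1) ∈ R j} *
        (volume.restrict (Metric.ball c e)) {θ | (θ, y, X.2.2) ∈ R j}) ∂μ ≤
      ENNReal.ofReal (v j ^ 3 * (D * ((dyadic j ^ τ) ^ 6)⁻¹ *
        ((dyadic j ^ (1 / 2 - τ')) ^ 2 / (dyadic j ^ τ) ^ 2) ^ s)) := by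
    filter_upwards [eventually_dyadic_rpow_lt (a := 1 - τ) (c := m / 2) (by linarith) (by positivity),
      eventually_dyadic_rpow_lt (a := 1 / 2 - τ' - τ) (c := m) (by linarith) hm] with j hj1 hj2
    rintro ⟨x₁, x₂, x₃⟩
    have hd := dyadic_pos j
    have hdτ := Real.rpow_pos_of_pos hd τ
    have hβ := Real.rpow_pos_of_pos hd (1 / 2 - τ')
    rw [Real.rpow_sub hd, Real.rpow_one, div_lt_iff₀ hdτ] at hj1
    rw [Real.rpow_sub hd _ τ, div_lt_iff₀ hdτ] at hj2
    by_cases hx : ‖x₁‖ ≤ Rad ∧ ‖x₂‖ ≤ Rad ∧ ‖x₃‖ ≤ Rad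
    swap
    · have hz : ∀ y, (volume.restrict (Metric.ball a e)) {θ | (θ, y, x₁) ∈ R j} *
          ((volume.restrict (Metric.ball b e)) {θ | (θ, y, x₂) ∈ R j} *
          (volume.restrict (Metric.ball c e)) {θ | (θ, y, x₃) ∈ R j}) = 0 := by
        intro y
        rw [mul_eq_zero, mul_eq_zero]
        by_contra! hne
        exact hx ⟨(hfib haJ j y x₁ hne.1).1.2.1, (hfib hbJ j y x₂ hne.2.1).1.2.1,
          (hfib hcJ j y x₃ hne.2.2).1.2.1⟩
      simp only [hz, lintegral_zero]
      exact zero_le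
    have hdβ : dyadic j ≤ (dyadic j ^ (1 / 2 - τ')) ^ 2 := by
      rw [← Real.rpow_natCast, ← Real.rpow_mul hd.le]
      conv_lhs => rw [← Real.rpow_one (dyadic j)]
      refine Real.rpow_le_rpow_of_exponent_ge hd (dyadic_le_one j) ?_
      push_cast
      linarith
    have hS := hjoint (dyadic j) (dyadic j ^ τ) (dyadic j ^ (1 / 2 - τ')) hd hdτ
      (Real.rpow_le_one hd.le (dyadic_le_one j) hτ0.le) hβ hdβ (by linarith) hj2 x₁ x₂ x₃ hx.1 hx.2.1
      hx.2.2
    set S := {y | ‖y‖ ≤ Rad ∧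
      y ∈ tangentSet g₀ g₁ (dyadic j) (dyadic j ^ (1 / 2 - τ')) (dyadic j ^ τ) (Metric.ball a e) x₁ ∧
      y ∈ tangentSet g₀ g₁ (dyadic j) (dyadic j ^ (1 / 2 - τ')) (dyadic j ^ τ) (Metric.ball b e) x₂ ∧
      y ∈ tangentSet g₀ g₁ (dyadic j) (dyadic j ^ (1 / 2 - τ')) (dyadic j ^ τ) (Metric.ball c e) x₃}
      with hSdef
    have hpt : ∀ y, (volume.restrict (Metric.ball a e)) {θ | (θ, y, x₁) ∈ R j} *
        ((volume.restrict (Metric.ball b e)) {θ | (θ, y, x₂) ∈ R j} *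
        (volume.restrict (Metric.ball c e)) {θ | (θ, y, x₃) ∈ R j}) ≤
        S.indicator (fun _ => ENNReal.ofReal (v j ^ 3)) y := by
      intro y
      by_cases hne : (volume.restrict (Metric.ball a e)) {θ | (θ, y, x₁) ∈ R j} *
          ((volume.restrict (Metric.ball b e)) {θ | (θ, y, x₂) ∈ R j} *
          (volume.restrict (Metric.ball c e)) {θ | (θ, y, x₃) ∈ R j}) = 0
      · rw [hne]
        exact zero_le
      rw [mul_eq_zero, mul_eq_zero] at hne
      push Not at hne
      have f₁ := hfib haJ j y x₁ hne.1
      have f₂ := hfib hbJ j y x₂ hne.2.1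
      have f₃ := hfib hcJ j y x₃ hne.2.2
      have hyS : y ∈ S := ⟨f₁.1.1, f₁.1.2.2, f₂.1.2.2, f₃.1.2.2⟩
      rw [Set.indicator_of_mem hyS, show v j ^ 3 = v j * (v j * v j) by ring,
        ENNReal.ofReal_mul (hv0 j), ENNReal.ofReal_mul (hv0 j)]
      exact mul_le_mul' f₁.2 (mul_le_mul' f₂.2 f₃.2)
    refine (lintegral_mono hpt).trans ((lintegral_indicator_const_le _ _).trans ?_)
    rw [ENNReal.ofReal_mul (pow_nonneg (hv0 j) 3)]
    exact mul_le_mul' le_rfl hS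
  have key := null_or_null_or_null_of_incidences hμ (lam₁ := volume.restrict (Metric.ball a e))
    (lam₂ := volume.restrict (Metric.ball b e)) (lam₃ := volume.restrict (Metric.ball c e)) hRm
    (σ := 1 / 2 + t) (c := 1 / 2) (a := s * (1 - 2 * τ' - 2 * τ) - (3 * t + 15 / 2 * τ))
    (C := (6 * √(2 / m)) ^ 3 * D * ((μ.prod (μ.prod μ)) Set.univ).toReal) (by linarith)
    (by norm_num) (hinc.mono fun j hj => ?_) (A₁ := E') (A₂ := E') (A₃ := E') (fun θ hθ => hθ.2)
    (fun θ hθ => hθ.2) (fun θ hθ => hθ.2)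
  · rw [Measure.restrict_apply' measurableSet_ball, Measure.restrict_apply' measurableSet_ball,
      Measure.restrict_apply' measurableSet_ball] at key
    rcases key with h1 | h1 | h1
    · exact ha _ (Metric.ball_mem_nhds _ he) h1
    · exact hb _ (Metric.ball_mem_nhds _ he) h1
    · exact hc _ (Metric.ball_mem_nhds _ he) h1
  · have hd := dyadic_pos j
    refine (lintegral_mono hj).trans (le_of_eq ?_)
    rw [lintegral_const, ← ENNReal.ofReal_toReal (measure_ne_top (μ.prod (μ.prod μ)) Set.univ),
      ENNReal.toReal_ofReal ENNReal.toReal_nonneg, ← ENNReal.ofReal_mul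
      (mul_nonneg (pow_nonneg (hv0 j) 3) (by positivity))]
    congr 1
    have e1 : (dyadic j ^ ((1 - τ) / 2)) ^ 3 = dyadic j ^ (3 / 2 * (1 - τ)) := by
      rw [← Real.rpow_natCast, ← Real.rpow_mul hd.le]
      congr 1
      push_cast
      ring
    have e2 : ((dyadic j ^ τ) ^ 6)⁻¹ = dyadic j ^ (-(6 * τ)) := by
      rw [← Real.rpow_natCast, ← Real.rpow_mul hd.le, ← Real.rpow_neg hd.le]
      congr 1
      push_cast
      ring
    have e3 : ((dyadic j ^ (1 / 2 - τ')) ^ 2 / (dyadic j ^ τ) ^ 2) ^ s =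
        dyadic j ^ (s * (1 - 2 * τ' - 2 * τ)) := by
      rw [← div_pow, ← Real.rpow_sub hd, ← Real.rpow_natCast, ← Real.rpow_mul hd.le,
        ← Real.rpow_mul hd.le]
      congr 1
      push_cast
      ring
    -- The right side collects `3/2 (1 - τ)` from the parameters, `-6 τ` from the number of balls
    -- and `s (1 - 2 τ' - 2 τ)` from their mass.
    have e4 : 3 * (1 / 2 + t) + (s * (1 - 2 * τ' - 2 * τ) - (3 * t + 15 / 2 * τ)) =
        3 / 2 * (1 - τ) + (-(6 * τ) + s * (1 - 2 * τ' - 2 * τ)) := by ring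
    rw [e4, Real.rpow_add hd, Real.rpow_add hd, e2, e3, hv, mul_pow, e1]
    ring

theorem volume_hasCoverExponent_lineProj_eq_zero (h : IsShortArc J g₀ g₁ g₂ m M)
    {B : Set E3} {μ : Measure E3} [IsFiniteMeasure μ] (hμ : μ ≠ 0) (hB : μ Bᶜ = 0) {Rad : ℝ}
    (hRad : 0 < Rad) (hsupp : ∀ᵐ y ∂μ, ‖y‖ ≤ Rad) {C s : ℝ} (hC : 0 < C)
    (hfro : ∀ y r, 0 < r → μ (Metric.closedBall y r) ≤ ENNReal.ofReal (C * r ^ s)) (hs : 1 / 2 < s)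
    {σ : ℝ} (hσ : (σ - 1 / 2) * (4 * s ^ 2 + 8 * s + 12) < s * (2 * s - 1)) :
    volume {θ ∈ J | HasCoverExponent (lineProj g₀ θ) B σ} = 0 := by
  have hq : 0 < 4 * s ^ 2 + 8 * s + 12 := by positivity
  have h1 : σ - 1 / 2 < s * (2 * s - 1) / (4 * s ^ 2 + 8 * s + 12) := by rwa [lt_div_iff₀ hq]
  have h2 : 0 < s * (2 * s - 1) / (4 * s ^ 2 + 8 * s + 12) :=
    div_pos (mul_pos (by linarith) (by linarith)) hq
  obtain ⟨t, ht1, ht2⟩ := exists_between (max_lt h1 h2)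
  rw [max_lt_iff] at ht1
  rw [lt_div_iff₀ hq] at ht2
  have hs2 : 0 < s - 1 / 2 := by linarith
  -- The limiting choice is `p = s`, `τ = τ₀`, `τ' = t`. There the last condition becomes `t (2 s² +
  -- 4 s + 6) < s (s - 1/2)`, which is `ht2`.
  set τ₀ := t / (s - 1 / 2) with hτ₀
  have hτ₀t : τ₀ * (s - 1 / 2) = t := div_mul_cancel₀ _ hs2.ne'
  have hG : 0 < s - (3 * t + 15 / 2 * τ₀ + s * (2 * t + 2 * τ₀)) := by
    have h3 : 0 < (s - (3 * t + 15 / 2 * τ₀ + s * (2 * t + 2 * τ₀))) * (s - 1 / 2) := by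
      have h4 : (s - (3 * t + 15 / 2 * τ₀ + s * (2 * t + 2 * τ₀))) * (s - 1 / 2) =
          s * (s - 1 / 2) - (3 + 2 * s) * t * (s - 1 / 2) -
            (15 / 2 + 2 * s) * (τ₀ * (s - 1 / 2)) := by ring
      rw [h4, hτ₀t]
      linarith
    exact pos_of_mul_pos_left h3 hs2.le
  set G := s - (3 * t + 15 / 2 * τ₀ + s * (2 * t + 2 * τ₀)) with hGdef
  have hk : 0 < 15 / 2 + 4 * s := by linarith
  -- Raising `τ` and `τ'` by `ε` makes the other conditions strict and uses half of the slack `G`.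
  set ε := G / (2 * (15 / 2 + 4 * s)) with hε
  have hε0 : 0 < ε := by positivity
  have hεG : (15 / 2 + 4 * s) * ε = G / 2 := by
    rw [hε]
    field_simp
  have hτ0 : 0 < τ₀ + ε := by
    have : 0 < τ₀ := div_pos ht1.2 hs2
    linarith
  have h5 : t / (τ₀ + ε) < s - 1 / 2 := by
    rw [div_lt_iff₀ hτ0]
    nlinarith
  have h6 : 0 < t / (τ₀ + ε) := div_pos ht1.2 hτ0
  obtain ⟨p, hp1, hp2⟩ := exists_between (show 1 / 2 + t / (τ₀ + ε) < s by linarith)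
  refine h.volume_hasCoverExponent_lineProj_eq_zero_of_params hμ hB hRad hsupp hC hfro (t := t)
    (τ := τ₀ + ε) (τ' := t + ε) (p := p) (by linarith) ht1.2 (by linarith) hp2 ?_ (by linarith) ?_
  · have h7 : t / (τ₀ + ε) < p - 1 / 2 := by linarith
    rw [div_lt_iff₀ hτ0] at h7
    linarith
  · have h8 : s * (1 - 2 * (t + ε) - 2 * (τ₀ + ε)) - (3 * t + 15 / 2 * (τ₀ + ε)) =
        G - (15 / 2 + 4 * s) * ε := by rw [hGdef]; ring
    linarith

end IsShortArc

/-! ### The main theorem -/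

theorem exists_frostman_bounded {B : Set E3} (hB : AnalyticSet B) {t : ℝ} (ht : 0 < t)
    (hdim : ENNReal.ofReal t < dimH B) :
    ∃ μ : Measure E3, IsFiniteMeasure μ ∧ μ ≠ 0 ∧ μ Bᶜ = 0 ∧
      (∃ Rad > 0, ∀ᵐ y ∂μ, ‖y‖ ≤ Rad) ∧
      ∃ C, 0 < C ∧ ∀ y r, 0 < r → μ (Metric.closedBall y r) ≤ ENNReal.ofReal (C * r ^ t) := by
  obtain ⟨μ, hfin, hμ, ⟨K, hKB, hK, hμK⟩, hfro⟩ := exists_frostman hB ht hdim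
  refine ⟨μ, hfin, hμ, measure_mono_null (Set.compl_subset_compl.2 hKB) hμK, ?_, hfro⟩
  obtain ⟨Rad, hRad, hsub⟩ := hK.isBounded.subset_closedBall_lt 0 0
  refine ⟨Rad, hRad, ?_⟩
  filter_upwards [measure_eq_zero_iff_ae_notMem.1 hμK] with y hy
  simpa using hsub (not_not.1 hy)

/-- A property of directions that fails almost surely on short arcs fails almost surely along a
nondegenerate curve. -/
theorem IsNondegenerateCurve.volume_eq_zero {U : Set ℝ} {γ : ℝ → E3}
    (h : IsNondegenerateCurve U γ) {P : E3 → Prop}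
    (hP : ∀ J g₀ g₁ g₂ m M, IsShortArc J g₀ g₁ g₂ m M → volume {θ ∈ J | P (g₀ θ)} = 0) :
    volume {θ ∈ U | P (γ θ)} = 0 := by
  refine measure_null_of_locally_null _ fun θ₀ hθ₀ => ?_
  obtain ⟨J, hJ, -, g₀, g₁, g₂, m, M, harc, hg⟩ := h.exists_isShortArc hθ₀.1
  refine ⟨{θ ∈ U | P (γ θ)} ∩ J, inter_mem_nhdsWithin _ hJ,
    measure_mono_null ?_ (hP J g₀ g₁ g₂ m M harc)⟩
  rintro θ ⟨⟨-, hθP⟩, hθJ⟩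
  refine ⟨hθJ, ?_⟩
  rwa [hg θ hθJ]

theorem volume_lineProj_lt_eq_zero {U : Set ℝ} {γ : ℝ → E3} (h : IsNondegenerateCurve U γ)
    {B : Set E3} (hB : AnalyticSet B) {s σ : ℝ} (hs : 1 / 2 < s) (hdim : ENNReal.ofReal s < dimH B)
    (hσ : (σ - 1 / 2) * (4 * s ^ 2 + 8 * s + 12) < s * (2 * s - 1)) :
    volume {θ ∈ U | packingDim (lineProj γ θ '' B) < (σ : EReal)} = 0 := by
  obtain ⟨μ, hfin, hμ, hμB, ⟨Rad, hRad, hsupp⟩, C, hC, hfro⟩ :=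
    exists_frostman_bounded hB (by linarith) hdim
  -- The property is phrased for the vector alone, so it transfers from the curve to its cut-off
  -- arcs.
  refine h.volume_eq_zero (P := fun v => packingDim ((fun x => inner ℝ v x) '' B) < (σ : EReal)) ?_
  intro J g₀ g₁ g₂ m M harc
  refine measure_mono_null (fun θ hθ => ?_)
    (harc.volume_hasCoverExponent_lineProj_eq_zero hμ hμB hRad hsupp hC hfro hs hσ)
  exact ⟨hθ.1, hasCoverExponent_of_packingDim_lt hθ.2⟩

theorem volume_lineProj_lt_eq_zero_of_two_mul_lt {U : Set ℝ} {γ : ℝ → E3}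
    (h : IsNondegenerateCurve U γ) {B : Set E3} (hB : AnalyticSet B) {s σ : ℝ} (hs : 0 < s)
    (hs2 : s ≤ 2) (hdim : ENNReal.ofReal s < dimH B) (hσ : 2 * σ < s) :
    volume {θ ∈ U | packingDim (lineProj γ θ '' B) < (σ : EReal)} = 0 := by
  obtain ⟨μ, hfin, hμ, hμB, -, C, hC, hfro⟩ := exists_frostman_bounded hB hs hdim
  obtain ⟨p, hp1, hp2⟩ := exists_between (max_lt hσ hs)
  rw [max_lt_iff] at hp1
  obtain ⟨W, hW, hpot⟩ := exists_lintegral_edist_rpow_le hfro hp1.2 hp2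
  refine h.volume_eq_zero (P := fun v => packingDim ((fun x => inner ℝ v x) '' B) < (σ : EReal)) ?_
  intro J g₀ g₁ g₂ m M harc
  refine measure_mono_null (fun θ hθ => ?_)
    (harc.volume_hasCoverExponent_eq_zero hμ hμB hp1.2 (hp2.le.trans hs2) hW hpot hp1.1)
  exact ⟨hθ.1, hasCoverExponent_of_packingDim_lt hθ.2⟩

theorem volume_planeProj_lt_eq_zero {U : Set ℝ} {γ : ℝ → E3} (h : IsNondegenerateCurve U γ)
    {B : Set E3} (hB : AnalyticSet B) {s σ : ℝ} (hs : 1 < s) (hdim : ENNReal.ofReal s < dimH B)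
    (hσ : (σ - 1) * (2 * s - 1) < (s - 1) ^ 2) :
    volume {θ ∈ U | packingDim (planeProj γ θ '' B) < (σ : EReal)} = 0 := by
  obtain ⟨μ, hfin, hμ, hμB, ⟨Rad, hRad, hsupp⟩, C, hC, hfro⟩ :=
    exists_frostman_bounded hB (by linarith) hdim
  refine h.volume_eq_zero (P := fun v => packingDim
    ((fun x => (Submodule.span ℝ {v})ᗮ.orthogonalProjectionOnto x) '' B) < (σ : EReal)) ?_
  intro J g₀ g₁ g₂ m M harc
  refine measure_mono_null (fun θ hθ => ?_)
    (harc.volume_hasCoverExponent_planeProj_eq_zero hμ hμB hRad hsupp hC hfro hs hσ)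
  exact ⟨hθ.1, hasCoverExponent_of_packingDim_lt hθ.2⟩

/-! ### From strict to attained exponents. -/

theorem volume_lt_eq_zero_of_forall_lt {U : Set ℝ} {f : ℝ → EReal} {σ : ℝ}
    (h : ∀ σ' < σ, volume {θ ∈ U | f θ < ((σ' : ℝ) : EReal)} = 0) :
    volume {θ ∈ U | f θ < (σ : EReal)} = 0 := by
  -- Rational thresholds make the union countable.
  refine measure_mono_null (t := ⋃ q : {q : ℚ // (q : ℝ) < σ},
    {θ ∈ U | f θ < (((q : ℚ) : ℝ) : EReal)}) ?_ (measure_iUnion_null fun q => h q q.2)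
  rintro θ ⟨hθ, hθσ⟩
  obtain ⟨q, hq1, hq2⟩ := EReal.lt_iff_exists_rat_btwn.1 hθσ
  exact Set.mem_iUnion.2 ⟨⟨q, EReal.coe_lt_coe_iff.1 hq2⟩, hθ, hq1⟩

theorem ae_le_of_volume_lt_eq_zero {U : Set ℝ} {f : ℝ → EReal} {σ : EReal}
    (h : volume {θ ∈ U | f θ < σ} = 0) : ∀ᵐ θ : ℝ, θ ∈ U → σ ≤ f θ := by
  filter_upwards [measure_eq_zero_iff_ae_notMem.1 h] with θ hθ hθU
  exact not_lt.1 fun hlt => hθ ⟨hθU, hlt⟩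

/-- Frostman measures exist only for exponents below the dimension; strict conditions at `s` survive
at a slightly smaller `s'`. -/
theorem Continuous.exists_pos_of_lt {F : ℝ → ℝ} (hF : Continuous F) {l s : ℝ} (hl : l < s)
    (h : 0 < F s) : ∃ s', l < s' ∧ s' < s ∧ 0 < F s' := by
  have h1 : ∀ᶠ x in 𝓝[<] s, 0 < F x :=
    ((hF.tendsto s).eventually (lt_mem_nhds h)).filter_mono nhdsWithin_le_nhds
  obtain ⟨x, hx1, hx2⟩ := (h1.and (Ioo_mem_nhdsLT hl)).exists
  exact ⟨x, hx2.1, hx2.2, hx1⟩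

/-- The argument reaches `s (2 s - 1) / (4 s² + 8 s + 12)`, strictly more than the stated gain. The
difference reduces to `8 s³ - 2 s² - 9 s + 6`, positive for `s > 1/2` with its minimum near `7/10`.
Strictness lets the stated exponent be reached at some `s' < s`, with no limit in `σ`. -/
theorem lineExponent_mul_lt {s : ℝ} (hs : 1 / 2 < s) :
    1 / 2 * ((2 * s - 1) ^ 2 / (12 * s ^ 2 + 4 * s - 1)) * (4 * s ^ 2 + 8 * s + 12) <
      s * (2 * s - 1) := by
  have hq : 0 < 12 * s ^ 2 + 4 * s - 1 := by nlinarith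
  have h1 : (2 * s - 1) * (2 * s ^ 2 + 4 * s + 6) < s * (12 * s ^ 2 + 4 * s - 1) := by
    nlinarith [mul_nonneg (by linarith : (0 : ℝ) ≤ s) (sq_nonneg (s - 7 / 10)),
      sq_nonneg (s - 7 / 10)]
  have h2 : 1 / 2 * ((2 * s - 1) ^ 2 / (12 * s ^ 2 + 4 * s - 1)) * (4 * s ^ 2 + 8 * s + 12) =
      (2 * s - 1) * ((2 * s - 1) * (2 * s ^ 2 + 4 * s + 6)) / (12 * s ^ 2 + 4 * s - 1) := by
    ring
  rw [h2, div_lt_iff₀ hq, mul_comm s, mul_assoc]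
  exact mul_lt_mul_of_pos_left h1 (by linarith)

theorem ae_le_packingDim_lineProj {U : Set ℝ} {γ : ℝ → E3} (h : IsNondegenerateCurve U γ)
    {B : Set E3} (hB : AnalyticSet B) {s : ℝ} (hdim : dimH B = ENNReal.ofReal s) (hs : 1 / 2 < s) :
    ∀ᵐ θ : ℝ, θ ∈ U →
      ((1 / 2 + 1 / 2 * ((2 * s - 1) ^ 2 / (12 * s ^ 2 + 4 * s - 1)) : ℝ) : EReal) ≤
        packingDim (lineProj γ θ '' B) := by
  have hpos := lineExponent_mul_lt hs
  set t := 1 / 2 * ((2 * s - 1) ^ 2 / (12 * s ^ 2 + 4 * s - 1)) with ht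
  obtain ⟨s', h1, h2, h3⟩ := Continuous.exists_pos_of_lt
    (F := fun x => x * (2 * x - 1) - t * (4 * x ^ 2 + 8 * x + 12)) (by fun_prop) hs
    (by linarith)
  refine ae_le_of_volume_lt_eq_zero (volume_lineProj_lt_eq_zero h hB h1 ?_ ?_)
  · rw [hdim, ENNReal.ofReal_lt_ofReal_iff (by linarith)]
    exact h2
  · rw [add_sub_cancel_left]
    linarith

theorem ae_half_le_packingDim_lineProj {U : Set ℝ} {γ : ℝ → E3} (h : IsNondegenerateCurve U γ)
    {B : Set E3} (hB : AnalyticSet B) {s : ℝ} (hdim : dimH B = ENNReal.ofReal s) (hs : 0 < s)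
    (hs2 : s ≤ 2) :
    ∀ᵐ θ : ℝ, θ ∈ U → ((s / 2 : ℝ) : EReal) ≤ packingDim (lineProj γ θ '' B) := by
  refine ae_le_of_volume_lt_eq_zero (volume_lt_eq_zero_of_forall_lt fun σ hσ => ?_)
  obtain ⟨s', h1, h2⟩ := exists_between (max_lt (show 2 * σ < s by linarith) hs)
  rw [max_lt_iff] at h1
  refine volume_lineProj_lt_eq_zero_of_two_mul_lt h hB h1.2 (h2.le.trans hs2) ?_ h1.1
  rwa [hdim, ENNReal.ofReal_lt_ofReal_iff hs]

theorem ae_le_packingDim_planeProj {U : Set ℝ} {γ : ℝ → E3} (h : IsNondegenerateCurve U γ)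
    {B : Set E3} (hB : AnalyticSet B) {s : ℝ} (hdim : dimH B = ENNReal.ofReal s) (hs : 1 < s) :
    ∀ᵐ θ : ℝ, θ ∈ U →
      ((1 + (s - 1) ^ 2 / (2 * s - 1) : ℝ) : EReal) ≤ packingDim (planeProj γ θ '' B) := by
  refine ae_le_of_volume_lt_eq_zero (volume_lt_eq_zero_of_forall_lt fun σ hσ => ?_)
  have h0 : σ - 1 < (s - 1) ^ 2 / (2 * s - 1) := by linarith
  rw [lt_div_iff₀ (by linarith)] at h0
  obtain ⟨s', h1, h2, h3⟩ := Continuous.exists_pos_of_lt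
    -- For planes the stated exponent is the limit of the method, so every `σ` below it is treated
    -- first.
    (F := fun x => (x - 1) ^ 2 - (σ - 1) * (2 * x - 1)) (by fun_prop) hs (by linarith)
  refine volume_planeProj_lt_eq_zero h hB h1 ?_ (by linarith)
  rwa [hdim, ENNReal.ofReal_lt_ofReal_iff (by linarith)]

theorem theorem1p3 :
    ∃ σ₁ σ₂ : ℝ → ℝ,
      (∀ s : ℝ, 1 / 2 < s → 1 / 2 < σ₁ s ∧
        1 / 2 + 1 / 2 * ((2 * s - 1) ^ 2 / (12 * s ^ 2 + 4 * s - 1)) ≤ σ₁ s ∧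
        (s ≤ 2 → s / 2 ≤ σ₁ s)) ∧
      (∀ s : ℝ, 1 < s → 1 < σ₂ s ∧ 1 + (s - 1) ^ 2 / (2 * s - 1) ≤ σ₂ s) ∧
      ∀ (U : Set ℝ) (γ : ℝ → E3), IsNondegenerateCurve U γ →
        ∀ B : Set E3, AnalyticSet B → ∀ s : ℝ, dimH B = ENNReal.ofReal s →
          (1 / 2 < s → ∀ᵐ θ : ℝ, θ ∈ U → (σ₁ s : EReal) ≤ packingDim (lineProj γ θ '' B)) ∧
          (1 < s → ∀ᵐ θ : ℝ, θ ∈ U → (σ₂ s : EReal) ≤ packingDim (planeProj γ θ '' B)) := by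
  -- The `s / 2` bound is available only for `s ≤ 2`, as the pair estimate has no exponent above
  -- `2`.
  refine ⟨fun s => if s ≤ 2 then
      max (1 / 2 + 1 / 2 * ((2 * s - 1) ^ 2 / (12 * s ^ 2 + 4 * s - 1))) (s / 2)
    else 1 / 2 + 1 / 2 * ((2 * s - 1) ^ 2 / (12 * s ^ 2 + 4 * s - 1)),
    fun s => 1 + (s - 1) ^ 2 / (2 * s - 1), fun s hs => ?_, fun s hs => ⟨?_, le_rfl⟩,
    fun U γ h B hB s hdim => ⟨fun hs => ?_, fun hs => ae_le_packingDim_planeProj h hB hdim hs⟩⟩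
  · have hpos : 0 < 1 / 2 * ((2 * s - 1) ^ 2 / (12 * s ^ 2 + 4 * s - 1)) :=
      mul_pos one_half_pos (div_pos (pow_pos (by linarith) 2) (by nlinarith))
    dsimp only
    split_ifs with hs2
    · exact ⟨lt_max_of_lt_left (by linarith), le_max_left _ _, fun _ => le_max_right _ _⟩
    · exact ⟨by linarith, le_rfl, fun h => absurd h hs2⟩
  · have : 0 < (s - 1) ^ 2 / (2 * s - 1) := div_pos (pow_pos (by linarith) 2) (by linarith)
    linarith
  · dsimp only
    split_ifs with hs2
    · filter_upwards [ae_le_packingDim_lineProj h hB hdim hs,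
        ae_half_le_packingDim_lineProj h hB hdim (by linarith) hs2] with θ h1 h2 hθ
      rcases max_choice (1 / 2 + 1 / 2 * ((2 * s - 1) ^ 2 / (12 * s ^ 2 + 4 * s - 1))) (s / 2)
        with h3 | h3 <;> rw [h3]
      exacts [h1 hθ, h2 hθ]
    · exact ae_le_packingDim_lineProj h hB hdim hs
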